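/- Let $d\ge 1$ and let $V_s(x)=|x|^{-s}$ for $s>0$, $V_0(x)=-\log|x|$, $V_s(x)=-|x|^{-s}$ for $-2<s<0$ on $\mathbb{R}^d$. Let $\mathscr{L}\subset\mathbb{R}^d$ be a (full-rank) lattice with Wigner–Seitz cell $Q=\{x:|x|<|x-z|\ \forall z\in\mathscr{L}\setminus\{0\}\}$ and dual lattice $\mathscr{L}^*=\{k: k\cdot z\in2\pi\mathbb{Z}\ \forall z\in\mathscr{L}\}$, and put $\Omega_R=\bigcup_{z\in\mathscr{L},\,|z|<R}\overline{z+Q}$. For $-2<s<d$ let $V_s^{\mathscr{L}}$ be the $\mathscr{L}$-periodic, locally integrable function (it exists and is unique almost everywhere) with $\int_Q V_s^{\mathscr{L}}=0$ and, for $0\ne k\in\mathscr{L}^*$, $$\int_Q V_s^{\mathscr{L}}(x)e^{-ik\cdot x}\,dx=c_s|k|^{s-d},\qquad c_s=\operatorname{sgn}(s)\frac{2^{d-s}\pi^{d/2}\Gamma(\frac{d-s}{2})}{\Gamma(\frac s2)}\ (s\neq0),\qquad c_0=2^{d-1}\pi^{d/2}\Gamma(\tfrac d2),$$ so that $V_s^{\mathscr{L}}$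 has the same Fourier coefficients as $V_s$ at $k\neq0$. For finitely many distinct points set $\mathcal{E}_s(x_1,\dots,x_N)=\sum_{j<k}V_s(x_j-x_k)$ and, for $\rho_b\ge0$ and a bounded measurable set $\Omega$, $$\mathcal{E}_s(x_1,\dots,x_N,\Omega,\rho_b)=\sum_{j<k}V_s(x_j-x_k)-\rho_b\sum_{j}\int_\Omega V_s(x_j-y)\,dy+\frac{\rho_b^2}{2}\iint_{\Omega\times\Omega}V_s(x-y)\,dx\,dy .$$ Let $\mathscr{P}$ be an $\mathscr{L}$-periodic point process on $\mathbb{R}^d$ (a probability law on locally finite configurations, invariant under the translations of $\mathscr{L}$), with finite local moments and with one- and two-point correlation functions $\rho^{(1)},\rho^{(2)}$ satisfying, for some $a,b,C>0$ and almost all $x,y$, $$|\rho^{(2)}(x,y)|\le C e^{-\frac{1}{C|x-y|^a}},\qquad |\rho^{(2)}(x,y)-\rho^{(1)}(x)\rho^{(1)}(y)|\le\frac{C}{1+|x-y|^b}.$$ Let $\mathscr{P}_R$ be the localization of $\mathscr{P}$ to $\Omega_R$ and $\rho_b=|Q|^{-1}\int_Q\rho^{(1)}$. (1) For every real $s>d$,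 $$\lim_{R\to\infty}\frac{\mathbb{E}_{\mathscr{P}_R}[\mathcal{E}_s(\cdot)]}{|\Omega_R|}=\frac1{2|Q|}\iint_{Q\times\mathbb{R}^d}\frac{\rho^{(2)}(x,y)}{|x-y|^s}\,dx\,dy ,$$ where the energies have finite expectation and the integral on the right converges. (2) Let $m=2$, or let $m=4$ if moreover $\int_Q y\,\rho^{(1)}(y)\,dy=0$. For every real $s>-2$ with $\max(d-m,d-b)<s<d$, $$\lim_{R\to\infty}\frac{\mathbb{E}_{\mathscr{P}_R}[\mathcal{E}_s(\cdot,\Omega_R,\rho_b)]}{|\Omega_R|}=e(s):=\frac1{2|Q|}\iint_{Q\times\mathbb{R}^d}V_s(x-y)\big(\rho^{(2)}(x,y)-\rho^{(1)}(x)\rho^{(1)}(y)\big)dx\,dy+\frac1{2|Q|}\iint_{Q\times Q}V_s^{\mathscr{L}}(x-y)\rho^{(1)}(x)\rho^{(1)}(y)\,dx\,dy ,$$ where the energies have finite expectation and both integrals on the right converge absolutely. (3) With $m$ as in (2), $e(s)$ is the analytic continuation of the short-range formula: there is a meromorphic function $F$ on $\{\Re s>\max(d-m,d-b)\}$, analytic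 except possibly at $s=d$, with $F(s)=\frac1{2|Q|}\iint_{Q\times\mathbb{R}^d}\rho^{(2)}(x,y)|x-y|^{-s}dx\,dy$ for $\Re s>d$, and for all real $s>-2$ with $\max(d-m,d-b)<s<d$ we have $e(s)=F(s)$ if $s>0$, $e(s)=-F(s)$ if $s<0$, and $e(0)=F'(0)$ if $s=0$. -/

import Mathlib

open MeasureTheory Filter Topology
open scoped ENNReal

noncomputable section

namespace RieszGas

/-- `ℝᵈ` with its Euclidean norm. -/
abbrev Space (d : ℕ) : Type := EuclideanSpace ℝ (Fin d)

/-- The Riesz potential: `|x|^{-s}` for `s > 0`, `-log |x|` for `s = 0`, `-|x|^{-s}` for `s < 0`. -/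
def riesz {d : ℕ} (s : ℝ) (x : Space d) : ℝ :=
  if 0 < s then ‖x‖ ^ (-s) else if s = 0 then -Real.log ‖x‖ else -‖x‖ ^ (-s)

/-! ### Point configurations and point processes -/

/-- A locally finite configuration of (distinct) points of `ℝᵈ`. -/
@[ext]
structure Config (d : ℕ) where
  /-- the set of points -/
  points : Set (Space d)
  locallyFinite : ∀ D : Set (Space d), Bornology.IsBounded D → (points ∩ D).Finite

/-- The number of points of the configuration `X` in `D`. -/
def Config.count {d : ℕ} (X : Config d) (D : Set (Space d)) : ℕ∞ := (X.points ∩ D).encard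

/-- The σ-algebra generated by the numbers of points in Borel sets. -/
instance Config.instMeasurableSpace (d : ℕ) : MeasurableSpace (Config d) :=
  MeasurableSpace.generateFrom
    {S | ∃ D : Set (Space d), MeasurableSet D ∧ ∃ n : ℕ∞, S = {X | X.count D = n}}

/-- The configuration `X ∩ D`. -/
def Config.restrict {d : ℕ} (D : Set (Space d)) (X : Config d) : Config d where
  points := X.points ∩ D
  locallyFinite := fun B hB =>
    (X.locallyFinite B hB).subset fun _ hx => ⟨hx.1.1, hx.2⟩

/-- The configuration `X + z`. -/
def Config.translate {d : ℕ} (z : Space d) (X : Config d) : Config d where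
  points := {x | x - z ∈ X.points}
  locallyFinite := fun B hB => by
    have h1 : Bornology.IsBounded ((fun x => x - z) '' B) :=
      (LipschitzWith.id.sub (LipschitzWith.const z)).isBounded_image hB
    refine Set.Finite.of_finite_image (f := fun x => x - z)
      ((X.locallyFinite _ h1).subset ?_) (fun _ _ _ _ h => sub_left_injective h)
    rintro _ ⟨x, hx, rfl⟩
    exact ⟨hx.1, x, hx.2, rfl⟩

theorem Config.measurable_restrict {d : ℕ} {D : Set (Space d)} (hD : MeasurableSet D) :
    Measurable (Config.restrict D) := by
  refine measurable_generateFrom ?_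
  rintro _ ⟨B, hB, n, rfl⟩
  refine MeasurableSpace.measurableSet_generateFrom ⟨D ∩ B, hD.inter hB, n, ?_⟩
  ext X
  simp [Config.count, Config.restrict, Set.inter_assoc]

theorem Config.measurable_translate {d : ℕ} (z : Space d) :
    Measurable (Config.translate z) := by
  refine measurable_generateFrom ?_
  rintro _ ⟨B, hB, n, rfl⟩
  refine MeasurableSpace.measurableSet_generateFrom
    ⟨(fun x => x + z) ⁻¹' B, (measurable_add_const z) hB, n, ?_⟩
  ext X
  have h : (X.translate z).points ∩ B
      = (fun x => x + z) '' (X.points ∩ (fun x => x + z) ⁻¹' B) := by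
    ext x
    constructor
    · intro hx
      exact ⟨x - z, ⟨hx.1, by simpa using hx.2⟩, by simp⟩
    · rintro ⟨y, hy, rfl⟩
      exact ⟨by simpa [Config.translate] using hy.1, hy.2⟩
  simp only [Set.mem_preimage, Set.mem_ofPred_eq, Config.count]
  rw [h, (add_left_injective z).encard_image]

/-- The law `P` of a point process is invariant under the translations of the lattice `L`. -/
def IsPeriodic {d : ℕ} (L : Submodule ℤ (Space d)) (P : Measure (Config d)) : Prop :=
  ∀ z ∈ L, MeasurePreserving (Config.translate z) P P

/-- All moments of the number of points in any bounded Borel set are finite. -/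
def HasFiniteLocalMoments {d : ℕ} (P : Measure (Config d)) : Prop :=
  ∀ D : Set (Space d), MeasurableSet D → Bornology.IsBounded D →
    ∀ k : ℕ, ∫⁻ X, (X.count D : ℝ≥0∞) ^ k ∂P < ∞

/-- `ρ` is the one-point correlation function (intensity) of `P`. -/
structure IsOnePointCorrelation {d : ℕ} (P : Measure (Config d)) (ρ : Space d → ℝ) : Prop where
  measurable : Measurable ρ
  nonneg : ∀ x, 0 ≤ ρ x
  lintegral_count : ∀ B : Set (Space d), MeasurableSet B →
    ∫⁻ X, (X.count B : ℝ≥0∞) ∂P = ∫⁻ x in B, ENNReal.ofReal (ρ x)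

/-- `ρ` is the two-point correlation function of `P`: the density of the expected number of
ordered pairs of distinct points. -/
structure IsTwoPointCorrelation {d : ℕ} (P : Measure (Config d))
    (ρ : Space d × Space d → ℝ) : Prop where
  measurable : Measurable ρ
  nonneg : ∀ p, 0 ≤ ρ p
  lintegral_count : ∀ B : Set (Space d × Space d), MeasurableSet B →
    ∫⁻ X, ((X.points.offDiag ∩ B).encard : ℝ≥0∞) ∂P = ∫⁻ p in B, ENNReal.ofReal (ρ p)

/-- The localization of the point process `P` to the set `D`: the law of `X ∩ D`. -/
def localize {d : ℕ} (P : Measure (Config d)) (D : Set (Space d)) : Measure (Config d) :=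
  P.map (Config.restrict D)

/-! ### Energies -/

/-- The Riesz energy `∑_{j<k} V_s(x_j - x_k)` of a finite configuration (each unordered pair is
counted twice in the sum over ordered pairs). -/
def energy {d : ℕ} (s : ℝ) (X : Config d) : ℝ :=
  (1 / 2) * ∑ᶠ p ∈ X.points.offDiag, riesz s (p.1 - p.2)

/-- The energy of a finite configuration with a uniform background of density `ρb` in `Ω`. -/
def jelliumEnergy {d : ℕ} (s : ℝ) (X : Config d) (Ω : Set (Space d)) (ρb : ℝ) : ℝ :=
  energy s X - ρb * (∑ᶠ x ∈ X.points, (∫ y in Ω, riesz s (x - y)))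
    + ρb ^ 2 / 2 * (∫ x in Ω, (∫ y in Ω, riesz s (x - y)))

/-! ### Lattices -/

/-- The Wigner-Seitz cell `Q` of the lattice `L`. -/
def wignerSeitz {d : ℕ} (L : Submodule ℤ (Space d)) : Set (Space d) :=
  {x | ∀ z ∈ L, z ≠ 0 → ‖x‖ < ‖x - z‖}

/-- The volume `|Q|`. -/
def cellVolume {d : ℕ} (L : Submodule ℤ (Space d)) : ℝ := volume.real (wignerSeitz L)

/-- `Ω_R`, the union of the closed cells centered at the lattice points of the ball `B_R`. -/
def cellUnion {d : ℕ} (L : Submodule ℤ (Space d)) (R : ℝ) : Set (Space d) :=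
  ⋃ z ∈ (L : Set (Space d)) ∩ Metric.ball 0 R, closure ((fun x => z + x) '' wignerSeitz L)

/-- The mean density `|Q|⁻¹ ∫_Q ρ`. -/
def meanDensity {d : ℕ} (L : Submodule ℤ (Space d)) (ρ : Space d → ℝ) : ℝ :=
  (cellVolume L)⁻¹ * ∫ x in wignerSeitz L, ρ x

/-- The dual lattice `{k | k·z ∈ 2πℤ for all z ∈ L}`. -/
def dualLattice {d : ℕ} (L : Submodule ℤ (Space d)) : Set (Space d) :=
  {k | ∀ z ∈ L, ∃ n : ℤ, inner ℝ k z = 2 * Real.pi * n}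

/-- The constant `c` such that the Fourier transform `∫ V_s(x) e^{-ik·x} dx` of the Riesz potential
`V_s` (as a tempered distribution) is `c |k|^{s-d}` away from `k = 0`, for `-2 < s < d`. -/
def fourierConst (d : ℕ) (s : ℝ) : ℝ :=
  if s = 0 then 2 ^ ((d : ℝ) - 1) * Real.pi ^ ((d : ℝ) / 2) * Real.Gamma ((d : ℝ) / 2)
  else Real.sign s * (2 ^ ((d : ℝ) - s) * Real.pi ^ ((d : ℝ) / 2) * Real.Gamma (((d : ℝ) - s) / 2)
    / Real.Gamma (s / 2))

/-- `V` is the `L`-periodic Riesz potential `V_s^L`: the (almost everywhere unique) `L`-periodic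
locally integrable function with mean zero and with the same Fourier coefficients as `V_s` at the
nonzero points of the dual lattice. -/
structure IsPeriodicRiesz {d : ℕ} (L : Submodule ℤ (Space d)) (s : ℝ) (V : Space d → ℝ) :
    Prop where
  periodic : ∀ z ∈ L, ∀ x, V (x + z) = V x
  integrable : IntegrableOn V (wignerSeitz L)
  mean_zero : (∫ x in wignerSeitz L, V x) = 0
  fourier : ∀ k ∈ dualLattice L, k ≠ 0 →
    (∫ x in wignerSeitz L, (V x : ℂ) * Complex.exp (-(Complex.I * (inner ℝ k x : ℝ))))
      = ((fourierConst d s * ‖k‖ ^ (s - d) : ℝ) : ℂ)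

/-! ### Limiting energies per unit volume -/

/-- `(2|Q|)⁻¹ ∬_{Q × ℝᵈ} ρ₂(x,y) |x-y|^{-s} dx dy` for complex `s`. -/
def shortRangeEnergy {d : ℕ} (L : Submodule ℤ (Space d)) (ρ₂ : Space d × Space d → ℝ) (s : ℂ) :
    ℂ :=
  1 / (2 * (cellVolume L : ℂ)) *
    (∫ p in wignerSeitz L ×ˢ Set.univ, (ρ₂ p : ℂ) * ((‖p.1 - p.2‖ : ℝ) : ℂ) ^ (-s))

/-- The sum of the truncated-correlation term and of the periodic-potential term, where `V` is the
`L`-periodic Riesz potential. -/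
def longRangeEnergy {d : ℕ} (L : Submodule ℤ (Space d)) (ρ₁ : Space d → ℝ)
    (ρ₂ : Space d × Space d → ℝ) (s : ℝ) (V : Space d → ℝ) : ℝ :=
  1 / (2 * cellVolume L) *
      (∫ p in wignerSeitz L ×ˢ Set.univ, riesz s (p.1 - p.2) * (ρ₂ p - ρ₁ p.1 * ρ₁ p.2))
    + 1 / (2 * cellVolume L) *
      (∫ p in wignerSeitz L ×ˢ wignerSeitz L, V (p.1 - p.2) * ρ₁ p.1 * ρ₁ p.2)

end RieszGas

end

noncomputable section

set_option linter.unusedSectionVars false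

namespace RieszGas

/-! Write ρ₁ = f + c with c the mean density and f a bounded periodic charge density that is neutral
on each cell. By Campbell's formula the expected energies are double integrals over Ω_R × Ω_R. With
background density exactly c the square completes: the expected jellium energy is half the integral
of V_s(x-y) against ρ₂ - ρ₁⊗ρ₁, plus half the self-energy of f (`jellium`). The first integrand,
like ρ₂|x-y|^{-s} for s > d, is invariant under diagonal lattice translations and integrable on Q ×
ℝᵈ, so its average per volume converges because boundary cells are negligible
(`tendsto_setIntegral_cellUnion_prod`).

The self-energy of f need not converge absolutely. Up to an additive constant, V_s is a positive
mixture over t > 0 of e^{-t|x|²} - e^{-t} (`riesz_eq_mix`), and constants disappear against f⊗f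
because Ω_R consists of whole neutral cells. For fixed t the Gaussian self-energy per volume
converges by the same averaging. The limit passes through the t-integral thanks to a bound uniform
in R (`exists_gaussEnergy_bounds`). For t > 1 this bound is t^{-d/2}. For t ≤ 1 the Gaussian is
Taylor expanded around the lattice vector u between two cells; the polynomial part is annihilated by
the vanishing charge (and dipole, if m = 4), which leaves t^{m/2} e^{-t|u|²/4}, and summing over u
gives t^{(m-d)/2}. The resulting Mellin integral converges for d - m < s < d; its value is
`chargeEnergy` (`IsNeutral.tendsto_riesz`).

The periodic potential is the same mixture of periodized Gaussians minus their means. Its Fourier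
coefficients follow from those of a Gaussian (`isPeriodicRiesz_periodicRiesz`), and a Fourier
uniqueness theorem identifies it with any other candidate (`IsPeriodicRiesz.ae_eq`). Unfolding the
lattice sum turns its interaction with f⊗f back into `chargeEnergy`
(`IsNeutral.integral_periodicRiesz_pair`); constants do not interact with a mean zero potential, so
f may be replaced by ρ₁.

For the continuation, the Gaussian mean G of ρ₂ equals N + K t^{-d/2}, where N is the truncated part
plus the self-energy of f (`gaussMean_two`). For Re s > d the Mellin transform of G is Γ(s/2) times
the short-range integral; in a strip to the left of d the transform of N is Γ(s/2) times the
long-range formula. The power t^{-d/2} has no Mellin transform, but splitting at t = 1 shows that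
both equal one analytic function plus 2K/(s-d) (`mellinHalf_eq_glue_of_lt`,
`mellinHalf_eq_glue_of_gt`). The long-range formula is itself analytic further left, also at s ≤ 0.
At s = 0 the factor 1/Γ(s/2) vanishes to first order, which is why the logarithmic energy is the
derivative there (`hasDerivAt_longRangeMean_zero`). -/

/-- The translate of the Wigner-Seitz cell centered at `z`. -/
def cell {d : ℕ} (L : Submodule ℤ (Space d)) (z : Space d) : Set (Space d) :=
  {x | x - z ∈ wignerSeitz L}

/-! ### Wigner-Seitz tiling and volume of the unions of cells -/

section Geometry

variable {d : ℕ} (L : Submodule ℤ (Space d))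

theorem neg_mem_wignerSeitz {x : Space d} (hx : x ∈ wignerSeitz L) : -x ∈ wignerSeitz L := by
  intro z hz hz0
  have h := hx (-z) (L.neg_mem hz) (by simpa using hz0)
  rw [norm_neg]
  calc ‖x‖ < ‖x - -z‖ := h
    _ = ‖-x - z‖ := by rw [← norm_neg]; congr 1; abel

theorem neg_mem_wignerSeitz_iff {x : Space d} : -x ∈ wignerSeitz L ↔ x ∈ wignerSeitz L :=
  ⟨fun h => by simpa using neg_mem_wignerSeitz L h, neg_mem_wignerSeitz L⟩

theorem neg_preimage_wignerSeitz : Neg.neg ⁻¹' wignerSeitz L = wignerSeitz L :=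
  Set.ext fun _ => neg_mem_wignerSeitz_iff L

theorem cell_eq_image (z : Space d) : (fun x => z + x) '' wignerSeitz L = cell L z := by
  ext x
  constructor
  · rintro ⟨y, hy, rfl⟩
    simpa [cell] using hy
  · intro hx
    exact ⟨x - z, hx, by simp⟩

theorem cell_disjoint {z w : Space d} (hz : z ∈ L) (hw : w ∈ L) (h : z ≠ w) :
    Disjoint (cell L z) (cell L w) := by
  rw [Set.disjoint_left]
  intro x hx hx'
  have h1 := hx (w - z) (L.sub_mem hw hz) (sub_ne_zero.2 h.symm)
  have h2 := hx' (z - w) (L.sub_mem hz hw) (sub_ne_zero.2 h)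
  simp only [sub_sub, add_sub_cancel] at h1 h2
  exact lt_asymm h1 h2

/-- Squaring makes the condition linear in `x`, so each cell is an intersection of half-spaces; this
linearity is what the shrinking argument of `mem_closure_cell` uses. -/
theorem lt_sub_norm_iff (x z : Space d) : ‖x‖ < ‖x - z‖ ↔ 2 * inner ℝ x z < ‖z‖ ^ 2 := by
  rw [← sq_lt_sq₀ (norm_nonneg _) (norm_nonneg _), norm_sub_sq_real]
  constructor <;> intro h <;> linarith

theorem le_sub_norm_iff (x z : Space d) : ‖x‖ ≤ ‖x - z‖ ↔ 2 * inner ℝ x z ≤ ‖z‖ ^ 2 := by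
  rw [← sq_le_sq₀ (norm_nonneg _) (norm_nonneg _), norm_sub_sq_real]
  constructor <;> intro h <;> linarith

variable [DiscreteTopology L] [IsZLattice ℝ L]

theorem measurableSet_wignerSeitz : MeasurableSet (wignerSeitz L) := by
  have : wignerSeitz L = ⋂ z : L, {x : Space d | (z : Space d) ≠ 0 → ‖x‖ < ‖x - z‖} := by
    ext x; simp [wignerSeitz]
  rw [this]
  refine MeasurableSet.iInter fun z => ?_
  by_cases hz : (z : Space d) = 0
  · simp [hz]
  · simp only [ne_eq, hz, not_false_eq_true, forall_const]
    exact measurableSet_lt (by fun_prop) (by fun_prop)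

theorem measurableSet_cell (z : Space d) : MeasurableSet (cell L z) :=
  (measurable_sub_const z) (measurableSet_wignerSeitz L)

theorem lattice_inter_finite {B : Set (Space d)} (hB : Bornology.IsBounded B) :
    ((L : Set (Space d)) ∩ B).Finite := by
  have h := Module.Free.chooseBasis ℤ L
  have := ZSpan.setFinite_inter (h.ofZLatticeBasis ℝ) hB
  rw [h.ofZLatticeBasis_span ℝ] at this
  rwa [Set.inter_comm]

theorem exists_lattice_near :
    ∃ c : ℝ, 0 < c ∧ ∀ x : Space d, ∃ z ∈ L, ‖x - z‖ ≤ c := by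
  let h := Module.Free.chooseBasis ℤ L
  refine ⟨∑ i, ‖h.ofZLatticeBasis ℝ L i‖ + 1, by positivity, fun x => ?_⟩
  refine ⟨ZSpan.floor (h.ofZLatticeBasis ℝ) x, ?_, ?_⟩
  · exact (h.ofZLatticeBasis_span ℝ).le (ZSpan.floor (h.ofZLatticeBasis ℝ) x).2
  · have := ZSpan.norm_fract_le (h.ofZLatticeBasis ℝ) x
    rw [ZSpan.fract_apply] at this
    linarith

/-- The ball of radius `‖x‖` around `x` contains the lattice point `0` and only finitely many
others, and every lattice point outside it is farther away. -/
theorem exists_nearest (x : Space d) : ∃ z ∈ L, ∀ w ∈ L, ‖x - z‖ ≤ ‖x - w‖ := by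
  have hfin := lattice_inter_finite L (Metric.isBounded_closedBall (x := x) (r := ‖x‖))
  obtain ⟨z, hz, hmin⟩ := Set.exists_min_image _ (fun z => ‖x - z‖) hfin
    ⟨0, L.zero_mem, by simp⟩
  refine ⟨z, hz.1, fun w hw => ?_⟩
  by_cases hwb : w ∈ Metric.closedBall x ‖x‖
  · exact hmin w ⟨hw, hwb⟩
  · rw [mem_closedBall_iff_norm', not_le] at hwb
    have := hz.2
    rw [mem_closedBall_iff_norm'] at this
    linarith

/-- Ties occur on countably many perpendicular bisectors, each a proper affine subspace and hence
null. Outside them the open cells tile the space. -/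
theorem ae_not_bisector :
    ∀ᵐ x : Space d, ∀ z ∈ L, ∀ w ∈ L, z ≠ w → ‖x - z‖ ≠ ‖x - w‖ := by
  have key : ∀ z w : Space d, z ≠ w → ∀ᵐ x : Space d, ‖x - z‖ ≠ ‖x - w‖ := by
    intro z w h
    have hset : {x : Space d | ‖x - z‖ = ‖x - w‖} = (AffineSubspace.perpBisector z w : Set _) := by
      ext x
      simp [AffineSubspace.mem_perpBisector_iff_dist_eq, dist_eq_norm]
    rw [ae_iff]
    simp only [ne_eq, not_not]
    rw [hset]
    refine Measure.addHaar_affineSubspace _ _ ?_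
    intro htop
    have : z ∈ AffineSubspace.perpBisector z w := htop ▸ AffineSubspace.mem_top _ _ _
    rw [AffineSubspace.mem_perpBisector_iff_dist_eq, dist_self] at this
    exact h (dist_eq_zero.1 this.symm)
  have h2 : ∀ᵐ x : Space d, ∀ z w : L, (z : Space d) ≠ w → ‖x - z‖ ≠ ‖x - w‖ := by
    rw [ae_all_iff]; intro z
    rw [ae_all_iff]; intro w
    by_cases h : (z : Space d) = w
    · simp [h]
    · filter_upwards [key z w h] with x hx _ using hx
  filter_upwards [h2] with x hx z hz w hw
  exact hx ⟨z, hz⟩ ⟨w, hw⟩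

theorem ae_mem_cell : ∀ᵐ x : Space d, ∃ z ∈ L, x ∈ cell L z := by
  filter_upwards [ae_not_bisector L] with x hx
  obtain ⟨z, hz, hmin⟩ := exists_nearest L x
  refine ⟨z, hz, fun w hw hw0 => ?_⟩
  have h1 := hmin (z + w) (L.add_mem hz hw)
  have h2 := hx z hz (z + w) (L.add_mem hz hw) (by simpa using hw0)
  rw [sub_sub]
  exact lt_of_le_of_ne h1 h2

open scoped Pointwise in
theorem vadd_wignerSeitz (z : L) : z +ᵥ wignerSeitz L = cell L z :=
  cell_eq_image L z

instance instVAddInvariantMeasureLattice {d : ℕ} (L : Submodule ℤ (Space d)) :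
    VAddInvariantMeasure L (Space d) volume where
  measure_preimage_vadd z s _ := measure_preimage_add volume (z : Space d) s

theorem isAddFundamentalDomain_wignerSeitz :
    IsAddFundamentalDomain L (wignerSeitz L) (volume : Measure (Space d)) where
  nullMeasurableSet := (measurableSet_wignerSeitz L).nullMeasurableSet
  ae_covers := by
    filter_upwards [ae_mem_cell L] with x ⟨z, hz, hx⟩
    refine ⟨⟨-z, L.neg_mem hz⟩, ?_⟩
    have : (⟨-z, L.neg_mem hz⟩ : L) +ᵥ x = x - z := by
      rw [Submodule.vadd_def]; simp; abel
    rw [this]; exact hx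
  aedisjoint z w h := by
    simp only [Function.onFun]
    rw [vadd_wignerSeitz, vadd_wignerSeitz]
    exact (cell_disjoint L z.2 w.2 (fun h' => h (Subtype.ext h'))).aedisjoint

theorem exists_wignerSeitz_subset :
    ∃ c : ℝ, 0 < c ∧ ∀ x : Space d, (∀ z ∈ L, ‖x‖ ≤ ‖x - z‖) → ‖x‖ ≤ c := by
  obtain ⟨c, hc, h⟩ := exists_lattice_near L
  refine ⟨c, hc, fun x hx => ?_⟩
  obtain ⟨z, hz, hxz⟩ := h x
  exact (hx z hz).trans hxz

/-- A positive bound for the norms of the points of the Wigner-Seitz cell. -/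
def cellRadius : ℝ := (exists_wignerSeitz_subset L).choose

theorem cellRadius_pos : 0 < cellRadius L := (exists_wignerSeitz_subset L).choose_spec.1

theorem norm_le_cellRadius' {x : Space d} (hx : ∀ z ∈ L, ‖x‖ ≤ ‖x - z‖) : ‖x‖ ≤ cellRadius L :=
  (exists_wignerSeitz_subset L).choose_spec.2 x hx

theorem norm_le_cellRadius {x : Space d} (hx : x ∈ wignerSeitz L) : ‖x‖ ≤ cellRadius L := by
  refine norm_le_cellRadius' L fun z hz => ?_
  by_cases h : z = 0
  · simp [h]
  · exact (hx z hz h).le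

theorem isBounded_wignerSeitz : Bornology.IsBounded (wignerSeitz L) :=
  (Metric.isBounded_closedBall (x := 0) (r := cellRadius L)).subset
    fun _ hx => mem_closedBall_zero_iff.2 (norm_le_cellRadius L hx)

theorem isBounded_cell (z : Space d) : Bornology.IsBounded (cell L z) := by
  refine (Metric.isBounded_closedBall (x := z) (r := cellRadius L)).subset fun x hx => ?_
  rw [mem_closedBall_iff_norm]
  exact norm_le_cellRadius L hx

theorem volume_cell (z : Space d) : volume (cell L z) = volume (wignerSeitz L) :=
  (measurePreserving_sub_right volume z).measure_preimage
    (measurableSet_wignerSeitz L).nullMeasurableSet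

theorem volume_wignerSeitz_ne_top : volume (wignerSeitz L) ≠ ∞ :=
  (isBounded_wignerSeitz L).measure_lt_top.ne

theorem volume_wignerSeitz_ne_zero : volume (wignerSeitz L) ≠ 0 :=
  (isAddFundamentalDomain_wignerSeitz L).measure_ne_zero (NeZero.ne _)

theorem cellVolume_pos : 0 < cellVolume L :=
  ENNReal.toReal_pos (volume_wignerSeitz_ne_zero L) (volume_wignerSeitz_ne_top L)

theorem closure_cell_subset {z x : Space d} (hx : x ∈ closure (cell L z)) (w : Space d)
    (hw : w ∈ L) : ‖x - z‖ ≤ ‖x - z - w‖ := by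
  have hcl : IsClosed {x : Space d | ‖x - z‖ ≤ ‖x - z - w‖} :=
    isClosed_le (by fun_prop) (by fun_prop)
  refine closure_minimal (fun y hy => ?_) hcl hx
  by_cases h : w = 0
  · simp [h]
  · exact (hy w hw h).le

/-- Shrinking towards the center by a factor `t < 1` makes all the weak inequalities strict, since
`2t⟨x-z,w⟩ ≤ t‖w‖² < ‖w‖²`; then `t → 1`. -/
theorem mem_closure_cell {z x : Space d} (hx : ∀ w ∈ L, ‖x - z‖ ≤ ‖x - z - w‖) :
    x ∈ closure (cell L z) := by
  have h1 : ∀ t ∈ Set.Ioo (0 : ℝ) 1, z + t • (x - z) ∈ cell L z := by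
    intro t ht w hw hw0
    have := hx w hw
    rw [le_sub_norm_iff] at this
    simp only [add_sub_cancel_left]
    rw [lt_sub_norm_iff, inner_smul_left]
    have hpos : 0 < ‖w‖ ^ 2 := by positivity
    simp only [conj_trivial]
    nlinarith [ht.1, ht.2]
  have h2 : Tendsto (fun t : ℝ => z + t • (x - z)) (𝓝[<] 1) (𝓝 x) := by
    have : Tendsto (fun t : ℝ => z + t • (x - z)) (𝓝 1) (𝓝 (z + (1 : ℝ) • (x - z))) :=
      Continuous.tendsto (by fun_prop) 1
    simp only [one_smul, add_sub_cancel] at this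
    exact this.mono_left nhdsWithin_le_nhds
  refine mem_closure_of_tendsto h2 ?_
  filter_upwards [Ioo_mem_nhdsLT (zero_lt_one' ℝ)] with t ht using h1 t ht

theorem closure_cell_ae_eq {z : Space d} (hz : z ∈ L) :
    (closure (cell L z) : Set (Space d)) =ᵐ[volume] cell L z := by
  filter_upwards [ae_not_bisector L] with x hx
  refine propext ⟨fun h w hw hw0 => ?_, fun h => subset_closure h⟩
  refine lt_of_le_of_ne (closure_cell_subset L h w hw) ?_
  rw [sub_sub]
  exact hx z hz (z + w) (L.add_mem hz hw) (by simpa using hw0)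

/-- The lattice points of the open ball of radius `R`. -/
def latticeBall (R : ℝ) : Finset (Space d) :=
  (lattice_inter_finite L (Metric.isBounded_ball (x := 0) (r := R))).toFinset

theorem mem_latticeBall {R : ℝ} {z : Space d} : z ∈ latticeBall L R ↔ z ∈ L ∧ ‖z‖ < R := by
  simp [latticeBall]

theorem cellUnion_eq (R : ℝ) : cellUnion L R = ⋃ z ∈ latticeBall L R, closure (cell L z) := by
  simp only [cellUnion, cell_eq_image]
  ext x
  simp [mem_latticeBall]

theorem isClosed_cellUnion (R : ℝ) : IsClosed (cellUnion L R) := by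
  rw [cellUnion_eq]
  exact Set.Finite.isClosed_biUnion (Finset.finite_toSet _) fun _ _ => isClosed_closure

theorem measurableSet_cellUnion (R : ℝ) : MeasurableSet (cellUnion L R) :=
  (isClosed_cellUnion L R).measurableSet

theorem isBounded_cellUnion (R : ℝ) : Bornology.IsBounded (cellUnion L R) := by
  rw [cellUnion_eq, Bornology.isBounded_biUnion_finset]
  exact fun z _ => (isBounded_cell L z).closure

theorem cellUnion_ae_eq (R : ℝ) :
    (cellUnion L R : Set (Space d)) =ᵐ[volume] ⋃ z ∈ latticeBall L R, cell L z := by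
  rw [cellUnion_eq]
  have h : ∀ᵐ x : Space d, ∀ z ∈ latticeBall L R, (x ∈ closure (cell L z) ↔ x ∈ cell L z) := by
    rw [Filter.eventually_all_finset]
    intro z hz
    filter_upwards [closure_cell_ae_eq L ((mem_latticeBall L).1 hz).1] with x hx
    exact hx.to_iff
  filter_upwards [h] with x hx
  refine propext ?_
  change x ∈ (⋃ z ∈ latticeBall L R, closure (cell L z)) ↔ x ∈ ⋃ z ∈ latticeBall L R, cell L z
  simp only [Set.mem_iUnion]
  exact exists_congr fun z => exists_congr fun hz => hx z hz

theorem volume_cellUnion (R : ℝ) :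
    volume (cellUnion L R) = (latticeBall L R).card * volume (wignerSeitz L) := by
  rw [measure_congr (cellUnion_ae_eq L R), measure_biUnion_finset]
  · simp [volume_cell]
  · intro z hz w hw h
    exact cell_disjoint L ((mem_latticeBall L).1 hz).1 ((mem_latticeBall L).1 hw).1 h
  · exact fun z _ => measurableSet_cell L z

theorem volumeReal_cellUnion (R : ℝ) :
    volume.real (cellUnion L R) = (latticeBall L R).card * cellVolume L := by
  simp [Measure.real, volume_cellUnion, cellVolume]

theorem cellUnion_subset_ball (R : ℝ) :
    cellUnion L R ⊆ Metric.ball 0 (R + cellRadius L) := by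
  rw [cellUnion_eq]
  refine Set.iUnion₂_subset fun z hz x hx => ?_
  have h1 := norm_le_cellRadius' L (x := x - z) (closure_cell_subset L hx)
  have h2 := ((mem_latticeBall L).1 hz).2
  rw [mem_ball_zero_iff]
  calc ‖x‖ = ‖(x - z) + z‖ := by simp
    _ ≤ ‖x - z‖ + ‖z‖ := norm_add_le _ _
    _ < R + cellRadius L := by linarith

theorem ball_subset_cellUnion (R : ℝ) :
    Metric.ball 0 (R - cellRadius L) ⊆ cellUnion L R := by
  rw [cellUnion_eq]
  intro x hx
  rw [mem_ball_zero_iff] at hx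
  obtain ⟨z, hz, hmin⟩ := exists_nearest L x
  have hn : ∀ w ∈ L, ‖x - z‖ ≤ ‖x - z - w‖ := fun w hw => by
    rw [sub_sub]; exact hmin _ (L.add_mem hz hw)
  have h1 := norm_le_cellRadius' L hn
  refine Set.mem_biUnion (x := z) ?_ (mem_closure_cell L hn)
  refine (mem_latticeBall L).2 ⟨hz, ?_⟩
  calc ‖z‖ = ‖x - (x - z)‖ := by simp
    _ ≤ ‖x‖ + ‖x - z‖ := norm_sub_le _ _
    _ < R := by linarith

/-- The cells indexed by the lattice ball are essentially disjoint with common volume, and their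
union lies between the balls of radii `R - cellRadius L` and `R + cellRadius L`. -/
theorem latticeBall_card_bounds {R : ℝ} (hR : cellRadius L < R) :
    (R - cellRadius L) ^ d * volume.real (Metric.ball (0 : Space d) 1)
        ≤ (latticeBall L R).card * cellVolume L ∧
      (latticeBall L R).card * cellVolume L
        ≤ (R + cellRadius L) ^ d * volume.real (Metric.ball (0 : Space d) 1) := by
  have hc := cellRadius_pos L
  rw [← volumeReal_cellUnion]
  have e : ∀ r : ℝ, 0 < r → volume.real (Metric.ball (0 : Space d) r)
      = r ^ d * volume.real (Metric.ball (0 : Space d) 1) := by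
    intro r hr
    have h := Measure.addHaar_ball_of_pos (volume : Measure (Space d)) 0 hr
    rw [finrank_euclideanSpace_fin] at h
    rw [Measure.real, h, ENNReal.toReal_mul, ENNReal.toReal_ofReal (pow_pos hr d).le, Measure.real]
  rw [← e _ (by linarith), ← e _ (by linarith)]
  exact ⟨measureReal_mono (ball_subset_cellUnion L R) (isBounded_cellUnion L R).measure_lt_top.ne,
    measureReal_mono (cellUnion_subset_ball L R) measure_ball_lt_top.ne⟩

/-- Negligibility of the boundary: both counts are squeezed between multiples, with the same
constant, of d-th powers of `R` plus bounded shifts. -/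
theorem tendsto_card_latticeBall_ratio (a : ℝ) :
    Tendsto (fun R => ((latticeBall L (R - a)).card : ℝ) / (latticeBall L R).card) atTop (𝓝 1) := by
  have hQ := cellVolume_pos L
  have hc := cellRadius_pos L
  have hω : 0 < volume.real (Metric.ball (0 : Space d) 1) :=
    ENNReal.toReal_pos (Metric.measure_ball_pos _ _ one_pos).ne' measure_ball_lt_top.ne
  have lim : ∀ u v : ℝ, Tendsto (fun R : ℝ => ((R + u) / (R + v)) ^ d) atTop (𝓝 1) := by
    intro u v
    have h1 : Tendsto (fun R : ℝ => 1 + (u - v) / (R + v)) atTop (𝓝 1) := by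
      have : Tendsto (fun R : ℝ => (u - v) / (R + v)) atTop (𝓝 0) :=
        tendsto_const_nhds.div_atTop (tendsto_atTop_add_const_right _ _ tendsto_id)
      simpa using this.const_add 1
    have h2 : Tendsto (fun R : ℝ => (R + u) / (R + v)) atTop (𝓝 1) := by
      refine h1.congr' ?_
      filter_upwards [eventually_gt_atTop (-v)] with R hR
      have : R + v ≠ 0 := by linarith
      field_simp; ring
    simpa using h2.pow d
  refine tendsto_of_tendsto_of_tendsto_of_le_of_le'
    (lim (-a - cellRadius L) (cellRadius L)) (lim (-a + cellRadius L) (-cellRadius L)) ?_ ?_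
  all_goals
    filter_upwards [eventually_gt_atTop (cellRadius L + |a|)] with R hR
    have ha := le_abs_self a
    have ha' := neg_abs_le a
    have b1 := latticeBall_card_bounds L (R := R - a) (by linarith)
    have b2 := latticeBall_card_bounds L (R := R) (by linarith [abs_nonneg a])
    have hpos : 0 < (R - cellRadius L) ^ d := pow_pos (by linarith [abs_nonneg a]) d
    have hpos' : 0 < (R + cellRadius L) ^ d := pow_pos (by linarith [abs_nonneg a]) d
    have hN : (0 : ℝ) < (latticeBall L R).card := by
      by_contra h
      nlinarith [mul_pos hpos hω, b2.1]
  · rw [div_pow, div_le_div_iff₀ hpos' hN]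
    have e1 : (R + (-a - cellRadius L)) ^ d = (R - a - cellRadius L) ^ d := by ring
    rw [e1]
    refine le_of_mul_le_mul_right ?_ (mul_pos hQ hω)
    calc _ = ((R - a - cellRadius L) ^ d * volume.real (Metric.ball (0 : Space d) 1))
          * ((latticeBall L R).card * cellVolume L) := by ring
      _ ≤ ((latticeBall L (R - a)).card * cellVolume L)
          * ((R + cellRadius L) ^ d * volume.real (Metric.ball (0 : Space d) 1)) :=
        mul_le_mul b1.1 b2.2 (by positivity) (by positivity)
      _ = _ := by ring
  · have e1 : R + -cellRadius L = R - cellRadius L := by ring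
    have e2 : R + (-a + cellRadius L) = R - a + cellRadius L := by ring
    rw [e1, e2, div_pow, div_le_div_iff₀ hN hpos]
    refine le_of_mul_le_mul_right ?_ (mul_pos hQ hω)
    have hp : 0 ≤ (R - a + cellRadius L) ^ d := pow_nonneg (by linarith) d
    calc _ = ((latticeBall L (R - a)).card * cellVolume L)
          * ((R - cellRadius L) ^ d * volume.real (Metric.ball (0 : Space d) 1)) := by ring
      _ ≤ ((R - a + cellRadius L) ^ d * volume.real (Metric.ball (0 : Space d) 1))
          * ((latticeBall L R).card * cellVolume L) :=
        mul_le_mul b1.2 b2.1 (by positivity) (by positivity)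
      _ = _ := by ring

end Geometry

/-! ### Double sums over lattice balls -/

section LatticeSums

variable {d : ℕ} (L : Submodule ℤ (Space d))

theorem sum_eq_tsum_lattice {S : Finset (Space d)} (hS : ∀ w ∈ S, w ∈ L) (F : Space d → ℝ) :
    ∑ w ∈ S, F w = ∑' w : L, if (w : Space d) ∈ S then F w else 0 := by
  classical
  rw [tsum_eq_sum (s := S.subtype (· ∈ L))]
  · rw [← Finset.sum_subtype_of_mem F hS]
    exact Finset.sum_congr rfl fun w hw => by rw [if_pos (Finset.mem_subtype.1 hw)]
  · intro w hw
    exact if_neg fun h => hw (Finset.mem_subtype.2 h)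

theorem sum_shift_eq_tsum {S : Finset (Space d)} (hS : ∀ w ∈ S, w ∈ L) (G : Space d → ℝ)
    {z : Space d} (hz : z ∈ L) :
    ∑ w ∈ S, G (w - z) = ∑' u : L, if z + u ∈ S then G u else 0 := by
  rw [sum_eq_tsum_lattice L hS (fun w => G (w - z)),
    ← (Equiv.addLeft (⟨z, hz⟩ : L)).tsum_eq]
  exact tsum_congr fun u => by simp

open scoped Classical in
-- Pairs are grouped by their difference `u = w - z`; the weight of `u` counts the points of `S`
-- that stay in `S` after the shift by `u`.
theorem double_sum_eq_tsum {S : Finset (Space d)} (hS : ∀ w ∈ S, w ∈ L) {G : Space d → ℝ}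
    (hG : Summable fun u : L => G u) :
    ∑ z ∈ S, ∑ w ∈ S, G (w - z) = ∑' u : L, (S.filter fun z => z + (u : Space d) ∈ S).card * G u := by
  have h1 : ∀ z ∈ S, Summable fun u : L => if z + u ∈ S then G u else 0 := fun z _ =>
    Summable.of_norm_bounded hG.norm fun u => by split_ifs <;> simp
  rw [Finset.sum_congr rfl fun z hz => sum_shift_eq_tsum L hS G (hS z hz),
    ← Summable.tsum_finsetSum h1]
  refine tsum_congr fun u => ?_
  rw [← Finset.sum_filter, Finset.sum_const, nsmul_eq_mul]

theorem abs_double_sum_le {S : Finset (Space d)} (hS : ∀ w ∈ S, w ∈ L) {G : Space d → ℝ}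
    (hG : Summable fun u : L => |G u|) :
    |∑ z ∈ S, ∑ w ∈ S, G (w - z)| ≤ S.card * ∑' u : L, |G u| := by
  calc |∑ z ∈ S, ∑ w ∈ S, G (w - z)| ≤ ∑ z ∈ S, ∑ w ∈ S, |G (w - z)| :=
        (Finset.abs_sum_le_sum_abs _ _).trans
          (Finset.sum_le_sum fun z _ => Finset.abs_sum_le_sum_abs _ _)
    _ ≤ ∑ z ∈ S, ∑' u : L, |G u| := by
        refine Finset.sum_le_sum fun z hz => ?_
        rw [sum_shift_eq_tsum L hS (fun u => |G u|) (hS z hz)]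
        refine Summable.tsum_le_tsum (fun u => ?_) ?_ hG
        · split_ifs <;> simp
        · exact Summable.of_norm_bounded hG fun u => by split_ifs <;> simp
    _ = _ := by simp

variable [DiscreteTopology L] [IsZLattice ℝ L]

/-- The normalized weight of a difference `u` is at most `1`, and tends to `1` because every point
of the ball of radius `R - ‖u‖` stays in the ball of radius `R` after the shift. Dominated
convergence for series concludes. -/
theorem tendsto_double_sum_div_card {G : Space d → ℝ} (hG : Summable fun u : L => G u) :
    Tendsto (fun R => (∑ z ∈ latticeBall L R, ∑ w ∈ latticeBall L R, G (w - z))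
      / (latticeBall L R).card) atTop (𝓝 (∑' u : L, G u)) := by
  classical
  have hS : ∀ R, ∀ w ∈ latticeBall L R, w ∈ L := fun R w hw => ((mem_latticeBall L).1 hw).1
  have e : ∀ R, (∑ z ∈ latticeBall L R, ∑ w ∈ latticeBall L R, G (w - z))
      / (latticeBall L R).card = ∑' u : L,
        (((latticeBall L R).filter fun z => z + (u : Space d) ∈ latticeBall L R).card : ℝ)
          / (latticeBall L R).card * G u := by
    intro R
    rw [double_sum_eq_tsum L (hS R) hG, div_eq_inv_mul, ← tsum_mul_left]
    exact tsum_congr fun u => by ring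
  simp_rw [e]
  have hle : ∀ R (u : L), (((latticeBall L R).filter fun z => z + (u : Space d) ∈ latticeBall L R).card : ℝ)
      / (latticeBall L R).card ≤ 1 := fun R u =>
    div_le_one_of_le₀ (by exact_mod_cast Finset.card_filter_le _ _) (by positivity)
  refine tendsto_tsum_of_dominated_convergence (bound := fun u : L => |G u|) hG.abs (fun u => ?_)
    (Eventually.of_forall fun R u => ?_)
  · have : Tendsto (fun R => (((latticeBall L R).filter
        fun z => z + (u : Space d) ∈ latticeBall L R).card : ℝ) / (latticeBall L R).card) atTop (𝓝 1) := by
      refine tendsto_of_tendsto_of_tendsto_of_le_of_le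
        (tendsto_card_latticeBall_ratio L ‖(u : Space d)‖) tendsto_const_nhds
        (fun R => ?_) (fun R => hle R u)
      refine div_le_div_of_nonneg_right ?_ (by positivity)
      refine Nat.cast_le.2 ?_
      refine Finset.card_le_card fun z hz => ?_
      rw [mem_latticeBall] at hz
      rw [Finset.mem_filter, mem_latticeBall, mem_latticeBall]
      refine ⟨⟨hz.1, ?_⟩, L.add_mem hz.1 u.2, ?_⟩
      · linarith [norm_nonneg (u : Space d)]
      · linarith [norm_add_le z (u : Space d)]
    simpa using this.mul_const (G u)
  · rw [norm_mul, Real.norm_eq_abs, Real.norm_eq_abs]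
    refine mul_le_of_le_one_left (abs_nonneg _) ?_
    rw [abs_of_nonneg (by positivity)]
    exact hle R u

end LatticeSums

/-! ### Averages of diagonally periodic functions -/

section VanHove

variable {d : ℕ} (L : Submodule ℤ (Space d))

/-- `g` is almost everywhere invariant under the diagonal translations by the lattice. -/
def IsDiagPeriodic {d : ℕ} {F : Type*} (L : Submodule ℤ (Space d)) (g : Space d × Space d → F) :
    Prop :=
  ∀ z ∈ L, ∀ᵐ p : Space d × Space d, g (p + (z, z)) = g p

theorem preimage_cell_prod (z w : Space d) :
    (fun p : Space d × Space d => p + (z, z)) ⁻¹' (cell L z ×ˢ cell L w)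
      = wignerSeitz L ×ˢ cell L (w - z) := by
  ext p
  simp only [Set.mem_preimage, Set.mem_prod, cell, Set.mem_ofPred_eq, Prod.fst_add, Prod.snd_add,
    add_sub_cancel_right]
  rw [show p.2 + z - w = p.2 - (w - z) by abel]

theorem measurePreserving_add_diag (z : Space d) :
    MeasurePreserving (fun p : Space d × Space d => p + (z, z)) volume volume :=
  (measurePreserving_add_right volume z).prod (measurePreserving_add_right volume z)

theorem measurableEmbedding_add_diag (z : Space d) :
    MeasurableEmbedding (fun p : Space d × Space d => p + (z, z)) :=
  measurableEmbedding_addRight (z, z)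

variable {F : Type*} [NormedAddCommGroup F] {g : Space d × Space d → F}

theorem IsDiagPeriodic.integrableOn_cell_prod (hg : IsDiagPeriodic L g) {z : Space d}
    (hz : z ∈ L) (w : Space d) (hint : IntegrableOn g (wignerSeitz L ×ˢ cell L (w - z))) :
    IntegrableOn g (cell L z ×ˢ cell L w) := by
  rw [← (measurePreserving_add_diag z).integrableOn_comp_preimage (measurableEmbedding_add_diag z),
    preimage_cell_prod]
  exact hint.congr_fun_ae (ae_restrict_of_ae ((hg z hz).mono fun p hp => hp.symm))

variable [NormedSpace ℝ F]

theorem IsDiagPeriodic.setIntegral_cell_prod (hg : IsDiagPeriodic L g) {z : Space d} (hz : z ∈ L)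
    (w : Space d) :
    ∫ p in cell L z ×ˢ cell L w, g p = ∫ p in wignerSeitz L ×ˢ cell L (w - z), g p := by
  rw [← (measurePreserving_add_diag z).setIntegral_preimage_emb (measurableEmbedding_add_diag z),
    preimage_cell_prod]
  exact integral_congr_ae (ae_restrict_of_ae (hg z hz))

variable [DiscreteTopology L] [IsZLattice ℝ L]

theorem iUnion_cell_ae_eq : (⋃ u : L, cell L u : Set (Space d)) =ᵐ[volume] Set.univ := by
  filter_upwards [ae_mem_cell L] with x ⟨z, hz, hx⟩
  refine propext ⟨fun _ => trivial, fun _ => ?_⟩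
  exact Set.mem_iUnion.2 ⟨⟨z, hz⟩, hx⟩

theorem hasSum_integral_cells (hint : IntegrableOn g (wignerSeitz L ×ˢ Set.univ)) :
    HasSum (fun u : L => ∫ p in wignerSeitz L ×ˢ cell L u, g p)
      (∫ p in wignerSeitz L ×ˢ Set.univ, g p) := by
  have hU : (wignerSeitz L ×ˢ Set.univ : Set (Space d × Space d)) =ᵐ[volume]
      ⋃ u : L, wignerSeitz L ×ˢ cell L u := by
    rw [← Set.prod_iUnion]
    exact Measure.set_prod_ae_eq (ae_eq_refl _) (iUnion_cell_ae_eq L).symm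
  rw [setIntegral_congr_set hU]
  refine hasSum_integral_iUnion (fun u => (measurableSet_wignerSeitz L).prod
    (measurableSet_cell L u)) (fun u v huv => ?_) ?_
  · exact Set.disjoint_prod.2 (Or.inr (cell_disjoint L u.2 v.2 fun h => huv (Subtype.ext h)))
  · exact hint.congr_set_ae hU.symm

theorem setIntegral_cellUnion_prod (hg : IsDiagPeriodic L g) (R : ℝ)
    (hint : ∀ u ∈ L, IntegrableOn g (wignerSeitz L ×ˢ cell L u)) :
    ∫ p in cellUnion L R ×ˢ cellUnion L R, g p
      = ∑ z ∈ latticeBall L R, ∑ w ∈ latticeBall L R,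
          ∫ p in wignerSeitz L ×ˢ cell L (w - z), g p := by
  have hS : ∀ w ∈ latticeBall L R, w ∈ L := fun w hw => ((mem_latticeBall L).1 hw).1
  have hU : (cellUnion L R ×ˢ cellUnion L R : Set (Space d × Space d)) =ᵐ[volume]
      ⋃ q ∈ latticeBall L R ×ˢ latticeBall L R, cell L q.1 ×ˢ cell L q.2 := by
    refine (Measure.set_prod_ae_eq (cellUnion_ae_eq L R) (cellUnion_ae_eq L R)).trans ?_
    have h : (⋃ z ∈ latticeBall L R, cell L z) ×ˢ (⋃ z ∈ latticeBall L R, cell L z)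
        = ⋃ q ∈ latticeBall L R ×ˢ latticeBall L R, cell L q.1 ×ˢ cell L q.2 := ?_
    · rw [h]; exact ae_eq_refl _
    ext p
    simp only [Set.mem_prod, Set.mem_iUnion, Finset.mem_product]
    constructor
    · rintro ⟨⟨z, hz, h⟩, ⟨w, hw, h'⟩⟩
      exact ⟨(z, w), ⟨hz, hw⟩, ⟨h, h'⟩⟩
    · rintro ⟨⟨z, w⟩, ⟨hz, hw⟩, h, h'⟩
      exact ⟨⟨z, hz, h⟩, ⟨w, hw, h'⟩⟩
  rw [setIntegral_congr_set hU, integral_biUnion_finset, Finset.sum_product]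
  · refine Finset.sum_congr rfl fun z hz => Finset.sum_congr rfl fun w _ => ?_
    exact hg.setIntegral_cell_prod L (hS z hz) w
  · exact fun q _ => (measurableSet_cell L _).prod (measurableSet_cell L _)
  · rintro ⟨z, w⟩ hq ⟨z', w'⟩ hq' hne
    simp only [Finset.coe_product, Set.mem_prod, Finset.mem_coe] at hq hq'
    refine Set.disjoint_prod.2 ?_
    by_cases h : z = z'
    · refine Or.inr (cell_disjoint L (hS _ hq.2) (hS _ hq'.2) fun h' => hne (Prod.ext h h'))
    · exact Or.inl (cell_disjoint L (hS _ hq.1) (hS _ hq'.1) h)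
  · rintro ⟨z, w⟩ hq
    rw [Finset.mem_product] at hq
    exact hg.integrableOn_cell_prod L (hS _ hq.1) w
      (hint _ (L.sub_mem (hS _ hq.2) (hS _ hq.1)))

/-- Thermodynamic limit of the double integral of an integrable diagonally periodic function. -/
theorem tendsto_setIntegral_cellUnion_prod {g : Space d × Space d → ℝ} (hg : IsDiagPeriodic L g)
    (hint : IntegrableOn g (wignerSeitz L ×ˢ Set.univ)) :
    Tendsto (fun R => (∫ p in cellUnion L R ×ˢ cellUnion L R, g p) / volume.real (cellUnion L R))
      atTop (𝓝 (1 / cellVolume L * ∫ p in wignerSeitz L ×ˢ Set.univ, g p)) := by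
  have hsum := hasSum_integral_cells L hint
  have h := (tendsto_double_sum_div_card L
    (G := fun u => ∫ p in wignerSeitz L ×ˢ cell L u, g p) hsum.summable).const_mul
      (1 / cellVolume L)
  rw [hsum.tsum_eq] at h
  refine h.congr fun R => ?_
  rw [setIntegral_cellUnion_prod L hg R fun u _ =>
    hint.mono_set (Set.prod_mono_right (Set.subset_univ _)), volumeReal_cellUnion]
  rw [div_mul_div_comm, one_mul, mul_comm (cellVolume L)]

/-- The bound uniform in `R` that later dominates the Mellin integrand: for a given first cell each
difference `u` occurs at most once. The absolute values are taken after integrating over a pair of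
cells, so that cancellation within the pair is kept. -/
theorem abs_setIntegral_cellUnion_prod_le {g : Space d × Space d → ℝ} (hg : IsDiagPeriodic L g)
    (hint : ∀ u ∈ L, IntegrableOn g (wignerSeitz L ×ˢ cell L u))
    (hsum : Summable fun u : L => |∫ p in wignerSeitz L ×ˢ cell L u, g p|) (R : ℝ) :
    |∫ p in cellUnion L R ×ˢ cellUnion L R, g p| / volume.real (cellUnion L R)
      ≤ 1 / cellVolume L * ∑' u : L, |∫ p in wignerSeitz L ×ˢ cell L u, g p| := by
  have hQ := cellVolume_pos L
  rw [setIntegral_cellUnion_prod L hg R hint, volumeReal_cellUnion]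
  have h := abs_double_sum_le L (S := latticeBall L R)
    (fun w hw => ((mem_latticeBall L).1 hw).1)
    (G := fun u => ∫ p in wignerSeitz L ×ˢ cell L u, g p) hsum
  -- If no lattice point lies in the ball, the quotient is `0 / 0 = 0`.
  rcases (Nat.cast_nonneg (α := ℝ) (latticeBall L R).card).eq_or_lt with h0 | h0
  · rw [← h0]
    simp only [zero_mul, div_zero]
    exact mul_nonneg (by positivity) (tsum_nonneg fun _ => abs_nonneg _)
  · rw [div_le_iff₀ (mul_pos h0 hQ)]
    refine h.trans_eq ?_
    field_simp

end VanHove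

/-! ### Campbell's formula and expected energies -/

section Campbell

variable {d : ℕ}

theorem Config.measurable_count {D : Set (Space d)} (hD : MeasurableSet D) :
    Measurable fun X : Config d => X.count D := by
  refine measurable_to_countable' fun n => ?_
  exact MeasurableSpace.measurableSet_generateFrom ⟨D, hD, n, rfl⟩

theorem Config.measurable_toENNReal_count {D : Set (Space d)} (hD : MeasurableSet D) :
    Measurable fun X : Config d => (X.count D : ℝ≥0∞) :=
  (Measurable.of_discrete (f := fun n : ℕ∞ => (n : ℝ≥0∞))).comp (Config.measurable_count hD)

theorem Config.restrict_points_finite {Ω : Set (Space d)} (hb : Bornology.IsBounded Ω)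
    (X : Config d) : (X.restrict Ω).points.Finite :=
  X.locallyFinite Ω hb

theorem Config.restrict_offDiag (Ω : Set (Space d)) (X : Config d) :
    (X.restrict Ω).points.offDiag = X.points.offDiag ∩ Ω ×ˢ Ω := by
  ext p
  simp only [Config.restrict, Set.mem_offDiag, Set.mem_inter_iff, Set.mem_prod]
  tauto

theorem Config.restrict_restrict (Ω : Set (Space d)) (X : Config d) :
    (X.restrict Ω).restrict Ω = X.restrict Ω := by
  ext x; simp [Config.restrict]

theorem isFiniteMeasure_count_restrict {α : Type*} [MeasurableSpace α]
    [MeasurableSingletonClass α] {s : Set α} (hs : s.Finite) :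
    IsFiniteMeasure ((Measure.count : Measure α).restrict s) := by
  refine ⟨?_⟩
  rw [Measure.restrict_apply_univ, Measure.count_apply_finite _ hs]
  exact ENNReal.natCast_lt_top _

theorem integral_count_restrict {α : Type*} [MeasurableSpace α]
    [MeasurableSingletonClass α] {s : Set α} (hs : s.Finite) (g : α → ℝ) :
    ∫ x, g x ∂((Measure.count : Measure α).restrict s) = ∑ᶠ x ∈ s, g x := by
  have hfin := isFiniteMeasure_count_restrict hs
  have hint : IntegrableOn g (hs.toFinset : Set α) Measure.count := by
    have h2 := IntegrableOn.finset (μ := (Measure.count : Measure α).restrict s)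
      (s := hs.toFinset) (f := g)
    rwa [IntegrableOn, Measure.restrict_restrict hs.toFinset.measurableSet, hs.coe_toFinset,
      Set.inter_self, ← hs.coe_toFinset] at h2
  rw [finsum_mem_eq_finite_toFinset_sum g hs]
  conv_lhs => rw [← hs.coe_toFinset]
  rw [setIntegral_finset _ hint]
  simp [Measure.real]

/-- The counting measure of the points of `X` in `Ω`. -/
def pointMeasure (Ω : Set (Space d)) (X : Config d) : Measure (Space d) :=
  Measure.count.restrict (X.restrict Ω).points

/-- The counting measure of the ordered pairs of distinct points of `X` in `Ω`. -/
def pairMeasure (Ω : Set (Space d)) (X : Config d) : Measure (Space d × Space d) :=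
  Measure.count.restrict (X.restrict Ω).points.offDiag

theorem pointMeasure_apply {Ω : Set (Space d)} (X : Config d) {B : Set (Space d)}
    (hB : MeasurableSet B) : pointMeasure Ω X B = X.count (B ∩ Ω) := by
  rw [pointMeasure, Measure.restrict_apply hB]
  have hc : (B ∩ (X.restrict Ω).points) = X.points ∩ (B ∩ Ω) := by
    ext x; simp only [Config.restrict, Set.mem_inter_iff]; tauto
  have hcount : (X.points ∩ (B ∩ Ω)).Countable := by
    have : X.points ∩ (B ∩ Ω) ⊆ ⋃ n : ℕ, X.points ∩ Metric.ball 0 n := by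
      rw [← Set.inter_iUnion, Metric.iUnion_ball_nat]
      exact Set.inter_subset_inter_right _ (Set.subset_univ _)
    exact (Set.countable_iUnion fun n => (X.locallyFinite _ Metric.isBounded_ball).countable).mono
      this
  rw [hc, Measure.count_apply hcount.measurableSet]
  rfl

theorem Config.countable_points (X : Config d) : X.points.Countable := by
  have : X.points ⊆ ⋃ n : ℕ, X.points ∩ Metric.ball 0 n := by
    rw [← Set.inter_iUnion, Metric.iUnion_ball_nat, Set.inter_univ]
  exact (Set.countable_iUnion fun n =>
    (X.locallyFinite _ Metric.isBounded_ball).countable).mono this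

theorem pairMeasure_apply {Ω : Set (Space d)} (X : Config d) {B : Set (Space d × Space d)}
    (hB : MeasurableSet B) :
    pairMeasure Ω X B = (X.points.offDiag ∩ (B ∩ Ω ×ˢ Ω)).encard := by
  rw [pairMeasure, Measure.restrict_apply hB, Config.restrict_offDiag]
  have hc : (B ∩ (X.points.offDiag ∩ Ω ×ˢ Ω)) = X.points.offDiag ∩ (B ∩ Ω ×ˢ Ω) := by
    ext x; simp only [Set.mem_inter_iff]; tauto
  have hcount : (X.points.offDiag ∩ (B ∩ Ω ×ˢ Ω)).Countable :=
    (X.countable_points.prod X.countable_points).mono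
      fun p hp => Set.mem_prod.2 ⟨hp.1.1, hp.1.2.1⟩
  rw [hc, Measure.count_apply hcount.measurableSet]

/-- A product of counts splits into pairs off the diagonal and pairs on it. The pair count thereby
becomes a function of counts, which is all that the σ-algebra on configurations makes measurable. -/
theorem Config.offDiag_inter_prod_encard (X : Config d) (A B : Set (Space d)) :
    (X.points.offDiag ∩ A ×ˢ B).encard + X.count (A ∩ B) = X.count A * X.count B := by
  have h1 : (X.points ∩ A) ×ˢ (X.points ∩ B) = (X.points.offDiag ∩ A ×ˢ B) ∪
      (fun x => (x, x)) '' (X.points ∩ (A ∩ B)) := by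
    ext ⟨x, y⟩
    simp only [Set.mem_prod, Set.mem_inter_iff, Set.mem_union, Set.mem_offDiag, Set.mem_image,
      Prod.mk.injEq, ne_eq]
    constructor
    · rintro ⟨⟨hx, hA⟩, hy, hB⟩
      by_cases h : x = y
      · subst h
        exact Or.inr ⟨x, ⟨hx, hA, hB⟩, rfl, rfl⟩
      · exact Or.inl ⟨⟨hx, hy, h⟩, hA, hB⟩
    · rintro (⟨⟨hx, hy, -⟩, hA, hB⟩ | ⟨z, ⟨hz, hA, hB⟩, rfl, rfl⟩)
      · exact ⟨⟨hx, hA⟩, hy, hB⟩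
      · exact ⟨⟨hz, hA⟩, hz, hB⟩
  have hdis : Disjoint (X.points.offDiag ∩ A ×ˢ B)
      ((fun x => (x, x)) '' (X.points ∩ (A ∩ B))) := by
    rw [Set.disjoint_left]
    rintro _ ⟨hp, -⟩ ⟨x, -, rfl⟩
    exact hp.2.2 rfl
  rw [Config.count, Config.count, Config.count, ← Set.encard_prod, h1, Set.encard_union_eq hdis,
    Function.Injective.encard_image fun x y h => (Prod.mk.inj h).1]

variable {Ω : Set (Space d)}

theorem measurable_pointMeasure (hΩ : MeasurableSet Ω) : Measurable (pointMeasure Ω) := by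
  refine Measure.measurable_of_measurable_coe _ fun B hB => ?_
  rw [funext fun X => pointMeasure_apply X hB]
  exact Config.measurable_toENNReal_count (hB.inter hΩ)

/-- Rectangles form a generating π-system, and on a rectangle the pair count is a product of counts
minus a count. The subtraction is legitimate because `Ω` is bounded, so the diagonal term is finite.
-/
theorem measurable_pairMeasure (hΩ : MeasurableSet Ω) (hb : Bornology.IsBounded Ω) :
    Measurable (pairMeasure Ω) := by
  have hfin : ∀ X, IsFiniteMeasure (pairMeasure Ω X) := fun X =>
    isFiniteMeasure_count_restrict (X.restrict_points_finite hb).offDiag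
  have key : ∀ A B : Set (Space d), MeasurableSet A → MeasurableSet B →
      Measurable fun X => pairMeasure Ω X (A ×ˢ B) := by
    intro A B hA hB
    have e : (fun X => pairMeasure Ω X (A ×ˢ B)) = fun X =>
        (X.count (A ∩ Ω) : ℝ≥0∞) * X.count (B ∩ Ω) - X.count ((A ∩ Ω) ∩ (B ∩ Ω)) := by
      funext X
      rw [pairMeasure_apply X (hA.prod hB), Set.prod_inter_prod]
      have h := congrArg (fun n : ℕ∞ => (n : ℝ≥0∞))
        (X.offDiag_inter_prod_encard (A ∩ Ω) (B ∩ Ω))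
      simp only [ENat.toENNReal_add, ENat.toENNReal_mul] at h
      refine ENNReal.eq_sub_of_add_eq ?_ h
      have : (X.points ∩ ((A ∩ Ω) ∩ (B ∩ Ω))).Finite :=
        X.locallyFinite _ (hb.subset fun x hx => hx.1.2)
      have h3 := this.encard_lt_top
      rw [Config.count]
      simpa using h3.ne
    rw [e]
    exact ((Config.measurable_toENNReal_count (hA.inter hΩ)).mul
      (Config.measurable_toENNReal_count (hB.inter hΩ))).sub
      (Config.measurable_toENNReal_count ((hA.inter hΩ).inter (hB.inter hΩ)))
  refine Measurable.measure_of_isPiSystem generateFrom_prod.symm isPiSystem_prod ?_ ?_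
  · rintro _ ⟨A, hA, B, hB, rfl⟩
    exact key A B hA hB
  · rw [← Set.univ_prod_univ]
    exact key _ _ .univ .univ

variable {P : Measure (Config d)} {ρ₁ : Space d → ℝ} {ρ₂ : Space d × Space d → ℝ}

theorem bind_pointMeasure (hΩ : MeasurableSet Ω) (hρ : IsOnePointCorrelation P ρ₁) :
    P.bind (pointMeasure Ω) = (volume.restrict Ω).withDensity fun x => ENNReal.ofReal (ρ₁ x) := by
  ext B hB
  rw [Measure.bind_apply hB (measurable_pointMeasure hΩ).aemeasurable, withDensity_apply _ hB,
    Measure.restrict_restrict hB, ← hρ.lintegral_count _ (hB.inter hΩ)]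
  exact lintegral_congr fun X => pointMeasure_apply X hB

theorem bind_pairMeasure (hΩ : MeasurableSet Ω) (hb : Bornology.IsBounded Ω)
    (hρ : IsTwoPointCorrelation P ρ₂) :
    P.bind (pairMeasure Ω)
      = (volume.restrict (Ω ×ˢ Ω)).withDensity fun p => ENNReal.ofReal (ρ₂ p) := by
  ext B hB
  rw [Measure.bind_apply hB (measurable_pairMeasure hΩ hb).aemeasurable, withDensity_apply _ hB,
    Measure.restrict_restrict hB, ← hρ.lintegral_count _ (hB.inter (hΩ.prod hΩ))]
  exact lintegral_congr fun X => pairMeasure_apply X hB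

/-- Campbell's formula in abstract form: the mean measure `P.bind κ` has density `ρ`, and
integration against it is Fubini for the composition of a kernel with `P`. -/
theorem integral_bind_density {α β : Type*} [MeasurableSpace α] [MeasurableSpace β]
    {P : Measure α} {κ : α → Measure β} (hκ : Measurable κ) {μ : Measure β} {ρ : β → ℝ}
    (hρ : Measurable ρ) (hρ0 : ∀ x, 0 ≤ ρ x)
    (h : P.bind κ = μ.withDensity fun x => ENNReal.ofReal (ρ x)) {g : β → ℝ}
    (hg : Integrable (fun x => ρ x * g x) μ) :
    Integrable (fun X => ∫ x, g x ∂κ X) P ∧ ∫ X, (∫ x, g x ∂κ X) ∂P = ∫ x, ρ x * g x ∂μ := by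
  let η : ProbabilityTheory.Kernel α β := ⟨κ, hκ⟩
  have hbind : (η.comp (ProbabilityTheory.Kernel.const Unit P)) ()
      = μ.withDensity fun x => ENNReal.ofReal (ρ x) := by
    rw [ProbabilityTheory.Kernel.comp_apply, ProbabilityTheory.Kernel.const_apply]
    exact h
  have hint : Integrable g ((η.comp (ProbabilityTheory.Kernel.const Unit P)) ()) := by
    rw [hbind, integrable_withDensity_iff_integrable_smul' hρ.ennreal_ofReal (by simp)]
    simpa [ENNReal.toReal_ofReal (hρ0 _)] using hg
  refine ⟨hint.integral_comp, ?_⟩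
  have h2 := ProbabilityTheory.Kernel.integral_comp hint
  rw [hbind, integral_withDensity_eq_integral_toReal_smul hρ.ennreal_ofReal (by simp)] at h2
  simp only [ENNReal.toReal_ofReal (hρ0 _), smul_eq_mul, ProbabilityTheory.Kernel.const_apply] at h2
  exact h2.symm

/-- Being contained in `Ω` is the event that no point lies in `Ωᶜ`, hence measurable; this allows
passing to the image measure. -/
theorem ae_localize_restrict_eq (hΩ : MeasurableSet Ω) :
    ∀ᵐ X ∂(localize P Ω), X.restrict Ω = X := by
  have hset : {X : Config d | X.restrict Ω = X} = {X | X.count Ωᶜ = 0} := by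
    ext X
    simp only [Set.mem_ofPred_eq, Config.count, Set.encard_eq_zero]
    constructor
    · intro h
      rw [← h]
      ext x; simp [Config.restrict]
    · intro h
      ext x
      simp only [Config.restrict, Set.mem_inter_iff, and_iff_left_iff_imp]
      intro hx
      by_contra hx'
      have : x ∈ X.points ∩ Ωᶜ := ⟨hx, hx'⟩
      rw [h] at this
      exact this
  have hm : MeasurableSet {X : Config d | X.restrict Ω = X} := by
    rw [hset]
    exact MeasurableSpace.measurableSet_generateFrom ⟨Ωᶜ, hΩ.compl, 0, rfl⟩
  rw [localize, ae_map_iff (Config.measurable_restrict hΩ).aemeasurable hm]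
  exact Eventually.of_forall fun X => X.restrict_restrict Ω

/-- Only `Ψ` has to be measurable. The energies, defined by finite sums over the points, need only
agree with it on configurations contained in `Ω`, where the localized law is concentrated. -/
theorem integral_localize (hΩ : MeasurableSet Ω) {Φ Ψ : Config d → ℝ} (hΨ : StronglyMeasurable Ψ)
    (h : ∀ X : Config d, X.restrict Ω = X → Φ X = Ψ X) (h' : ∀ X : Config d, Ψ (X.restrict Ω) = Ψ X)
    (hint : Integrable Ψ P) :
    Integrable Φ (localize P Ω) ∧ ∫ X, Φ X ∂(localize P Ω) = ∫ X, Ψ X ∂P := by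
  have hae : Φ =ᵐ[localize P Ω] Ψ := (ae_localize_restrict_eq hΩ).mono h
  have hm := (Config.measurable_restrict hΩ).aemeasurable (μ := P)
  constructor
  · rw [integrable_congr hae, localize, integrable_map_measure hΨ.aestronglyMeasurable hm]
    exact hint.congr (Eventually.of_forall fun X => (h' X).symm)
  · rw [integral_congr_ae hae, localize, integral_map hm hΨ.aestronglyMeasurable]
    exact integral_congr_ae (Eventually.of_forall h')

theorem pairMeasure_restrict (X : Config d) : pairMeasure Ω (X.restrict Ω) = pairMeasure Ω X := by
  rw [pairMeasure, Config.restrict_restrict, pairMeasure]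

theorem pointMeasure_restrict (X : Config d) :
    pointMeasure Ω (X.restrict Ω) = pointMeasure Ω X := by
  rw [pointMeasure, Config.restrict_restrict, pointMeasure]

theorem measurable_riesz (s : ℝ) : Measurable (riesz s : Space d → ℝ) := by
  unfold riesz
  split_ifs <;> fun_prop

theorem energy_eq_of_restrict {s : ℝ} (hb : Bornology.IsBounded Ω) {X : Config d}
    (hX : X.restrict Ω = X) :
    energy s X = (1 / 2) * ∫ p, riesz s (p.1 - p.2) ∂(pairMeasure Ω X) := by
  rw [pairMeasure, integral_count_restrict (X.restrict_points_finite hb).offDiag, hX, energy]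

theorem energy_localize [IsProbabilityMeasure P] (hΩ : MeasurableSet Ω)
    (hb : Bornology.IsBounded Ω) (hρ : IsTwoPointCorrelation P ρ₂) {s : ℝ}
    (hint : IntegrableOn (fun p : Space d × Space d => ρ₂ p * riesz s (p.1 - p.2)) (Ω ×ˢ Ω)) :
    Integrable (fun X => energy s X) (localize P Ω) ∧
      ∫ X, energy s X ∂(localize P Ω) = (1 / 2) * ∫ p in Ω ×ˢ Ω, ρ₂ p * riesz s (p.1 - p.2) := by
  have hm := measurable_pairMeasure hΩ hb
  have hV : StronglyMeasurable fun p : Space d × Space d => riesz s (p.1 - p.2) :=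
    ((measurable_riesz s).comp (measurable_fst.sub measurable_snd)).stronglyMeasurable
  obtain ⟨h1, h2⟩ := integral_bind_density hm hρ.measurable hρ.nonneg
    (bind_pairMeasure hΩ hb hρ) hint
  have hs : StronglyMeasurable fun X => ∫ p, riesz s (p.1 - p.2) ∂(pairMeasure Ω X) :=
    StronglyMeasurable.integral_kernel (κ := ⟨_, hm⟩) hV
  obtain ⟨h3, h4⟩ := integral_localize hΩ (Φ := fun X => energy s X) (hs.const_mul (1 / 2))
    (fun X hX => energy_eq_of_restrict hb hX) (fun X => by rw [pairMeasure_restrict])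
    (h1.const_mul (1 / 2))
  exact ⟨h3, by rw [h4, integral_const_mul, h2]⟩

theorem jelliumEnergy_localize [IsProbabilityMeasure P] (hΩ : MeasurableSet Ω)
    (hb : Bornology.IsBounded Ω) (hρ : IsTwoPointCorrelation P ρ₂)
    (hρ1 : IsOnePointCorrelation P ρ₁) {s : ℝ} (ρb : ℝ)
    (hint : IntegrableOn (fun p : Space d × Space d => ρ₂ p * riesz s (p.1 - p.2)) (Ω ×ˢ Ω))
    (hint1 : IntegrableOn (fun x => ρ₁ x * ∫ y in Ω, riesz s (x - y)) Ω) :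
    Integrable (fun X => jelliumEnergy s X Ω ρb) (localize P Ω) ∧
      ∫ X, jelliumEnergy s X Ω ρb ∂(localize P Ω)
        = (1 / 2) * (∫ p in Ω ×ˢ Ω, ρ₂ p * riesz s (p.1 - p.2))
          - ρb * (∫ x in Ω, ρ₁ x * ∫ y in Ω, riesz s (x - y))
          + ρb ^ 2 / 2 * (∫ x in Ω, (∫ y in Ω, riesz s (x - y))) := by
  have hm := measurable_pairMeasure hΩ hb
  have hm1 := measurable_pointMeasure (d := d) hΩ
  have hV : StronglyMeasurable fun p : Space d × Space d => riesz s (p.1 - p.2) :=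
    ((measurable_riesz s).comp (measurable_fst.sub measurable_snd)).stronglyMeasurable
  have hW : StronglyMeasurable fun x : Space d => ∫ y in Ω, riesz s (x - y) :=
    hV.integral_prod_right
  obtain ⟨h1, h2⟩ := integral_bind_density hm hρ.measurable hρ.nonneg
    (bind_pairMeasure hΩ hb hρ) hint
  obtain ⟨h1', h2'⟩ := integral_bind_density hm1 hρ1.measurable hρ1.nonneg
    (bind_pointMeasure hΩ hρ1) hint1
  have hs : StronglyMeasurable fun X => ∫ p, riesz s (p.1 - p.2) ∂(pairMeasure Ω X) :=
    StronglyMeasurable.integral_kernel (κ := ⟨_, hm⟩) hV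
  have hs1 : StronglyMeasurable fun X : Config d =>
      ∫ x, (∫ y in Ω, riesz s (x - y)) ∂(pointMeasure Ω X) :=
    StronglyMeasurable.integral_kernel (κ := ⟨_, hm1⟩) hW
  set K := ρb ^ 2 / 2 * (∫ x in Ω, (∫ y in Ω, riesz s (x - y)))
  have hi1 := h1.const_mul (1 / 2)
  have hi2 := h1'.const_mul ρb
  have hΨ : StronglyMeasurable fun X : Config d =>
      (1 / 2) * (∫ p, riesz s (p.1 - p.2) ∂(pairMeasure Ω X))
        - ρb * (∫ x, (∫ y in Ω, riesz s (x - y)) ∂(pointMeasure Ω X)) + K :=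
    ((hs.const_mul (1 / 2)).sub (hs1.const_mul ρb)).add stronglyMeasurable_const
  obtain ⟨h3, h4⟩ := integral_localize (P := P) hΩ (Φ := fun X => jelliumEnergy s X Ω ρb) hΨ
    (fun X hX => by
      rw [jelliumEnergy, energy_eq_of_restrict hb hX, pointMeasure, integral_count_restrict
        (X.restrict_points_finite hb), hX])
    (fun X => by rw [pairMeasure_restrict, pointMeasure_restrict])
    ((hi1.sub hi2).add (integrable_const K))
  refine ⟨h3, h4.trans ?_⟩
  have e1 := integral_add (hi1.sub hi2) (integrable_const K)
  have e2 := integral_sub hi1 hi2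
  simp only [Pi.sub_apply] at e1 e2
  rw [e1, e2, integral_const_mul, integral_const_mul, h2, h2']
  simp

end Campbell

/-! ### Periodicity and boundedness of the correlation functions -/

section Periodicity

variable {d : ℕ} {P : Measure (Config d)} {ρ₁ : Space d → ℝ} {ρ₂ : Space d × Space d → ℝ}
  {L : Submodule ℤ (Space d)}

theorem Config.translate_translate_neg (z : Space d) (X : Config d) :
    (X.translate z).translate (-z) = X := by
  ext x; simp [Config.translate]

theorem Config.measurableEmbedding_translate (z : Space d) :
    MeasurableEmbedding (Config.translate (d := d) z) := by
  let e : Config d ≃ᵐ Config d :=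
    { toFun := Config.translate z
      invFun := Config.translate (-z)
      left_inv := Config.translate_translate_neg z
      right_inv := fun X => by simpa using Config.translate_translate_neg (-z) X
      measurable_toFun := Config.measurable_translate z
      measurable_invFun := Config.measurable_translate (-z) }
  exact e.measurableEmbedding

theorem Config.translate_count (z : Space d) (X : Config d) (B : Set (Space d)) :
    (X.translate z).count B = X.count ((fun x => x + z) ⁻¹' B) := by
  have h : (X.translate z).points ∩ B
      = (fun x => x + z) '' (X.points ∩ (fun x => x + z) ⁻¹' B) := by
    ext x
    constructor
    · intro hx
      exact ⟨x - z, ⟨hx.1, by simpa using hx.2⟩, by simp⟩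
    · rintro ⟨y, hy, rfl⟩
      exact ⟨by simpa [Config.translate] using hy.1, hy.2⟩
  rw [Config.count, h, (add_left_injective z).encard_image, Config.count]

theorem Config.translate_offDiag_encard (z : Space d) (X : Config d)
    (B : Set (Space d × Space d)) :
    ((X.translate z).points.offDiag ∩ B).encard
      = (X.points.offDiag ∩ (fun p => p + (z, z)) ⁻¹' B).encard := by
  have h : (X.translate z).points.offDiag ∩ B
      = (fun p => p + (z, z)) '' (X.points.offDiag ∩ (fun p => p + (z, z)) ⁻¹' B) := by
    ext ⟨x, y⟩
    constructor
    · rintro ⟨⟨hx, hy, hne⟩, hB⟩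
      refine ⟨(x - z, y - z), ⟨⟨hx, hy, ?_⟩, by simpa using hB⟩, by simp⟩
      simpa using hne
    · rintro ⟨⟨x', y'⟩, ⟨⟨hx, hy, hne⟩, hB⟩, h⟩
      obtain ⟨rfl, rfl⟩ := Prod.mk.inj h
      exact ⟨⟨by simpa [Config.translate] using hx, by simpa [Config.translate] using hy,
        by simpa using hne⟩, hB⟩
  rw [h, (add_left_injective (z, z)).encard_image]

/-- Invariance of the law makes the shifted density have the same integral over every Borel set.
Densities are unique only almost everywhere, hence the form of the conclusion. -/
theorem IsPeriodic.onePoint (hper : IsPeriodic L P) (hρ : IsOnePointCorrelation P ρ₁) :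
    ∀ z ∈ L, ∀ᵐ x : Space d, ρ₁ (x + z) = ρ₁ x := by
  intro z hz
  have hmp := measurePreserving_add_right (volume : Measure (Space d)) z
  have h : (fun x => ENNReal.ofReal (ρ₁ (x + z))) =ᵐ[volume] fun x => ENNReal.ofReal (ρ₁ x) := by
    refine ae_eq_of_forall_setLIntegral_eq_of_sigmaFinite
      (hρ.measurable.comp (measurable_add_const z)).ennreal_ofReal
      hρ.measurable.ennreal_ofReal fun s hs _ => ?_
    have hs' : MeasurableSet ((fun x => x + -z) ⁻¹' s) := measurable_add_const (-z) hs
    have e : (fun x => x + z) ⁻¹' ((fun x => x + -z) ⁻¹' s) = s := by ext x; simp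
    have h1 := hmp.setLIntegral_comp_preimage hs' hρ.measurable.ennreal_ofReal
    rw [e] at h1
    rw [h1, ← hρ.lintegral_count _ hs', ← hρ.lintegral_count _ hs]
    rw [← (hper z hz).lintegral_comp_emb (Config.measurableEmbedding_translate z)]
    refine lintegral_congr fun X => ?_
    rw [Config.translate_count, e]
  filter_upwards [h] with x hx
  exact (ENNReal.ofReal_eq_ofReal_iff (hρ.nonneg _) (hρ.nonneg _)).1 hx

theorem IsPeriodic.twoPoint (hper : IsPeriodic L P) (hρ : IsTwoPointCorrelation P ρ₂) :
    IsDiagPeriodic L ρ₂ := by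
  intro z hz
  have hmp := measurePreserving_add_diag z
  have h : (fun p => ENNReal.ofReal (ρ₂ (p + (z, z)))) =ᵐ[volume]
      fun p => ENNReal.ofReal (ρ₂ p) := by
    refine ae_eq_of_forall_setLIntegral_eq_of_sigmaFinite
      (hρ.measurable.comp hmp.measurable).ennreal_ofReal
      hρ.measurable.ennreal_ofReal fun s hs _ => ?_
    have hs' : MeasurableSet ((fun p : Space d × Space d => p + (-z, -z)) ⁻¹' s) :=
      (measurePreserving_add_diag (-z)).measurable hs
    have e : (fun p : Space d × Space d => p + (z, z)) ⁻¹' ((fun p => p + (-z, -z)) ⁻¹' s) = s := by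
      ext p; rw [Set.mem_preimage, Set.mem_preimage, add_assoc,
        show ((z, z) : Space d × Space d) + (-z, -z) = 0 by simp, add_zero]
    have h1 := hmp.setLIntegral_comp_preimage hs' hρ.measurable.ennreal_ofReal
    rw [e] at h1
    rw [h1, ← hρ.lintegral_count _ hs', ← hρ.lintegral_count _ hs]
    rw [← (hper z hz).lintegral_comp_emb (Config.measurableEmbedding_translate z)]
    refine lintegral_congr fun X => ?_
    rw [Config.translate_offDiag_encard, e]
  filter_upwards [h] with x hx
  exact (ENNReal.ofReal_eq_ofReal_iff (hρ.nonneg _) (hρ.nonneg _)).1 hx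

/-- Repulsion bounds ρ₂ and clustering then bounds ρ₁⊗ρ₁ by `A + C`. If ρ₁ exceeded `K` on a set of
positive measure, then ρ₁⊗ρ₁ would exceed `K²` on its square; `K = |A| + C + 1` satisfies `K² > A +
C`. -/
theorem ae_onePoint_le {C b : ℝ} {A : ℝ} (hC : 0 < C)
    (hA : ∀ᵐ p, |ρ₂ p| ≤ A)
    (hclust : ∀ᵐ p : Space d × Space d,
      |ρ₂ p - ρ₁ p.1 * ρ₁ p.2| ≤ C / (1 + ‖p.1 - p.2‖ ^ b)) :
    ∃ K : ℝ, 0 ≤ K ∧ ∀ᵐ x : Space d, ρ₁ x ≤ K := by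
  have hprod : ∀ᵐ p : Space d × Space d, ρ₁ p.1 * ρ₁ p.2 ≤ A + C := by
    filter_upwards [hA, hclust] with p h1 h2
    have h3 : C / (1 + ‖p.1 - p.2‖ ^ b) ≤ C := by
      refine div_le_self hC.le ?_
      linarith [Real.rpow_nonneg (norm_nonneg (p.1 - p.2)) b]
    have h4 := (abs_le.1 (h2.trans h3)).1
    have h5 := (abs_le.1 h1).2
    linarith
  refine ⟨|A| + C + 1, by positivity, ?_⟩
  set K := |A| + C + 1
  have hK : A + C < K * K := by
    have := le_abs_self A
    nlinarith [abs_nonneg A, mul_nonneg (abs_nonneg A) hC.le, sq_nonneg (|A|), sq_nonneg C]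
  have h0 : (volume : Measure (Space d × Space d)) ({x | K < ρ₁ x} ×ˢ {x | K < ρ₁ x}) = 0 := by
    refine measure_mono_null ?_ hprod
    rintro ⟨x, y⟩ ⟨hx, hy⟩
    simp only [Set.mem_ofPred_eq] at hx hy
    simp only [Set.mem_compl_iff, Set.mem_ofPred_eq, not_le]
    have hK0 : 0 ≤ K := by positivity
    exact hK.trans (by nlinarith)
  rw [Measure.volume_eq_prod, Measure.prod_prod, mul_self_eq_zero] at h0
  rw [ae_iff]
  simpa using h0

/-- An exactly periodic bounded version of the one-point correlation function. -/
theorem exists_periodic_version [DiscreteTopology L] [IsZLattice ℝ L]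
    (hρ : IsOnePointCorrelation P ρ₁)
    (hper : ∀ z ∈ L, ∀ᵐ x : Space d, ρ₁ (x + z) = ρ₁ x) {K : ℝ} (hK0 : 0 ≤ K)
    (hK : ∀ᵐ x : Space d, ρ₁ x ≤ K) :
    ∃ ρ : Space d → ℝ, Measurable ρ ∧ (∀ x, |ρ x| ≤ K) ∧ (∀ z ∈ L, ∀ x, ρ (x + z) = ρ x) ∧
      ρ₁ =ᵐ[volume] ρ := by
  have hbdd : ∀ x : Space d, BddAbove (Set.range fun z : L => min (ρ₁ (x + z)) K) := fun x =>
    ⟨K, by rintro _ ⟨z, rfl⟩; exact min_le_right _ _⟩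
  -- The supremum over an orbit is periodic at every point, and truncating at `K` keeps it finite
  -- everywhere. Almost everywhere all terms coincide with `ρ₁ x`.
  refine ⟨fun x => ⨆ z : L, min (ρ₁ (x + z)) K, ?_, fun x => ?_, fun w hw x => ?_, ?_⟩
  · exact Measurable.iSup fun z =>
      (hρ.measurable.comp (measurable_add_const _)).min measurable_const
  · rw [abs_of_nonneg]
    · exact ciSup_le fun z => min_le_right _ _
    · exact le_ciSup_of_le (hbdd x) 0 (le_min (hρ.nonneg _) hK0)
  · refine (Equiv.addLeft (⟨w, hw⟩ : L)).iSup_congr fun z => ?_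
    simp [add_assoc]
  · have h1 : ∀ᵐ x : Space d, ∀ z : L, ρ₁ (x + z) = ρ₁ x :=
      ae_all_iff.2 fun z => hper z z.2
    filter_upwards [h1, hK] with x hx hxK
    simp only [hx, ciSup_const]
    exact (min_eq_left hxK).symm

end Periodicity

/-! ### Integrals of functions of x - y -/

section Shear

variable {d : ℕ}

/-- The involution `(x, y) ↦ (x, x - y)`. -/
def shear (d : ℕ) : Space d × Space d ≃ᵐ Space d × Space d where
  toFun p := (p.1, p.1 - p.2)
  invFun p := (p.1, p.1 - p.2)
  left_inv p := by simp
  right_inv p := by simp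
  measurable_toFun := measurable_fst.prodMk (measurable_fst.sub measurable_snd)
  measurable_invFun := measurable_fst.prodMk (measurable_fst.sub measurable_snd)

theorem measurePreserving_shear (μ : Measure (Space d)) [SFinite μ] :
    MeasurePreserving (shear d) (μ.prod volume) (μ.prod volume) := by
  have h1 := measurePreserving_prod_neg_add μ (volume : Measure (Space d))
  have h2 : MeasurePreserving (Prod.map id Neg.neg) (μ.prod volume)
      (μ.prod (volume : Measure (Space d))) :=
    (MeasurePreserving.id μ).prod (Measure.measurePreserving_neg volume)
  have h3 := h2.comp h1
  convert h3 using 1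
  funext p
  simp [shear, sub_eq_add_neg, add_comm]

theorem integrable_shear_iff {F : Type*} [NormedAddCommGroup F] {A : Set (Space d)}
    {g : Space d × Space d → F} :
    IntegrableOn (fun p => g (p.1, p.1 - p.2)) (A ×ˢ Set.univ)
      ↔ IntegrableOn g (A ×ˢ Set.univ) := by
  have h := (measurePreserving_shear (volume.restrict A)).integrable_comp_emb
    (shear d).measurableEmbedding (g := g)
  rw [IntegrableOn, IntegrableOn, Measure.volume_eq_prod, ← Measure.prod_restrict,
    Measure.restrict_univ]
  exact h

theorem integral_shear {F : Type*} [NormedAddCommGroup F] [NormedSpace ℝ F] {A : Set (Space d)}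
    (g : Space d × Space d → F) :
    ∫ p in A ×ˢ Set.univ, g (p.1, p.1 - p.2) = ∫ p in A ×ˢ Set.univ, g p := by
  have h := (measurePreserving_shear (volume.restrict A)).integral_comp
    (shear d).measurableEmbedding g
  rw [Measure.volume_eq_prod, ← Measure.prod_restrict, Measure.restrict_univ]
  exact h

variable {𝕜 : Type*} [RCLike 𝕜]

theorem integrableOn_mul_conv {A : Set (Space d)} {f φ : Space d → 𝕜} (hf : IntegrableOn f A)
    (hφ : Integrable φ) :
    IntegrableOn (fun p : Space d × Space d => f p.1 * φ (p.1 - p.2)) (A ×ˢ Set.univ) := by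
  rw [integrable_shear_iff (g := fun p : Space d × Space d => f p.1 * φ p.2), IntegrableOn,
    Measure.volume_eq_prod, ← Measure.prod_restrict, Measure.restrict_univ]
  exact Integrable.mul_prod hf hφ

theorem integral_mul_conv {A : Set (Space d)} (f φ : Space d → 𝕜) :
    ∫ p in A ×ˢ Set.univ, f p.1 * φ (p.1 - p.2) = (∫ x in A, f x) * ∫ x, φ x := by
  rw [integral_shear (fun p : Space d × Space d => f p.1 * φ p.2), Measure.volume_eq_prod,
    ← Measure.prod_restrict, Measure.restrict_univ, integral_prod_mul]

theorem integrableOn_conv {A : Set (Space d)} (hA : volume A ≠ ∞) {φ : Space d → 𝕜}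
    (hφ : Integrable φ) :
    IntegrableOn (fun p : Space d × Space d => φ (p.1 - p.2)) (A ×ˢ Set.univ) := by
  have h := integrableOn_mul_conv (A := A) (f := fun _ => (1 : 𝕜)) (integrableOn_const hA) hφ
  simpa using h

/-- Differences of points of a ball of radius `M` have norm less than `2M`, so `φ` may be cut off
there and becomes globally integrable. -/
theorem integrableOn_conv_of_locallyIntegrable {A : Set (Space d)} (hA : Bornology.IsBounded A)
    {φ : Space d → 𝕜} (hφ : ∀ r, IntegrableOn φ (Metric.ball 0 r)) :
    IntegrableOn (fun p : Space d × Space d => φ (p.1 - p.2)) (A ×ˢ A) := by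
  obtain ⟨M, hM⟩ := hA.subset_ball 0
  have h1 : Integrable ((Metric.ball (0 : Space d) (2 * M)).indicator φ) :=
    (integrable_indicator_iff Metric.isOpen_ball.measurableSet).2 (hφ _)
  have h2 := (integrableOn_conv (A := Metric.ball (0 : Space d) M) measure_ball_lt_top.ne h1).mono_set
    (Set.prod_mono_right (Set.subset_univ (Metric.ball (0 : Space d) M)))
  have h3 : IntegrableOn (fun p : Space d × Space d => φ (p.1 - p.2))
      (Metric.ball 0 M ×ˢ Metric.ball 0 M) := by
    refine h2.congr_fun (fun p hp => ?_)
      (Metric.isOpen_ball.measurableSet.prod Metric.isOpen_ball.measurableSet)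
    refine Set.indicator_of_mem ?_ φ
    have := norm_sub_le p.1 p.2
    have h1 := mem_ball_zero_iff.1 hp.1
    have h2 := mem_ball_zero_iff.1 hp.2
    rw [mem_ball_zero_iff]
    linarith
  exact h3.mono_set (Set.prod_mono hM hM)

theorem ae_prod_of_ae_sub {p : Space d → Prop} (h : ∀ᵐ x : Space d, p x) :
    ∀ᵐ q : Space d × Space d, p (q.1 - q.2) := by
  have h1 := (measurePreserving_shear (volume : Measure (Space d))).quasiMeasurePreserving
  have h2 : ∀ᵐ q : Space d × Space d, p q.2 := Measure.quasiMeasurePreserving_snd.ae h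
  exact h1.ae h2

theorem ae_ne_zero (hd : 1 ≤ d) : ∀ᵐ x : Space d, x ≠ 0 := by
  have : Nonempty (Fin d) := ⟨⟨0, hd⟩⟩
  rw [ae_iff]
  simp only [ne_eq, not_not, Set.ofPred_eq_eq_singleton]
  exact measure_singleton 0

end Shear

/-! ### Integrability of radial functions -/

section RadialIntegrability

variable {d : ℕ}

/-- In polar coordinates the radial exponent is `d - 1 - σ > -1` near the origin and `d - 1 - σ - b
< -1` at infinity. -/
theorem integrable_rpow_div_one_add (hd : 1 ≤ d) {σ b : ℝ} (h1 : (d : ℝ) - b < σ)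
    (h2 : σ < d) : Integrable fun x : Space d => ‖x‖ ^ (-σ) / (1 + ‖x‖ ^ b) := by
  have : Nonempty (Fin d) := ⟨⟨0, hd⟩⟩
  rw [integrable_fun_norm_addHaar (μ := (volume : Measure (Space d)))
    (f := fun r => r ^ (-σ) / (1 + r ^ b)), finrank_euclideanSpace_fin]
  have hmeas : Measurable fun y : ℝ => y ^ (d - 1) • (y ^ (-σ) / (1 + y ^ b)) := by fun_prop
  have e : ∀ y : ℝ, 0 < y → y ^ (d - 1) * y ^ (-σ) = y ^ ((d : ℝ) - 1 - σ) := fun y hy => by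
    rw [← Real.rpow_natCast, ← Real.rpow_add hy, Nat.cast_sub hd]
    congr 1; push_cast; ring
  rw [← Set.Ioc_union_Ioi_eq_Ioi zero_le_one]
  refine IntegrableOn.union ?_ ?_
  · have hi : IntegrableOn (fun y : ℝ => y ^ ((d : ℝ) - 1 - σ)) (Set.Ioc 0 1) := by
      rw [← intervalIntegrable_iff_integrableOn_Ioc_of_le zero_le_one]
      exact intervalIntegral.intervalIntegrable_rpow' (by linarith)
    refine Integrable.mono' hi hmeas.aestronglyMeasurable ?_
    filter_upwards [ae_restrict_mem measurableSet_Ioc] with y hy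
    have hy0 : 0 < y := hy.1
    have h3 := Real.rpow_pos_of_pos hy0 b
    rw [smul_eq_mul, ← mul_div_assoc, e y hy0, Real.norm_of_nonneg (by positivity)]
    exact div_le_self (by positivity) (by linarith)
  · have hi : IntegrableOn (fun y : ℝ => y ^ ((d : ℝ) - 1 - σ - b)) (Set.Ioi 1) :=
      integrableOn_Ioi_rpow_of_lt (by linarith) one_pos
    refine Integrable.mono' hi hmeas.aestronglyMeasurable ?_
    filter_upwards [ae_restrict_mem measurableSet_Ioi] with y hy
    have hy0 : 0 < y := one_pos.trans hy
    have h3 := Real.rpow_pos_of_pos hy0 b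
    rw [smul_eq_mul, ← mul_div_assoc, e y hy0, Real.norm_of_nonneg (by positivity),
      Real.rpow_sub hy0 _ b]
    exact div_le_div_of_nonneg_left (by positivity) h3 (by linarith)

theorem integrable_indicator_rpow (hd : 1 ≤ d) {σ : ℝ} (h : (d : ℝ) < σ) :
    IntegrableOn (fun x : Space d => ‖x‖ ^ (-σ)) {x | 1 ≤ ‖x‖} := by
  have hm : MeasurableSet {x : Space d | 1 ≤ ‖x‖} := measurableSet_le (by fun_prop) (by fun_prop)
  -- The two exponents add up to `σ`, and for `‖x‖ ≥ 1` the denominator is at most twice its power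
  -- term, which accounts for the factor `2`.
  have hi := ((integrable_rpow_div_one_add (σ := d - 1 / 2) (b := σ - d + 1 / 2) hd
    (by linarith) (by linarith)).const_mul 2).integrableOn (s := {x | 1 ≤ ‖x‖})
  refine Integrable.mono' hi (Measurable.aestronglyMeasurable (by fun_prop)) ?_
  filter_upwards [ae_restrict_mem hm] with x hx
  have hx0 : 0 < ‖x‖ := one_pos.trans_le hx
  have h1 : 1 ≤ ‖x‖ ^ (σ - d + 1 / 2) := Real.one_le_rpow hx (by linarith)
  rw [Real.norm_of_nonneg (by positivity), ← mul_div_assoc, le_div_iff₀ (by positivity)]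
  have e : ‖x‖ ^ (-((d : ℝ) - 1 / 2)) = ‖x‖ ^ (-σ) * ‖x‖ ^ (σ - d + 1 / 2) := by
    rw [← Real.rpow_add hx0]; congr 1; ring
  rw [e]
  have := Real.rpow_pos_of_pos hx0 (-σ)
  nlinarith

theorem abs_riesz_of_ne {s : ℝ} (hs : s ≠ 0) (x : Space d) : |riesz s x| = ‖x‖ ^ (-s) := by
  unfold riesz
  split_ifs with h
  · exact abs_of_nonneg (by positivity)
  · rw [abs_neg]; exact abs_of_nonneg (by positivity)

theorem abs_riesz_zero_le {ε : ℝ} (hε : 0 < ε) (x : Space d) :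
    |riesz 0 x| ≤ (‖x‖ ^ ε + ‖x‖ ^ (-ε)) / ε := by
  have e : riesz 0 x = -Real.log ‖x‖ := by simp [riesz]
  rw [e, abs_neg, abs_le]
  have h1 := Real.log_le_rpow_div (norm_nonneg x) hε
  have h2 := Real.log_le_rpow_div (inv_nonneg.2 (norm_nonneg x)) hε
  rw [Real.log_inv, Real.inv_rpow (norm_nonneg x), ← Real.rpow_neg (norm_nonneg x)] at h2
  have h3 : 0 ≤ ‖x‖ ^ ε / ε := by positivity
  have h4 : 0 ≤ ‖x‖ ^ (-ε) / ε := by positivity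
  rw [add_div]
  constructor <;> linarith

theorem integrable_riesz_div_one_add (hd : 1 ≤ d) {s b : ℝ} (h1 : (d : ℝ) - b < s)
    (h2 : s < d) : Integrable fun x : Space d => |riesz s x| / (1 + ‖x‖ ^ b) := by
  by_cases hs : s = 0
  · subst hs
    have hd' : (1 : ℝ) ≤ d := by exact_mod_cast hd
    -- The logarithm is dominated by the powers `±ε`, and this choice keeps both exponents inside
    -- the window `(d - b, d)`.
    set ε := min (1 / 2) ((b - d) / 2)
    have hε : 0 < ε := lt_min (by norm_num) (by linarith)
    have hε1 : ε ≤ 1 / 2 := min_le_left _ _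
    have hε2 : ε ≤ (b - d) / 2 := min_le_right _ _
    have i1 := integrable_rpow_div_one_add (σ := ε) (b := b) hd (by linarith) (by linarith)
    have i2 := integrable_rpow_div_one_add (σ := -ε) (b := b) hd (by linarith) (by linarith)
    refine Integrable.mono' ((i2.add i1).div_const ε) ?_ (Eventually.of_forall fun x => ?_)
    · have := measurable_riesz (d := d) 0
      exact (Measurable.div (by fun_prop) (by fun_prop)).aestronglyMeasurable
    · have h3 := abs_riesz_zero_le hε x
      have h4 : 0 ≤ ‖x‖ ^ b := by positivity
      rw [Real.norm_of_nonneg (by positivity)]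
      simp only [Pi.add_apply, neg_neg]
      calc _ ≤ ((‖x‖ ^ ε + ‖x‖ ^ (-ε)) / ε) / (1 + ‖x‖ ^ b) := by gcongr
        _ = _ := by ring
  · simp_rw [abs_riesz_of_ne hs]
    exact integrable_rpow_div_one_add hd h1 h2

theorem integrableOn_ball_riesz (hd : 1 ≤ d) {s : ℝ} (h : s < d) (r : ℝ) :
    IntegrableOn (riesz s : Space d → ℝ) (Metric.ball 0 r) := by
  set b := (d : ℝ) - s + 1
  have hb : 0 < b := by simp only [b]; linarith
  have hi := ((integrable_riesz_div_one_add (b := b) hd (by simp only [b]; linarith)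
    h).const_mul (1 + |r| ^ b)).integrableOn (s := Metric.ball 0 r)
  refine Integrable.mono' hi (measurable_riesz s).aestronglyMeasurable ?_
  filter_upwards [ae_restrict_mem Metric.isOpen_ball.measurableSet] with x hx
  have hx' : ‖x‖ ≤ |r| := ((mem_ball_zero_iff.1 hx).trans_le (le_abs_self r)).le
  have h1 := Real.rpow_le_rpow (norm_nonneg x) hx' hb.le
  have h2 := Real.rpow_nonneg (norm_nonneg x) b
  rw [Real.norm_eq_abs, ← mul_div_assoc, le_div_iff₀ (by positivity), mul_comm]
  gcongr

/-- Superpolynomial smallness of `exp (-1/(C r^a))` at `r = 0`. -/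
theorem exists_exp_neg_inv_mul_rpow_le {a C : ℝ} (ha : 0 < a) (hC : 0 < C) (σ : ℝ) :
    ∃ K : ℝ, 0 ≤ K ∧ ∀ r : ℝ, 0 < r → r ≤ 1 →
      Real.exp (-(1 / (C * r ^ a))) * r ^ (-σ) ≤ K := by
  -- A single term of the exponential series, of order at least `σ / a`, already compensates `r ^
  -- (-σ)` on `(0, 1]`.
  obtain ⟨N, hN⟩ := exists_nat_ge (σ / a)
  refine ⟨N.factorial * C ^ N, by positivity, fun r hr hr1 => ?_⟩
  have hra : 0 < r ^ a := Real.rpow_pos_of_pos hr a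
  have h1 := Real.pow_div_factorial_le_exp (1 / (C * r ^ a)) (by positivity) N
  have h2 : Real.exp (-(1 / (C * r ^ a))) ≤ N.factorial * C ^ N * (r ^ a) ^ N := by
    rw [Real.exp_neg, inv_le_comm₀ (Real.exp_pos _) (by positivity)]
    refine le_trans (le_of_eq ?_) h1
    rw [div_pow, mul_pow, one_pow]; field_simp
  have h3 : (r ^ a) ^ N * r ^ (-σ) ≤ 1 := by
    rw [← Real.rpow_natCast, ← Real.rpow_mul hr.le, ← Real.rpow_add hr]
    refine Real.rpow_le_one hr.le hr1 ?_
    rw [div_le_iff₀ ha] at hN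
    linarith
  calc _ ≤ N.factorial * C ^ N * (r ^ a) ^ N * r ^ (-σ) := by gcongr
    _ = N.factorial * C ^ N * ((r ^ a) ^ N * r ^ (-σ)) := by ring
    _ ≤ _ := mul_le_of_le_one_right (by positivity) h3

end RadialIntegrability

/-! ### The Riesz potential as a mixture of Gaussians -/

section GammaRepresentation

/-- The normalization of the representation of the Riesz potential as a mixture of Gaussians. -/
def mixConst (s : ℝ) : ℝ := if s = 0 then 1 / 2 else |s| / 2 / Real.Gamma (s / 2 + 1)

theorem mixConst_pos {s : ℝ} (hs : -2 < s) : 0 < mixConst s := by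
  unfold mixConst
  split_ifs with h
  · norm_num
  · have := Real.Gamma_pos_of_pos (s := s / 2 + 1) (by linarith)
    have := abs_pos.2 h
    positivity

/-- From `Γ(s/2 + 1) = (s/2) Γ(s/2)`. The form of the definition makes positivity on all of `s > -2`
visible; this one matches the Fourier constant and the factor `1/Γ(s/2)` of the continuation. -/
theorem mixConst_of_ne {s : ℝ} (hs : s ≠ 0) : mixConst s = Real.sign s / Real.Gamma (s / 2) := by
  rw [mixConst, if_neg hs, Real.Gamma_add_one (by simpa using hs)]
  rcases hs.lt_or_gt with h | h
  · rw [Real.sign_of_neg h, abs_of_neg h]; field_simp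
  · rw [Real.sign_of_pos h, abs_of_pos h]; field_simp

/-- The difference of exponentials gains a factor `t`, which makes the mixture converge at `t = 0`
for all `s > -2` rather than only for `s > 0`. -/
theorem integral_exp_sub {a t : ℝ} :
    ∫ u in a..1, t * Real.exp (-(t * u)) = Real.exp (-(t * a)) - Real.exp (-t) := by
  have h : ∀ u ∈ Set.uIcc a 1, HasDerivAt (fun u => -Real.exp (-(t * u)))
      (t * Real.exp (-(t * u))) u := fun u _ => by
    have := (((hasDerivAt_id u).const_mul t).neg.exp).neg
    refine HasDerivAt.congr_deriv (f := fun u => -Real.exp (-(t * u))) this ?_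
    simp only [mul_one, Pi.neg_apply, id]; ring
  rw [intervalIntegral.integral_eq_sub_of_hasDerivAt h
    (Continuous.intervalIntegrable (by fun_prop) _ _)]
  simp only [mul_one]; ring

variable {a s : ℝ}

theorem integrable_mix_aux (ha : 0 < a) (hs : -2 < s) :
    Integrable (fun p : ℝ × ℝ => p.1 ^ (s / 2) * Real.exp (-(p.1 * p.2)))
      ((volume.restrict (Set.Ioi 0)).prod (volume.restrict (Set.uIoc a 1))) := by
  have hc : 0 < min a 1 := lt_min ha one_pos
  have h1 : IntegrableOn (fun t : ℝ => t ^ (s / 2) * Real.exp (-(min a 1) * t ^ (1 : ℝ)))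
      (Set.Ioi 0) := integrableOn_rpow_mul_exp_neg_mul_rpow (by linarith) one_pos hc
  have h2 : IntegrableOn (fun _ : ℝ => (1 : ℝ)) (Set.uIoc a 1) :=
    integrableOn_const (by simp [Set.uIoc])
  have h3 := Integrable.mul_prod h1 h2
  refine Integrable.mono' h3 (by fun_prop) ?_
  rw [Measure.prod_restrict]
  filter_upwards [ae_restrict_mem (measurableSet_Ioi.prod measurableSet_uIoc)] with p hp
  have hp1 : 0 < p.1 := hp.1
  have hp2 : min a 1 < p.2 := hp.2.1
  rw [Real.norm_of_nonneg (by positivity), mul_one, Real.rpow_one]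
  have : Real.exp (-(p.1 * p.2)) ≤ Real.exp (-(min a 1) * p.1) := by
    rw [Real.exp_le_exp]; nlinarith
  gcongr

theorem mix_inner_eq (t : ℝ) (ht : 0 < t) :
    t ^ (s / 2 - 1) * (Real.exp (-(t * a)) - Real.exp (-t))
      = (if a ≤ 1 then 1 else -1) *
        ∫ u in Set.uIoc a 1, t ^ (s / 2) * Real.exp (-(t * u)) := by
  rw [← integral_exp_sub, intervalIntegral.intervalIntegral_eq_integral_uIoc, smul_eq_mul,
    integral_const_mul, integral_const_mul, Real.rpow_sub_one ht.ne']
  field_simp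

theorem integrableOn_mix (ha : 0 < a) (hs : -2 < s) :
    IntegrableOn (fun t : ℝ => t ^ (s / 2 - 1) * (Real.exp (-(t * a)) - Real.exp (-t)))
      (Set.Ioi 0) := by
  have h := (integrable_mix_aux ha hs).integral_prod_left.const_mul (if a ≤ 1 then (1 : ℝ) else -1)
  refine Integrable.congr h ?_
  filter_upwards [ae_restrict_mem measurableSet_Ioi] with t ht
  exact (mix_inner_eq t ht).symm

/-- After exchanging the integrals, the `t`-integral is a Gamma integral. What remains, the integral
of `u ^ (-s/2 - 1)` between `a` and `1`, treats powers of both signs and the logarithm at once. -/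
theorem integral_mix (ha : 0 < a) (hs : -2 < s) :
    ∫ t in Set.Ioi (0 : ℝ), t ^ (s / 2 - 1) * (Real.exp (-(t * a)) - Real.exp (-t))
      = Real.Gamma (s / 2 + 1) * ∫ u in a..1, u ^ (-(s / 2) - 1) := by
  rw [setIntegral_congr_fun measurableSet_Ioi fun t ht => mix_inner_eq t ht, integral_const_mul,
    integral_integral_swap (integrable_mix_aux ha hs), ← smul_eq_mul,
    intervalIntegral.intervalIntegral_eq_integral_uIoc, ← smul_eq_mul (Real.Gamma _), smul_comm]
  congr 1
  rw [smul_eq_mul, ← integral_const_mul]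
  refine setIntegral_congr_fun measurableSet_uIoc fun u hu => ?_
  have hu0 : 0 < u := (lt_min ha one_pos).trans hu.1
  have h := Real.integral_rpow_mul_exp_neg_mul_Ioi (a := s / 2 + 1) (r := u) (by linarith) hu0
  simp only [add_sub_cancel_right] at h
  simp only [mul_comm _ u]
  rw [h, one_div, Real.inv_rpow hu0.le, ← Real.rpow_neg hu0.le, mul_comm]
  congr 2; ring

/-- The integrand has constant sign in `t`, decided by whether `a ≤ 1`. Absolute integrability of
the mixture therefore reduces to local integrability of the potential itself. -/
theorem integral_norm_mix :
    ∫ t in Set.Ioi (0 : ℝ), ‖t ^ (s / 2 - 1) * (Real.exp (-(t * a)) - Real.exp (-t))‖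
      = |∫ t in Set.Ioi (0 : ℝ), t ^ (s / 2 - 1) * (Real.exp (-(t * a)) - Real.exp (-t))| := by
  by_cases h : a ≤ 1
  · rw [abs_of_nonneg]
    · refine setIntegral_congr_fun measurableSet_Ioi fun t ht => Real.norm_of_nonneg ?_
      have ht : 0 < t := ht
      exact mul_nonneg (by positivity)
        (sub_nonneg.2 (Real.exp_le_exp.2 (by nlinarith)))
    · refine setIntegral_nonneg measurableSet_Ioi fun t ht => ?_
      have ht : 0 < t := ht
      exact mul_nonneg (by positivity)
        (sub_nonneg.2 (Real.exp_le_exp.2 (by nlinarith)))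
  · have h : 1 ≤ a := (not_le.1 h).le
    rw [abs_of_nonpos, ← integral_neg]
    · refine setIntegral_congr_fun measurableSet_Ioi fun t ht => Real.norm_of_nonpos ?_
      have ht : 0 < t := ht
      exact mul_nonpos_of_nonneg_of_nonpos (by positivity)
        (sub_nonpos.2 (Real.exp_le_exp.2 (by nlinarith)))
    · refine setIntegral_nonpos measurableSet_Ioi fun t ht => ?_
      have ht : 0 < t := ht
      exact mul_nonpos_of_nonneg_of_nonpos (by positivity)
        (sub_nonpos.2 (Real.exp_le_exp.2 (by nlinarith)))

/-- The subtracted constant `Real.sign s` is the value of the potential on the unit sphere,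
including the value `0` of the logarithm, since the mixture vanishes at `‖x‖ = 1`. -/
theorem riesz_eq_mix {d : ℕ} (hs : -2 < s) {x : Space d} (hx : x ≠ 0) :
    riesz s x - Real.sign s = mixConst s *
      ∫ t in Set.Ioi (0 : ℝ), t ^ (s / 2 - 1) * (Real.exp (-(t * ‖x‖ ^ 2)) - Real.exp (-t)) := by
  have hx' : 0 < ‖x‖ := norm_pos_iff.2 hx
  have ha : 0 < ‖x‖ ^ 2 := by positivity
  have hΓ := Real.Gamma_pos_of_pos (s := s / 2 + 1) (by linarith)
  rw [integral_mix ha hs]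
  by_cases h0 : s = 0
  · subst h0
    have e : ∀ u : ℝ, u ^ (-((0 : ℝ) / 2) - 1) = u⁻¹ := fun u => by
      rw [show (-((0 : ℝ) / 2) - 1) = -1 by norm_num, Real.rpow_neg_one]
    simp only [e]
    rw [integral_inv_of_pos ha one_pos]
    simp [mixConst, riesz]
  · have hr : (‖x‖ ^ 2) ^ (-(s / 2)) = ‖x‖ ^ (-s) := by
      rw [← Real.rpow_natCast, ← Real.rpow_mul hx'.le]; congr 1; push_cast; ring
    have h0' : (0 : ℝ) ∉ Set.uIcc (‖x‖ ^ 2) 1 := fun h => by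
      have := h.1
      exact absurd this (not_le.2 (lt_min ha one_pos))
    rw [integral_rpow (Or.inr ⟨by intro h; apply h0; linarith, h0'⟩)]
    rw [show -(s / 2) - 1 + 1 = -(s / 2) by ring, hr, Real.one_rpow, mixConst, if_neg h0]
    generalize Real.Gamma (s / 2 + 1) = G at hΓ
    rcases lt_or_gt_of_ne h0 with h | h
    · rw [riesz, if_neg h.not_gt, if_neg h0, Real.sign_of_neg h, abs_of_neg h]
      field_simp
      ring
    · rw [riesz, if_pos h, Real.sign_of_pos h, abs_of_pos h]
      field_simp
      ring

end GammaRepresentation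

/-! ### Taylor expansion of a Gaussian around a lattice vector -/

section GaussianTaylor

/-- Polynomial and exponential factors in `ξ` are absorbed at the price of `exp (3/4 ξ²)`, so that a
quarter of the original Gaussian decay survives. -/
theorem one_add_pow_mul_exp_le {A ξ : ℝ} (hξ : 0 ≤ ξ) (n : ℕ) :
    (1 + ξ) ^ n * Real.exp (A * (1 + ξ))
      ≤ Real.exp ((A + n) + (A + n) ^ 2) * Real.exp (3 / 4 * ξ ^ 2) := by
  have h1 : (1 + ξ) ^ n ≤ Real.exp (n * (1 + ξ)) := by
    rw [Real.exp_nat_mul]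
    exact pow_le_pow_left₀ (by linarith) (by linarith [Real.add_one_le_exp (1 + ξ)]) n
  calc (1 + ξ) ^ n * Real.exp (A * (1 + ξ))
      ≤ Real.exp (n * (1 + ξ)) * Real.exp (A * (1 + ξ)) := by gcongr
    _ = Real.exp ((A + n) * (1 + ξ)) := by rw [← Real.exp_add]; congr 1; ring
    _ ≤ _ := by
      rw [← Real.exp_add, Real.exp_le_exp]
      nlinarith [sq_nonneg ((A + n) - ξ / 2)]

theorem abs_exp_sub_taylor_le (x : ℝ) (n : ℕ) :
    |Real.exp x - ∑ k ∈ Finset.range n, x ^ k / k.factorial| ≤ |x| ^ n * Real.exp |x| := by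
  have h := Complex.norm_exp_sub_sum_le_norm_mul_exp (x : ℂ) n
  have e : Complex.exp x - ∑ k ∈ Finset.range n, (x : ℂ) ^ k / k.factorial
      = ((Real.exp x - ∑ k ∈ Finset.range n, x ^ k / k.factorial : ℝ) : ℂ) := by
    push_cast; rfl
  rw [e, Complex.norm_real, Complex.norm_real] at h
  exact h

/-- In powers of `τ`, the variable `α` has weight one and `β` weight two, so `1 + α` is the part of
the exponential of weight less than two. -/
theorem abs_exp_add_sub_two_le {A τ ξ α β : ℝ} (hA : 1 ≤ A) (hτ : 0 ≤ τ) (hτ1 : τ ≤ 1) (hξ : 0 ≤ ξ)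
    (hα : |α| ≤ A * τ * ξ) (hβ : |β| ≤ A * τ ^ 2) :
    |Real.exp (α + β) - (1 + α)|
      ≤ (2 * A ^ 2) * τ ^ 2 * ((1 + ξ) ^ 2 * Real.exp (A * (1 + ξ))) := by
  have hx : |α + β| ≤ A * τ * (1 + ξ) := by
    have := abs_add_le α β
    nlinarith [mul_nonneg (by linarith : 0 ≤ A) (mul_nonneg hτ (sub_nonneg.2 hτ1))]
  have hx' : |α + β| ≤ A * (1 + ξ) := hx.trans (by
    have : 0 ≤ A * (1 + ξ) := by positivity
    nlinarith)
  have h := abs_exp_sub_taylor_le (α + β) 2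
  have h1 : |α + β| ^ 2 * Real.exp |α + β| ≤ (A * τ * (1 + ξ)) ^ 2 * Real.exp (A * (1 + ξ)) := by
    gcongr
  have e : Real.exp (α + β) - (1 + α)
      = (Real.exp (α + β) - ∑ k ∈ Finset.range 2, (α + β) ^ k / k.factorial) + β := by
    simp [Finset.sum_range_succ]; ring
  have h2 : (1 : ℝ) ≤ (1 + ξ) ^ 2 * Real.exp (A * (1 + ξ)) := by
    refine one_le_mul_of_one_le_of_one_le (one_le_pow₀ (by linarith)) (Real.one_le_exp ?_)
    positivity
  have h3 : A * τ ^ 2 ≤ A ^ 2 * τ ^ 2 * ((1 + ξ) ^ 2 * Real.exp (A * (1 + ξ))) := by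
    calc A * τ ^ 2 ≤ A ^ 2 * τ ^ 2 * 1 := by
          rw [mul_one]; gcongr; nlinarith
      _ ≤ _ := by gcongr
  rw [e]
  refine (abs_add_le _ _).trans ?_
  calc _ ≤ (A * τ * (1 + ξ)) ^ 2 * Real.exp (A * (1 + ξ))
        + A ^ 2 * τ ^ 2 * ((1 + ξ) ^ 2 * Real.exp (A * (1 + ξ))) :=
      add_le_add (h.trans h1) (hβ.trans h3)
    _ = _ := by ring

/-- The subtracted polynomial collects the terms of weight at most three. The other terms of the
cubic Taylor polynomial, `β²`, `α²β`, `αβ²` and `β³`, have weight at least four and join the error.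
-/
theorem abs_exp_add_sub_four_le {A τ ξ α β : ℝ} (hA : 1 ≤ A) (hτ : 0 ≤ τ) (hτ1 : τ ≤ 1)
    (hξ : 0 ≤ ξ) (hα : |α| ≤ A * τ * ξ) (hβ : |β| ≤ A * τ ^ 2) :
    |Real.exp (α + β) - (1 + α + β + α ^ 2 / 2 + α * β + α ^ 3 / 6)|
      ≤ (4 * A ^ 4) * τ ^ 4 * ((1 + ξ) ^ 4 * Real.exp (A * (1 + ξ))) := by
  have hA0 : 0 ≤ A := by linarith
  have hα' : |α| ≤ A * τ * (1 + ξ) := hα.trans (by gcongr; linarith)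
  have hβ' : |β| ≤ A * τ ^ 2 * (1 + ξ) := hβ.trans (le_mul_of_one_le_right (by positivity)
    (by linarith))
  have hx : |α + β| ≤ A * τ * (1 + ξ) := by
    have := abs_add_le α β
    nlinarith [mul_nonneg hA0 (mul_nonneg hτ (sub_nonneg.2 hτ1))]
  have hx' : |α + β| ≤ A * (1 + ξ) := hx.trans (by
    have : 0 ≤ A * (1 + ξ) := by positivity
    nlinarith)
  have h := abs_exp_sub_taylor_le (α + β) 4
  have h1 : |α + β| ^ 4 * Real.exp |α + β| ≤ (A * τ * (1 + ξ)) ^ 4 * Real.exp (A * (1 + ξ)) := by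
    gcongr
  have e : Real.exp (α + β) - (1 + α + β + α ^ 2 / 2 + α * β + α ^ 3 / 6)
      = (Real.exp (α + β) - ∑ k ∈ Finset.range 4, (α + β) ^ k / k.factorial)
        + (β ^ 2 / 2 + α ^ 2 * β / 2 + α * β ^ 2 / 2 + β ^ 3 / 6) := by
    simp only [Finset.sum_range_succ, Finset.sum_range_zero, Nat.factorial]
    push_cast; ring
  have h2 : (1 : ℝ) ≤ Real.exp (A * (1 + ξ)) := Real.one_le_exp (by positivity)
  have hξ1 : (1 : ℝ) ≤ 1 + ξ := by linarith
  have p2 : (1 + ξ) ^ 2 ≤ (1 + ξ) ^ 4 := pow_le_pow_right₀ hξ1 (by norm_num)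
  have p3 : (1 + ξ) ^ 3 ≤ (1 + ξ) ^ 4 := pow_le_pow_right₀ hξ1 (by norm_num)
  have q2 : A ^ 2 ≤ A ^ 4 := pow_le_pow_right₀ hA (by norm_num)
  have q3 : A ^ 3 ≤ A ^ 4 := pow_le_pow_right₀ hA (by norm_num)
  have r5 : τ ^ 5 ≤ τ ^ 4 := pow_le_pow_of_le_one hτ hτ1 (by norm_num)
  have r6 : τ ^ 6 ≤ τ ^ 4 := pow_le_pow_of_le_one hτ hτ1 (by norm_num)
  set M := A ^ 4 * τ ^ 4 * (1 + ξ) ^ 4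
  have hM : 0 ≤ M := by positivity
  have t1 : |β ^ 2| ≤ M := by
    rw [abs_pow]
    calc |β| ^ 2 ≤ (A * τ ^ 2 * (1 + ξ)) ^ 2 := by gcongr
      _ = A ^ 2 * τ ^ 4 * (1 + ξ) ^ 2 := by ring
      _ ≤ M := by simp only [M]; gcongr
  have t2 : |α ^ 2 * β| ≤ M := by
    rw [abs_mul, abs_pow]
    calc |α| ^ 2 * |β| ≤ (A * τ * (1 + ξ)) ^ 2 * (A * τ ^ 2 * (1 + ξ)) := by gcongr
      _ = A ^ 3 * τ ^ 4 * (1 + ξ) ^ 3 := by ring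
      _ ≤ M := by simp only [M]; gcongr
  have t3 : |α * β ^ 2| ≤ M := by
    rw [abs_mul, abs_pow]
    calc |α| * |β| ^ 2 ≤ (A * τ * (1 + ξ)) * (A * τ ^ 2 * (1 + ξ)) ^ 2 := by gcongr
      _ = A ^ 3 * τ ^ 5 * (1 + ξ) ^ 3 := by ring
      _ ≤ M := by simp only [M]; gcongr
  have t4 : |β ^ 3| ≤ M := by
    rw [abs_pow]
    calc |β| ^ 3 ≤ (A * τ ^ 2 * (1 + ξ)) ^ 3 := by gcongr
      _ = A ^ 3 * τ ^ 6 * (1 + ξ) ^ 3 := by ring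
      _ ≤ M := by simp only [M]; gcongr
  have hrest : |β ^ 2 / 2 + α ^ 2 * β / 2 + α * β ^ 2 / 2 + β ^ 3 / 6| ≤ 2 * M := by
    rw [abs_le] at t1 t2 t3 t4 ⊢
    constructor <;> linarith [t1.1, t1.2, t2.1, t2.2, t3.1, t3.2, t4.1, t4.2]
  have hrest' : 2 * M ≤ 2 * M * Real.exp (A * (1 + ξ)) :=
    le_mul_of_one_le_right (by positivity) h2
  rw [e]
  refine (abs_add_le _ _).trans ?_
  calc _ ≤ (A * τ * (1 + ξ)) ^ 4 * Real.exp (A * (1 + ξ)) + 2 * M * Real.exp (A * (1 + ξ)) :=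
      add_le_add (h.trans h1) (hrest.trans hrest')
    _ = 3 * M * Real.exp (A * (1 + ξ)) := by simp only [M]; ring
    _ ≤ 4 * M * Real.exp (A * (1 + ξ)) := by gcongr; norm_num
    _ = _ := by simp only [M]; ring

variable {d : ℕ}

/-- The expansion of `exp (-t|u+w|²)` up to third order in `w`, respectively up to first order. -/
def gaussPoly (m : ℕ) (t : ℝ) (u w : Space d) : ℝ :=
  if m = 2 then 1 - 2 * t * inner ℝ u w
  else 1 - 2 * t * inner ℝ u w - t * ‖w‖ ^ 2 + (2 * t * inner ℝ u w) ^ 2 / 2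
    + 2 * t * inner ℝ u w * (t * ‖w‖ ^ 2) - (2 * t * inner ℝ u w) ^ 3 / 6

/-- After factoring out `exp (-t‖u‖²)`, the exponent is `α + β` with `α = -2t⟨u,w⟩ = O(τξ)` and `β =
-t‖w‖² = O(τ²)`, where `τ = √t` and `ξ = τ‖u‖`. Thus `τ ^ m = t ^ (m/2)`, and the growth in `ξ` is
paid by the Gaussian, uniformly in `u`. -/
theorem exists_gaussPoly_bound (m : ℕ) (hm : m = 2 ∨ m = 4) (W : ℝ) :
    ∃ C : ℝ, 0 ≤ C ∧ ∀ t : ℝ, 0 < t → t ≤ 1 → ∀ u w : Space d, ‖w‖ ≤ W →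
      |Real.exp (-(t * ‖u + w‖ ^ 2)) - Real.exp (-(t * ‖u‖ ^ 2)) * gaussPoly m t u w|
        ≤ C * t ^ ((m : ℝ) / 2) * Real.exp (-(t * ‖u‖ ^ 2 / 4)) := by
  set A := 1 + 2 * |W| + W ^ 2
  have hA : 1 ≤ A := by simp only [A]; nlinarith [abs_nonneg W, sq_nonneg W]
  set K := Real.exp ((A + m) + (A + m) ^ 2)
  refine ⟨4 * A ^ m * K, by positivity, fun t ht ht1 u w hw => ?_⟩
  set τ := Real.sqrt t
  have hτ2 : τ ^ 2 = t := Real.sq_sqrt ht.le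
  have hτ : 0 ≤ τ := Real.sqrt_nonneg t
  have hτ1 : τ ≤ 1 := Real.sqrt_le_one.2 ht1
  set ξ := τ * ‖u‖
  have hξ : 0 ≤ ξ := by positivity
  set α := -(2 * t * inner ℝ u w)
  set β := -(t * ‖w‖ ^ 2)
  have hw' : ‖w‖ ≤ |W| := hw.trans (le_abs_self W)
  have hα : |α| ≤ A * τ * ξ := by
    have h1 := abs_real_inner_le_norm u w
    simp only [α, abs_neg, abs_mul, abs_two, abs_of_pos ht]
    calc 2 * t * |inner ℝ u w| ≤ 2 * t * (‖u‖ * |W|) := by gcongr; exact h1.trans (by gcongr)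
      _ = (2 * |W|) * (t * ‖u‖) := by ring
      _ ≤ A * (t * ‖u‖) := by gcongr; simp only [A]; nlinarith [sq_nonneg W]
      _ = A * τ * ξ := by simp only [ξ]; rw [← hτ2]; ring
  have hβ : |β| ≤ A * τ ^ 2 := by
    simp only [β, abs_neg, abs_mul, abs_of_pos ht, hτ2]
    rw [abs_of_nonneg (by positivity)]
    have : ‖w‖ ^ 2 ≤ W ^ 2 := by rw [← sq_abs W]; gcongr
    nlinarith [abs_nonneg W]
  have hsplit : Real.exp (-(t * ‖u + w‖ ^ 2)) = Real.exp (-(t * ‖u‖ ^ 2)) * Real.exp (α + β) := by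
    rw [← Real.exp_add, norm_add_sq_real]; congr 1; simp only [α, β]; ring
  have hτm : τ ^ m = t ^ ((m : ℝ) / 2) := by
    rw [← Real.rpow_natCast, show τ = t ^ (1 / 2 : ℝ) from Real.sqrt_eq_rpow t,
      ← Real.rpow_mul ht.le]
    congr 1; ring
  have key : |Real.exp (α + β) - gaussPoly m t u w|
      ≤ 4 * A ^ m * τ ^ m * ((1 + ξ) ^ m * Real.exp (A * (1 + ξ))) := by
    rcases hm with rfl | rfl
    · have h := abs_exp_add_sub_two_le hA hτ hτ1 hξ hα hβ
      have e : gaussPoly 2 t u w = 1 + α := by simp [gaussPoly, α]; ring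
      rw [e]
      refine h.trans ?_
      have : 0 ≤ A ^ 2 := by positivity
      gcongr; norm_num
    · have h := abs_exp_add_sub_four_le hA hτ hτ1 hξ hα hβ
      have e : gaussPoly 4 t u w = 1 + α + β + α ^ 2 / 2 + α * β + α ^ 3 / 6 := by
        simp only [gaussPoly, α, β]; norm_num; ring
      rw [e]; exact h
  rw [hsplit, ← mul_sub, abs_mul, abs_of_pos (Real.exp_pos _)]
  calc _ ≤ Real.exp (-(t * ‖u‖ ^ 2))
        * (4 * A ^ m * τ ^ m * (K * Real.exp (3 / 4 * ξ ^ 2))) := by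
        refine mul_le_mul_of_nonneg_left (key.trans ?_) (Real.exp_pos _).le
        exact mul_le_mul_of_nonneg_left (one_add_pow_mul_exp_le hξ m) (by positivity)
    _ = 4 * A ^ m * K * t ^ ((m : ℝ) / 2)
        * (Real.exp (-(t * ‖u‖ ^ 2)) * Real.exp (3 / 4 * ξ ^ 2)) := by rw [← hτm]; ring
    _ = _ := by
        rw [← Real.exp_add]; congr 2
        simp only [ξ]; rw [mul_pow, hτ2]; ring

end GaussianTaylor

/-! ### Polynomials annihilated by a neutral charge density -/

section Annihilation

variable {d : ℕ} {Q : Set (Space d)} {f : Space d → ℝ}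

theorem integrableOn_bounded_mul (hQ : Bornology.IsBounded Q)
    (hf : Measurable f) {K : ℝ} (hK : ∀ x, |f x| ≤ K) {g : Space d → ℝ} (hg : Continuous g) :
    IntegrableOn (fun y => f y * g y) Q := by
  have hg' : IntegrableOn g Q :=
    (hg.continuousOn.integrableOn_compact hQ.isCompact_closure).mono_set subset_closure
  exact hg'.bdd_mul (c := K) hf.aestronglyMeasurable (Eventually.of_forall hK)

theorem integral_mul_affine (hQ : Bornology.IsBounded Q)
    (hf : Measurable f) {K : ℝ} (hK : ∀ x, |f x| ≤ K) (h0 : ∫ x in Q, f x = 0) (a : ℝ)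
    (v : Space d) (h1 : v = 0 ∨ ∫ x in Q, f x • x = 0) :
    ∫ y in Q, f y * (a + inner ℝ v y) = 0 := by
  have i1 := integrableOn_bounded_mul hQ hf hK (g := fun _ => a) continuous_const
  have i2 := integrableOn_bounded_mul hQ hf hK (g := fun y => inner ℝ v y) (by fun_prop)
  simp_rw [mul_add]
  rw [integral_add i1 i2, integral_mul_const, h0, zero_mul, zero_add]
  rcases h1 with rfl | h1
  · simp
  · have i3 : IntegrableOn (fun y => f y • y) Q := by
      have : IntegrableOn (fun y : Space d => y) Q :=
        (continuous_id.continuousOn.integrableOn_compact hQ.isCompact_closure).mono_set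
          subset_closure
      exact this.bdd_smul K hf.aestronglyMeasurable (Eventually.of_forall hK)
    have h2 := integral_inner (𝕜 := ℝ) i3 v
    rw [h1, inner_zero_right] at h2
    rw [← h2]
    refine integral_congr_ae (Eventually.of_forall fun y => ?_)
    simp [inner_smul_right]

/-- Each summand is affine in one of the two variables, and integrating that variable first gives
zero. The dipole condition is needed only when linear terms are present. -/
theorem integral_prod_affine (hQ : Bornology.IsBounded Q)
    (hf : Measurable f) {K : ℝ} (hK : ∀ x, |f x| ≤ K) (h0 : ∫ x in Q, f x = 0)
    {a b : Space d → ℝ} {v w : Space d → Space d} (ha : Continuous a) (hb : Continuous b)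
    (hv : Continuous v) (hw : Continuous w)
    (h1 : ((∀ x, v x = 0) ∧ ∀ x, w x = 0) ∨ ∫ x in Q, f x • x = 0) :
    ∫ p in Q ×ˢ Q, (a p.1 + inner ℝ (v p.1) p.2 + (b p.2 + inner ℝ (w p.2) p.1))
      * (f p.1 * f p.2) = 0 := by
  have hint : ∀ g : Space d × Space d → ℝ, Continuous g →
      IntegrableOn (fun p => g p * (f p.1 * f p.2)) (Q ×ˢ Q) := by
    intro g hg
    have hg' : IntegrableOn g (Q ×ˢ Q) :=
      (hg.continuousOn.integrableOn_compact (hQ.prod hQ).isCompact_closure).mono_set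
        subset_closure
    refine hg'.mul_bdd (c := K * K)
      (by fun_prop : Measurable fun p : Space d × Space d => f p.1 * f p.2).aestronglyMeasurable
      (Eventually.of_forall fun p => ?_)
    rw [norm_mul]
    exact mul_le_mul (hK _) (hK _) (abs_nonneg _) ((abs_nonneg _).trans (hK p.1))
  have i1 := hint (fun p => a p.1 + inner ℝ (v p.1) p.2) (by fun_prop)
  have i2 := hint (fun p => b p.2 + inner ℝ (w p.2) p.1) (by fun_prop)
  rw [show (fun p : Space d × Space d =>
      (a p.1 + inner ℝ (v p.1) p.2 + (b p.2 + inner ℝ (w p.2) p.1)) * (f p.1 * f p.2))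
    = fun p => (a p.1 + inner ℝ (v p.1) p.2) * (f p.1 * f p.2)
      + (b p.2 + inner ℝ (w p.2) p.1) * (f p.1 * f p.2) by funext p; ring, integral_add i1 i2]
  have e1 : ∫ p in Q ×ˢ Q, (a p.1 + inner ℝ (v p.1) p.2) * (f p.1 * f p.2) = 0 := by
    rw [Measure.volume_eq_prod] at i1 ⊢
    rw [setIntegral_prod _ i1]
    refine (integral_congr_ae (Eventually.of_forall fun x => ?_)).trans (integral_zero _ _)
    have h := integral_mul_affine hQ hf hK h0 (a x) (v x) (h1.imp (fun h => h.1 x) id)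
    calc _ = ∫ y in Q, f x * (f y * (a x + inner ℝ (v x) y)) :=
          integral_congr_ae (Eventually.of_forall fun y => by simp only; ring)
      _ = 0 := by rw [integral_const_mul, h, mul_zero]
  have e2 : ∫ p in Q ×ˢ Q, (b p.2 + inner ℝ (w p.2) p.1) * (f p.1 * f p.2) = 0 := by
    rw [Measure.volume_eq_prod] at i2 ⊢
    rw [IntegrableOn] at i2
    rw [← Measure.prod_restrict] at i2 ⊢
    rw [integral_prod_symm _ i2]
    refine (integral_congr_ae (Eventually.of_forall fun y => ?_)).trans (integral_zero _ _)
    have h := integral_mul_affine hQ hf hK h0 (b y) (w y) (h1.imp (fun h => h.2 y) id)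
    calc _ = ∫ x in Q, f y * (f x * (b y + inner ℝ (w y) x)) :=
          integral_congr_ae (Eventually.of_forall fun x => by simp only; ring)
      _ = 0 := by rw [integral_const_mul, h, mul_zero]
  rw [e1, e2, add_zero]

/-- A polynomial of degree at most three in `x - y` has only monomials of degree at most one in `x`
or in `y`, so vanishing charge and dipole kill it. In degree one every monomial misses one variable,
and vanishing charge suffices. -/
theorem integral_gaussPoly_eq_zero (hQ : Bornology.IsBounded Q)
    (hf : Measurable f) {K : ℝ} (hK : ∀ x, |f x| ≤ K) (h0 : ∫ x in Q, f x = 0) {m : ℕ}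
    (hm : m = 2 ∨ (m = 4 ∧ ∫ x in Q, f x • x = 0)) (t : ℝ) (u : Space d) :
    ∫ p in Q ×ˢ Q, gaussPoly m t u (p.1 - p.2) * (f p.1 * f p.2) = 0 := by
  rcases hm with rfl | ⟨rfl, h1⟩
  · have h := integral_prod_affine hQ hf hK h0
      (a := fun x => 1 - 2 * t * inner ℝ u x) (b := fun y => 2 * t * inner ℝ u y)
      (v := fun _ => 0) (w := fun _ => 0) (by fun_prop) (by fun_prop) (by fun_prop) (by fun_prop)
      (Or.inl ⟨fun _ => rfl, fun _ => rfl⟩)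
    rw [← h]
    refine integral_congr_ae (Eventually.of_forall fun p => ?_)
    simp only [gaussPoly, if_true, inner_sub_right, inner_zero_left]
    ring
  -- Monomials of degree at most one in the second variable go to `a` and `v`; the others, at least
  -- quadratic in it and hence at most linear in the first, go to `b` and `w`.
  · have h := integral_prod_affine hQ hf hK h0
      (a := fun x => 1 - 2 * t * inner ℝ u x - t * ‖x‖ ^ 2 + 2 * t ^ 2 * inner ℝ u x ^ 2
        + 2 * t ^ 2 * inner ℝ u x * ‖x‖ ^ 2 - 4 / 3 * t ^ 3 * inner ℝ u x ^ 3)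
      (b := fun y => -t * ‖y‖ ^ 2 + 2 * t ^ 2 * inner ℝ u y ^ 2
        - 2 * t ^ 2 * inner ℝ u y * ‖y‖ ^ 2 + 4 / 3 * t ^ 3 * inner ℝ u y ^ 3)
      (v := fun x => (2 * t - 4 * t ^ 2 * inner ℝ u x - 2 * t ^ 2 * ‖x‖ ^ 2
        + 4 * t ^ 3 * inner ℝ u x ^ 2) • u + (2 * t - 4 * t ^ 2 * inner ℝ u x) • x)
      (w := fun y => (2 * t ^ 2 * ‖y‖ ^ 2 - 4 * t ^ 3 * inner ℝ u y ^ 2) • u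
        + (4 * t ^ 2 * inner ℝ u y) • y)
      (by fun_prop) (by fun_prop) (by fun_prop) (by fun_prop) (Or.inr h1)
    rw [← h]
    refine integral_congr_ae (Eventually.of_forall fun p => ?_)
    have hne : ¬ (4 : ℕ) = 2 := by norm_num
    simp only [gaussPoly, if_neg hne, inner_sub_right, inner_add_left, inner_smul_left,
      norm_sub_sq_real, conj_trivial, real_inner_comm p.1 p.2]
    ring

end Annihilation

/-! ### Gaussian interaction of neutral cells -/

section GaussianPairs

variable {d : ℕ}

/-- A bounded periodic charge density of zero total charge per cell. -/
structure IsNeutral (L : Submodule ℤ (Space d)) (f : Space d → ℝ) : Prop where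
  measurable : Measurable f
  bounded : ∃ K, ∀ x, |f x| ≤ K
  periodic : ∀ z ∈ L, ∀ x, f (x + z) = f x
  integral_eq_zero : ∫ x in wignerSeitz L, f x = 0

/-- The Gaussian interaction of the charge density `f` with itself. -/
def gaussPair (f : Space d → ℝ) (t : ℝ) (p : Space d × Space d) : ℝ :=
  Real.exp (-(t * ‖p.1 - p.2‖ ^ 2)) * (f p.1 * f p.2)

theorem integrable_gaussian {t : ℝ} (ht : 0 < t) :
    Integrable fun x : Space d => Real.exp (-(t * ‖x‖ ^ 2)) := by
  have h := (GaussianFourier.integrable_cexp_neg_mul_sq_norm_add (V := Space d) (b := (t : ℂ))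
    (by simpa using ht) 0 0).norm
  refine h.congr (Eventually.of_forall fun x => ?_)
  simp only [Complex.norm_exp]
  congr 1
  simp [← Complex.ofReal_pow, ← Complex.ofReal_mul, ← Complex.ofReal_neg]

theorem integral_gaussian_space {t : ℝ} (ht : 0 < t) :
    ∫ x : Space d, Real.exp (-(t * ‖x‖ ^ 2)) = (Real.pi / t) ^ ((d : ℝ) / 2) := by
  have h := GaussianFourier.integral_rexp_neg_mul_sq_norm (V := Space d) ht
  rw [finrank_euclideanSpace_fin] at h
  rw [← h]
  congr 1; funext x; rw [neg_mul]

variable {L : Submodule ℤ (Space d)} {f : Space d → ℝ}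

theorem abs_mul_le_of_bounded {K : ℝ} (hK : ∀ x, |f x| ≤ K) (x y : Space d) :
    |f x * f y| ≤ K ^ 2 := by
  rw [abs_mul, sq]
  exact mul_le_mul (hK _) (hK _) (abs_nonneg _) ((abs_nonneg _).trans (hK x))

theorem measurable_gaussPair (hf : Measurable f) :
    Measurable fun q : (Space d × Space d) × ℝ => gaussPair f q.2 q.1 := by
  unfold gaussPair; fun_prop

theorem abs_gaussPair_le {K : ℝ} (hK : ∀ x, |f x| ≤ K) (t : ℝ) (p : Space d × Space d) :
    |gaussPair f t p| ≤ K ^ 2 * Real.exp (-(t * ‖p.1 - p.2‖ ^ 2)) := by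
  rw [gaussPair, abs_mul, abs_of_pos (Real.exp_pos _), mul_comm]
  exact mul_le_mul_of_nonneg_right (abs_mul_le_of_bounded hK _ _) (Real.exp_pos _).le

theorem integrableOn_gaussPair (hf : IsNeutral L f) {A : Set (Space d)} (hA : volume A ≠ ∞)
    {t : ℝ} (ht : 0 < t) : IntegrableOn (gaussPair f t) (A ×ˢ Set.univ) := by
  obtain ⟨K, hK⟩ := hf.bounded
  have h := (integrableOn_conv (𝕜 := ℝ) hA (integrable_gaussian ht)).const_mul (K ^ 2)
  refine Integrable.mono' h ((measurable_gaussPair hf.measurable).comp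
    (measurable_id.prodMk measurable_const)).aestronglyMeasurable
    (Eventually.of_forall fun p => abs_gaussPair_le hK t p)

/-- The bound without cancellation, used for `t > 1`, where it decays like `t ^ (-d/2)`. -/
theorem abs_integral_gaussPair_le {K : ℝ} (hK : ∀ x, |f x| ≤ K) {A : Set (Space d)}
    (hA : volume A ≠ ∞) {t : ℝ} (ht : 0 < t) (B : Set (Space d)) :
    |∫ p in A ×ˢ B, gaussPair f t p|
      ≤ K ^ 2 * volume.real A * (Real.pi / t) ^ ((d : ℝ) / 2) := by
  have h := (integrableOn_conv (𝕜 := ℝ) hA (integrable_gaussian ht)).const_mul (K ^ 2)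
  have h' := h.mono_measure (Measure.restrict_mono_set volume
    (Set.prod_mono_right (Set.subset_univ B) : A ×ˢ B ⊆ A ×ˢ Set.univ))
  have e := integral_mul_conv (𝕜 := ℝ) (A := A) (fun _ => 1)
    (fun x => Real.exp (-(t * ‖x‖ ^ 2)))
  simp only [one_mul, integral_gaussian_space ht] at e
  calc |∫ p in A ×ˢ B, gaussPair f t p|
      ≤ ∫ p in A ×ˢ B, K ^ 2 * Real.exp (-(t * ‖p.1 - p.2‖ ^ 2)) :=
        norm_integral_le_of_norm_le (f := gaussPair f t) h'
          (Eventually.of_forall fun p => abs_gaussPair_le hK t p)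
    _ ≤ ∫ p in A ×ˢ Set.univ, K ^ 2 * Real.exp (-(t * ‖p.1 - p.2‖ ^ 2)) :=
        setIntegral_mono_set h (Eventually.of_forall fun p => by positivity)
          (Set.prod_mono_right (Set.subset_univ B)).eventuallyLE
    _ = _ := by
        rw [integral_const_mul, e]
        simp; ring

theorem IsNeutral.isDiagPeriodic_gaussPair (hf : IsNeutral L f) (t : ℝ) :
    IsDiagPeriodic L (gaussPair f t) := fun z hz => Eventually.of_forall fun p => by
  simp [gaussPair, hf.periodic z hz]

theorem IsNeutral.setIntegral_cell_gaussPair (hf : IsNeutral L f) {u : Space d} (hu : u ∈ L)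
    (t : ℝ) :
    ∫ p in wignerSeitz L ×ˢ cell L u, gaussPair f t p
      = ∫ p in wignerSeitz L ×ˢ wignerSeitz L,
          Real.exp (-(t * ‖-u + (p.1 - p.2)‖ ^ 2)) * (f p.1 * f p.2) := by
  have hmp : MeasurePreserving (Prod.map id (fun y : Space d => y + u))
      (volume : Measure (Space d × Space d)) volume :=
    (MeasurePreserving.id _).prod (measurePreserving_add_right volume u)
  have hemb : MeasurableEmbedding (Prod.map id (fun y : Space d => y + u) :
      Space d × Space d → Space d × Space d) :=
    MeasurableEmbedding.id.prodMap (measurableEmbedding_addRight u)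
  rw [← hmp.setIntegral_preimage_emb hemb]
  have hpre : Prod.map id (fun y : Space d => y + u) ⁻¹' (wignerSeitz L ×ˢ cell L u)
      = wignerSeitz L ×ˢ wignerSeitz L := by
    ext p; simp [cell]
  rw [hpre]
  refine integral_congr_ae (Eventually.of_forall fun p => ?_)
  simp only [gaussPair, Prod.map_fst, Prod.map_snd, id, hf.periodic u hu]
  rw [show p.1 - (p.2 + u) = -u + (p.1 - p.2) by abel]

variable [DiscreteTopology L] [IsZLattice ℝ L]

/-- The charge density has vanishing multipole moments of order less than `m / 2`. -/
def HasMultipoleOrder (L : Submodule ℤ (Space d)) (f : Space d → ℝ) (m : ℕ) : Prop :=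
  m = 2 ∨ (m = 4 ∧ ∫ x in wignerSeitz L, f x • x = 0)

/-- The interaction of two cells is unchanged when the Taylor polynomial at the displacement is
subtracted, because it integrates to zero against the charges. The Taylor remainder supplies both
the power of `t` and the decay in `u`. -/
theorem IsNeutral.exists_cell_bound (hf : IsNeutral L f) {m : ℕ} (hm : HasMultipoleOrder L f m) :
    ∃ C : ℝ, 0 ≤ C ∧ ∀ t : ℝ, 0 < t → t ≤ 1 → ∀ u ∈ L,
      |∫ p in wignerSeitz L ×ˢ cell L u, gaussPair f t p|
        ≤ C * t ^ ((m : ℝ) / 2) * Real.exp (-(t * ‖u‖ ^ 2 / 4)) := by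
  obtain ⟨K, hK⟩ := hf.bounded
  obtain ⟨C, hC, h⟩ := exists_gaussPoly_bound (d := d) m (hm.imp id And.left) (2 * cellRadius L)
  have hQb := isBounded_wignerSeitz L
  have hQm := measurableSet_wignerSeitz L
  have hvol : (volume : Measure (Space d × Space d)) (wignerSeitz L ×ˢ wignerSeitz L) < ∞ :=
    (hQb.prod hQb).measure_lt_top
  refine ⟨C * K ^ 2 * (volume : Measure (Space d × Space d)).real
    (wignerSeitz L ×ˢ wignerSeitz L), by positivity, fun t ht ht1 u hu => ?_⟩
  have hcont : ∀ g : Space d × Space d → ℝ, Continuous g →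
      IntegrableOn (fun p => g p * (f p.1 * f p.2)) (wignerSeitz L ×ˢ wignerSeitz L) := by
    intro g hg
    have hg' : IntegrableOn g (wignerSeitz L ×ˢ wignerSeitz L) :=
      (hg.continuousOn.integrableOn_compact (hQb.prod hQb).isCompact_closure).mono_set
        subset_closure
    have := hf.measurable
    exact hg'.mul_bdd (c := K ^ 2)
      (by fun_prop : Measurable fun p : Space d × Space d => f p.1 * f p.2).aestronglyMeasurable
      (Eventually.of_forall fun p => abs_mul_le_of_bounded hK _ _)
  have hpoly : Continuous fun p : Space d × Space d => gaussPoly m t (-u) (p.1 - p.2) := by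
    unfold gaussPoly; split_ifs <;> fun_prop
  have i1 := hcont (fun p => Real.exp (-(t * ‖-u + (p.1 - p.2)‖ ^ 2))) (by fun_prop)
  have i2 := (hcont _ hpoly).const_mul (Real.exp (-(t * ‖-u‖ ^ 2)))
  have hz := integral_gaussPoly_eq_zero hQb hf.measurable hK hf.integral_eq_zero hm t (-u)
  rw [hf.setIntegral_cell_gaussPair hu]
  have e : ∫ p in wignerSeitz L ×ˢ wignerSeitz L,
        Real.exp (-(t * ‖-u + (p.1 - p.2)‖ ^ 2)) * (f p.1 * f p.2)
      = ∫ p in wignerSeitz L ×ˢ wignerSeitz L,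
        (Real.exp (-(t * ‖-u + (p.1 - p.2)‖ ^ 2))
          - Real.exp (-(t * ‖-u‖ ^ 2)) * gaussPoly m t (-u) (p.1 - p.2)) * (f p.1 * f p.2) := by
    have h3 := integral_sub i1 i2
    rw [integral_const_mul, hz, mul_zero, sub_zero] at h3
    rw [← h3]
    exact integral_congr_ae (Eventually.of_forall fun p => by simp only; ring)
  rw [e, ← Real.norm_eq_abs]
  refine le_trans (b := (C * t ^ ((m : ℝ) / 2) * Real.exp (-(t * ‖u‖ ^ 2 / 4)) * K ^ 2)
    * volume.real (wignerSeitz L ×ˢ wignerSeitz L)) (norm_setIntegral_le_of_norm_le_const hvol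
      fun p hp => ?_) (le_of_eq (by ring))
  have hp1 := norm_le_cellRadius L hp.1
  have hp2 := norm_le_cellRadius L hp.2
  have h4 := h t ht ht1 (-u) (p.1 - p.2) (by linarith [norm_sub_le p.1 p.2])
  rw [norm_neg] at h4
  rw [norm_mul, norm_neg]
  exact mul_le_mul h4 (abs_mul_le_of_bounded hK _ _) (abs_nonneg _) (by positivity)

variable (L) in
-- The sum is compared with an integral cell by cell: on the cell at `u` one has `‖x‖² ≤ 2‖u‖² +
-- 2c²`, so for `t ≤ 1` the term at `u` is at most `exp (c²/4)` times `exp (-t‖x‖²/8)`.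
theorem exists_lattice_gaussian_bound :
    ∃ C : ℝ, 0 ≤ C ∧ ∀ t : ℝ, 0 < t → t ≤ 1 →
      Summable (fun u : L => Real.exp (-(t * ‖(u : Space d)‖ ^ 2 / 4))) ∧
      ∑' u : L, Real.exp (-(t * ‖(u : Space d)‖ ^ 2 / 4)) ≤ C * t ^ (-((d : ℝ) / 2)) := by
  have hQ := cellVolume_pos L
  set c := cellRadius L
  refine ⟨(cellVolume L)⁻¹ * Real.exp (c ^ 2 / 4) * (8 * Real.pi) ^ ((d : ℝ) / 2),
    by positivity, fun t ht ht1 => ?_⟩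
  have hi := integrable_gaussian (d := d) (t := t / 8) (by positivity)
  have hfd := isAddFundamentalDomain_wignerSeitz L
  have hdis : Pairwise (Function.onFun Disjoint fun u : L => cell L (u : Space d)) :=
    fun u v huv => cell_disjoint L u.2 v.2 fun h => huv (Subtype.ext h)
  have hs := hasSum_integral_iUnion (fun u : L => measurableSet_cell L (u : Space d)) hdis
    hi.integrableOn
  rw [setIntegral_congr_set (iUnion_cell_ae_eq L), setIntegral_univ,
    integral_gaussian_space (by positivity)] at hs
  have hs' := hs.mul_left ((cellVolume L)⁻¹ * Real.exp (c ^ 2 / 4))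
  have hle : ∀ u : L, Real.exp (-(t * ‖(u : Space d)‖ ^ 2 / 4)) ≤
      (cellVolume L)⁻¹ * Real.exp (c ^ 2 / 4) *
        ∫ x in cell L (u : Space d), Real.exp (-(t / 8 * ‖x‖ ^ 2)) := by
    intro u
    have hvol : volume.real (cell L (u : Space d)) = cellVolume L := by
      rw [Measure.real, volume_cell]; rfl
    have h1 : ∫ _ in cell L (u : Space d), Real.exp (-(t * ‖(u : Space d)‖ ^ 2 / 4))
        ≤ ∫ x in cell L (u : Space d), Real.exp (c ^ 2 / 4) * Real.exp (-(t / 8 * ‖x‖ ^ 2)) := by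
      refine setIntegral_mono_on ?_ (hi.const_mul _).integrableOn (measurableSet_cell L _)
        fun x hx => ?_
      · exact integrableOn_const (isBounded_cell L _).measure_lt_top.ne
      · rw [← Real.exp_add, Real.exp_le_exp]
        have h2 := norm_le_cellRadius L hx
        have h3 : ‖x‖ ≤ ‖(u : Space d)‖ + c := by
          calc ‖x‖ = ‖(u : Space d) + (x - u)‖ := by simp
            _ ≤ ‖(u : Space d)‖ + ‖x - u‖ := norm_add_le _ _
            _ ≤ _ := by linarith
        have h4 : ‖x‖ ^ 2 ≤ 2 * ‖(u : Space d)‖ ^ 2 + 2 * c ^ 2 := by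
          have := pow_le_pow_left₀ (norm_nonneg x) h3 2
          nlinarith [sq_nonneg (‖(u : Space d)‖ - c)]
        have h5 : t * ‖x‖ ^ 2 ≤ t * (2 * ‖(u : Space d)‖ ^ 2 + 2 * c ^ 2) := by gcongr
        nlinarith [mul_le_mul_of_nonneg_right ht1 (sq_nonneg c)]
    rw [setIntegral_const, smul_eq_mul, hvol, integral_const_mul] at h1
    rw [mul_assoc, inv_mul_eq_div, le_div_iff₀ hQ, mul_comm]
    exact h1
  have hsum := Summable.of_nonneg_of_le (fun u => (Real.exp_pos _).le) hle hs'.summable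
  refine ⟨hsum, (hsum.tsum_le_tsum hle hs'.summable).trans_eq ?_⟩
  rw [hs'.tsum_eq, mul_assoc _ _ (t ^ _), show Real.pi / (t / 8) = (8 * Real.pi) * t⁻¹ by
    field_simp, Real.mul_rpow (by positivity) (by positivity), Real.inv_rpow ht.le,
    ← Real.rpow_neg ht.le]

theorem IsNeutral.exists_gaussPair_bounds (hf : IsNeutral L f) {m : ℕ}
    (hm : HasMultipoleOrder L f m) :
    ∃ C : ℝ, 0 ≤ C ∧ ∀ t : ℝ, 0 < t → t ≤ 1 →
      (∀ R : ℝ, |∫ p in cellUnion L R ×ˢ cellUnion L R, gaussPair f t p|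
        / volume.real (cellUnion L R) ≤ C * t ^ (((m : ℝ) - d) / 2)) ∧
      |∫ p in wignerSeitz L ×ˢ Set.univ, gaussPair f t p| ≤ C * t ^ (((m : ℝ) - d) / 2) := by
  have hQ := cellVolume_pos L
  obtain ⟨C₁, hC₁, h₁⟩ := hf.exists_cell_bound hm
  obtain ⟨C₂, hC₂, h₂⟩ := exists_lattice_gaussian_bound L
  refine ⟨max (1 / cellVolume L) 1 * (C₁ * C₂), by positivity, fun t ht ht1 => ?_⟩
  obtain ⟨hs, hle⟩ := h₂ t ht ht1
  have hs' := hs.mul_left (C₁ * t ^ ((m : ℝ) / 2))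
  have hb : ∀ u : L, |∫ p in wignerSeitz L ×ˢ cell L u, gaussPair f t p|
      ≤ C₁ * t ^ ((m : ℝ) / 2) * Real.exp (-(t * ‖(u : Space d)‖ ^ 2 / 4)) :=
    fun u => h₁ t ht ht1 u u.2
  have hsum := Summable.of_nonneg_of_le (fun u => abs_nonneg _) hb hs'
  have htot : ∑' u : L, |∫ p in wignerSeitz L ×ˢ cell L u, gaussPair f t p|
      ≤ C₁ * C₂ * t ^ (((m : ℝ) - d) / 2) := by
    refine (hsum.tsum_le_tsum hb hs').trans ?_
    rw [tsum_mul_left]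
    calc _ ≤ C₁ * t ^ ((m : ℝ) / 2) * (C₂ * t ^ (-((d : ℝ) / 2))) := by gcongr
      _ = C₁ * C₂ * (t ^ ((m : ℝ) / 2) * t ^ (-((d : ℝ) / 2))) := by ring
      _ = _ := by rw [← Real.rpow_add ht]; congr 2; ring
  have hp : 0 ≤ C₁ * C₂ * t ^ (((m : ℝ) - d) / 2) := by positivity
  have hint := integrableOn_gaussPair hf (volume_wignerSeitz_ne_top L) ht
  constructor
  · intro R
    refine (abs_setIntegral_cellUnion_prod_le L (hf.isDiagPeriodic_gaussPair t)
      (fun u _ => hint.mono_set (Set.prod_mono_right (Set.subset_univ _))) hsum R).trans ?_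
    rw [mul_assoc]
    refine mul_le_mul (le_max_left _ _) htot (tsum_nonneg fun _ => abs_nonneg _) (by positivity)
  · have hh := hasSum_integral_cells L hint
    rw [← hh.tsum_eq]
    have h3 := norm_tsum_le_tsum_norm (f := fun u : L =>
      ∫ p in wignerSeitz L ×ˢ cell L u, gaussPair f t p) hsum
    refine (h3.trans htot).trans ?_
    rw [mul_assoc (max _ _)]
    exact le_mul_of_one_le_left hp (le_max_right _ _)

end GaussianPairs

/-! ### Thermodynamic limit of the self-energy of a neutral charge density -/

section ChargeEnergy

variable {d : ℕ} {L : Submodule ℤ (Space d)} {f : Space d → ℝ}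

theorem integrableOn_mellin_bound {σ p q C₁ C₂ : ℝ} (hp : -p < σ) (hq : σ < q) :
    IntegrableOn (fun t : ℝ => t ^ (σ - 1) * if t ≤ 1 then C₁ * t ^ p else C₂ * t ^ (-q))
      (Set.Ioi 0) := by
  rw [← Set.Ioc_union_Ioi_eq_Ioi zero_le_one]
  refine IntegrableOn.union ?_ ?_
  · have hi : IntegrableOn (fun y : ℝ => y ^ (σ - 1 + p)) (Set.Ioc 0 1) := by
      rw [← intervalIntegrable_iff_integrableOn_Ioc_of_le zero_le_one]
      exact intervalIntegral.intervalIntegrable_rpow' (by linarith)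
    refine (Integrable.const_mul hi C₁).congr ?_
    filter_upwards [ae_restrict_mem measurableSet_Ioc] with t ht
    rw [if_pos ht.2, Real.rpow_add ht.1]; ring
  · have hi : IntegrableOn (fun y : ℝ => y ^ (σ - 1 + -q)) (Set.Ioi 1) :=
      integrableOn_Ioi_rpow_of_lt (by linarith) one_pos
    refine (Integrable.const_mul hi C₂).congr ?_
    filter_upwards [ae_restrict_mem measurableSet_Ioi] with t ht
    rw [if_neg (not_le.2 ht), Real.rpow_add (one_pos.trans ht)]; ring

/-- The Gaussian self-interaction per cell. -/
def gaussEnergy (L : Submodule ℤ (Space d)) (f : Space d → ℝ) (t : ℝ) : ℝ :=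
  ∫ p in wignerSeitz L ×ˢ Set.univ, gaussPair f t p

/-- The regularized Riesz self-interaction per cell of a neutral periodic charge density. -/
def chargeEnergy (L : Submodule ℤ (Space d)) (f : Space d → ℝ) (s : ℝ) : ℝ :=
  mixConst s * ∫ t in Set.Ioi (0 : ℝ), t ^ (s / 2 - 1) * gaussEnergy L f t

theorem measurable_integral_gaussPair (hf : Measurable f) (A : Set (Space d × Space d)) :
    StronglyMeasurable fun t : ℝ => ∫ p in A, gaussPair f t p :=
  (measurable_gaussPair hf).stronglyMeasurable.integral_prod_left'
    (μ := volume.restrict A)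

variable [DiscreteTopology L] [IsZLattice ℝ L]

/-- The domain is a union of whole cells, so neutrality is exact and no boundary charge appears.
Constants may therefore be subtracted from the potential for free. -/
theorem IsNeutral.setIntegral_cellUnion (hf : IsNeutral L f) (R : ℝ) :
    ∫ x in cellUnion L R, f x = 0 := by
  obtain ⟨K, hK⟩ := hf.bounded
  have hS : ∀ w ∈ latticeBall L R, w ∈ L := fun w hw => ((mem_latticeBall L).1 hw).1
  rw [setIntegral_congr_set (cellUnion_ae_eq L R), integral_biUnion_finset]
  · refine Finset.sum_eq_zero fun z hz => ?_
    rw [← hf.integral_eq_zero,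
      ← (measurePreserving_add_right (volume : Measure (Space d)) z).setIntegral_preimage_emb
        (measurableEmbedding_addRight z)]
    have hpre : (fun x => x + z) ⁻¹' cell L z = wignerSeitz L := by ext x; simp [cell]
    rw [hpre]
    exact integral_congr_ae (Eventually.of_forall fun x => hf.periodic z (hS z hz) x)
  · exact fun z _ => measurableSet_cell L z
  · exact fun z hz w hw h => cell_disjoint L (hS z hz) (hS w hw) h
  · intro z _
    refine IntegrableOn.of_bound (isBounded_cell L z).measure_lt_top
      hf.measurable.aestronglyMeasurable K (Eventually.of_forall hK)

/-- For fixed points, the `t`-integral of the absolute value is a multiple of `|V_s(x-y) - sign s|`,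
by constancy of sign; this is locally integrable for `s < d`. -/
theorem integrable_mix_pair (hd : 1 ≤ d) (hf : Measurable f) {K : ℝ} (hK : ∀ x, |f x| ≤ K)
    {Ω : Set (Space d)} (hΩ : Bornology.IsBounded Ω) {s : ℝ} (hs : -2 < s) (hsd : s < d) :
    Integrable (fun q : (Space d × Space d) × ℝ =>
      q.2 ^ (s / 2 - 1) * (Real.exp (-(q.2 * ‖q.1.1 - q.1.2‖ ^ 2)) - Real.exp (-q.2))
        * (f q.1.1 * f q.1.2))
      ((volume.restrict (Ω ×ˢ Ω)).prod (volume.restrict (Set.Ioi 0))) := by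
  have hκ := mixConst_pos hs
  have hne : ∀ᵐ p : Space d × Space d, p.1 - p.2 ≠ 0 := ae_prod_of_ae_sub (ae_ne_zero hd)
  rw [integrable_prod_iff (Measurable.aestronglyMeasurable (by fun_prop))]
  constructor
  · filter_upwards [ae_restrict_of_ae hne] with p hp
    have ha : 0 < ‖p.1 - p.2‖ ^ 2 := by have := norm_pos_iff.2 hp; positivity
    exact (integrableOn_mix ha hs).mul_const _
  · have hV : IntegrableOn (fun p : Space d × Space d => riesz s (p.1 - p.2)) (Ω ×ˢ Ω) :=
      integrableOn_conv_of_locallyIntegrable (𝕜 := ℝ) hΩ (integrableOn_ball_riesz hd hsd)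
    have hc : IntegrableOn (fun _ : Space d × Space d => Real.sign s) (Ω ×ˢ Ω) :=
      integrableOn_const (hΩ.prod hΩ).measure_lt_top.ne
    have hg : Integrable (fun p : Space d × Space d =>
        (mixConst s)⁻¹ * |riesz s (p.1 - p.2) - Real.sign s| * |f p.1 * f p.2|)
        (volume.restrict (Ω ×ˢ Ω)) := by
      refine Integrable.mul_bdd (c := K ^ 2) ((hV.sub hc).abs.const_mul _)
        (by fun_prop : Measurable fun p : Space d × Space d =>
          |f p.1 * f p.2|).aestronglyMeasurable (Eventually.of_forall fun p => ?_)
      rw [Real.norm_eq_abs, abs_abs]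
      exact abs_mul_le_of_bounded hK _ _
    refine hg.congr ?_
    filter_upwards [ae_restrict_of_ae hne] with p hp
    simp only [norm_mul _ (f p.1 * f p.2)]
    rw [integral_mul_const, integral_norm_mix, Real.norm_eq_abs]
    have h := congrArg abs (riesz_eq_mix hs hp)
    rw [abs_mul, abs_of_pos hκ] at h
    rw [h, inv_mul_cancel_left₀ hκ.ne']

/-- Both counterterms of the mixture, `Real.sign s` and `exp (-t)`, are constant in the points and
integrate to zero against `f⊗f`. Only the Gaussian remains. -/
theorem IsNeutral.setIntegral_riesz_eq (hd : 1 ≤ d) (hf : IsNeutral L f) {s : ℝ} (hs : -2 < s)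
    (hsd : s < d) (R : ℝ) :
    ∫ p in cellUnion L R ×ˢ cellUnion L R, riesz s (p.1 - p.2) * (f p.1 * f p.2)
      = mixConst s * ∫ t in Set.Ioi (0 : ℝ), t ^ (s / 2 - 1) *
          ∫ p in cellUnion L R ×ˢ cellUnion L R, gaussPair f t p := by
  obtain ⟨K, hK⟩ := hf.bounded
  have hfm := hf.measurable
  have hb := isBounded_cellUnion L R
  set Ω := cellUnion L R
  have hne : ∀ᵐ p : Space d × Space d, p.1 - p.2 ≠ 0 := ae_prod_of_ae_sub (ae_ne_zero hd)
  have hff : ∫ p in Ω ×ˢ Ω, f p.1 * f p.2 = 0 := by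
    rw [Measure.volume_eq_prod, ← Measure.prod_restrict, integral_prod_mul,
      hf.setIntegral_cellUnion, zero_mul]
  have hbdd : ∀ᵐ p ∂((volume : Measure (Space d × Space d)).restrict (Ω ×ˢ Ω)),
      ‖f p.1 * f p.2‖ ≤ K ^ 2 := Eventually.of_forall fun p => abs_mul_le_of_bounded hK _ _
  have hffm : Measurable fun p : Space d × Space d => f p.1 * f p.2 := by fun_prop
  have iff1 : IntegrableOn (fun p : Space d × Space d => f p.1 * f p.2) (Ω ×ˢ Ω) :=
    IntegrableOn.of_bound (hb.prod hb).measure_lt_top hffm.aestronglyMeasurable _ hbdd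
  have hV : IntegrableOn (fun p : Space d × Space d => riesz s (p.1 - p.2)) (Ω ×ˢ Ω) :=
    integrableOn_conv_of_locallyIntegrable (𝕜 := ℝ) hb (integrableOn_ball_riesz hd hsd)
  have hVf : IntegrableOn (fun p : Space d × Space d => riesz s (p.1 - p.2) * (f p.1 * f p.2))
      (Ω ×ˢ Ω) := Integrable.mul_bdd hV hffm.aestronglyMeasurable hbdd
  have e1 : ∫ p in Ω ×ˢ Ω, riesz s (p.1 - p.2) * (f p.1 * f p.2)
      = ∫ p in Ω ×ˢ Ω, (riesz s (p.1 - p.2) - Real.sign s) * (f p.1 * f p.2) := by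
    have h := integral_sub hVf (iff1.const_mul (Real.sign s))
    rw [integral_const_mul, hff, mul_zero, sub_zero] at h
    rw [← h]
    exact integral_congr_ae (Eventually.of_forall fun p => by simp only; ring)
  have e2 : ∫ p in Ω ×ˢ Ω, (riesz s (p.1 - p.2) - Real.sign s) * (f p.1 * f p.2)
      = mixConst s * ∫ p in Ω ×ˢ Ω, ∫ t in Set.Ioi (0 : ℝ),
        t ^ (s / 2 - 1) * (Real.exp (-(t * ‖p.1 - p.2‖ ^ 2)) - Real.exp (-t))
        * (f p.1 * f p.2) := by
    rw [← integral_const_mul]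
    refine integral_congr_ae ?_
    filter_upwards [ae_restrict_of_ae hne] with p hp
    rw [riesz_eq_mix hs hp, integral_mul_const]; ring
  rw [e1, e2, integral_integral_swap (integrable_mix_pair hd hfm hK hb hs hsd)]
  congr 1
  refine setIntegral_congr_fun measurableSet_Ioi fun t ht => ?_
  have i1 : IntegrableOn (gaussPair f t) (Ω ×ˢ Ω) :=
    (integrableOn_gaussPair hf hb.measure_lt_top.ne ht).mono_set
      (Set.prod_mono_right (Set.subset_univ _))
  have h := integral_sub i1 (iff1.const_mul (Real.exp (-t)))
  rw [integral_const_mul, hff, mul_zero, sub_zero] at h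
  rw [← h, ← integral_const_mul]
  refine integral_congr_ae (Eventually.of_forall fun p => ?_)
  simp only [gaussPair]; ring

/-- One dominating function serves the finite volumes and the limit: the multipole bound for `t ≤
1`, the crude bound for `t > 1`. Multiplied by `t ^ (s/2 - 1)` it is integrable when `d - m < s <
d`. -/
theorem IsNeutral.exists_gaussEnergy_bounds (hf : IsNeutral L f) {m : ℕ}
    (hm : HasMultipoleOrder L f m) :
    ∃ C₁ C₂ : ℝ, ∀ t : ℝ, 0 < t →
      (∀ R : ℝ, |(∫ p in cellUnion L R ×ˢ cellUnion L R, gaussPair f t p)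
        / volume.real (cellUnion L R)|
          ≤ if t ≤ 1 then C₁ * t ^ (((m : ℝ) - d) / 2) else C₂ * t ^ (-((d : ℝ) / 2))) ∧
      |gaussEnergy L f t|
          ≤ if t ≤ 1 then C₁ * t ^ (((m : ℝ) - d) / 2) else C₂ * t ^ (-((d : ℝ) / 2)) := by
  obtain ⟨K, hK⟩ := hf.bounded
  obtain ⟨C, hC, h⟩ := hf.exists_gaussPair_bounds hm
  have hQ := cellVolume_pos L
  refine ⟨C, K ^ 2 * max 1 (cellVolume L) * Real.pi ^ ((d : ℝ) / 2), fun t ht => ?_⟩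
  have hpi : (Real.pi / t) ^ ((d : ℝ) / 2) = Real.pi ^ ((d : ℝ) / 2) * t ^ (-((d : ℝ) / 2)) := by
    rw [Real.div_rpow Real.pi_pos.le ht.le, Real.rpow_neg ht.le]; rfl
  have hA : ∀ R, |∫ p in cellUnion L R ×ˢ cellUnion L R, gaussPair f t p|
      / volume.real (cellUnion L R) ≤ K ^ 2 * (Real.pi / t) ^ ((d : ℝ) / 2) := fun R => by
    have h1 := abs_integral_gaussPair_le hK (isBounded_cellUnion L R).measure_lt_top.ne ht
      (cellUnion L R)
    refine div_le_of_le_mul₀ measureReal_nonneg (by positivity) (h1.trans_eq (by ring))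
  have hB := abs_integral_gaussPair_le hK (volume_wignerSeitz_ne_top L) ht Set.univ
  by_cases ht1 : t ≤ 1
  · simp only [if_pos ht1]
    refine ⟨fun R => ?_, (h t ht ht1).2⟩
    rw [abs_div, abs_of_nonneg (measureReal_nonneg : 0 ≤ volume.real (cellUnion L R))]
    exact (h t ht ht1).1 R
  · simp only [if_neg ht1]
    rw [hpi] at hA hB
    refine ⟨fun R => ?_, ?_⟩
    · rw [abs_div, abs_of_nonneg (measureReal_nonneg : 0 ≤ volume.real (cellUnion L R))]
      refine (hA R).trans ?_
      rw [← mul_assoc]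
      gcongr
      exact le_mul_of_one_le_right (by positivity) (le_max_left _ _)
    · refine hB.trans ?_
      rw [← mul_assoc]
      gcongr
      exact le_max_right _ _

theorem IsNeutral.integrableOn_mellin_gaussEnergy (hf : IsNeutral L f) {m : ℕ}
    (hm : HasMultipoleOrder L f m) {s : ℝ} (hsm : (d : ℝ) - m < s) (hsd : s < d) :
    IntegrableOn (fun t : ℝ => t ^ (s / 2 - 1) * gaussEnergy L f t) (Set.Ioi 0) := by
  obtain ⟨C₁, C₂, h⟩ := hf.exists_gaussEnergy_bounds hm
  refine Integrable.mono' (integrableOn_mellin_bound (σ := s / 2) (p := ((m : ℝ) - d) / 2)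
    (q := (d : ℝ) / 2) (C₁ := C₁) (C₂ := C₂) (by linarith) (by linarith)) ?_ ?_
  · exact (Measurable.aestronglyMeasurable (by fun_prop)).mul
      (measurable_integral_gaussPair hf.measurable _).aestronglyMeasurable
  · filter_upwards [ae_restrict_mem measurableSet_Ioi] with t ht
    have ht : 0 < t := ht
    rw [norm_mul, Real.norm_of_nonneg (by positivity)]
    exact mul_le_mul_of_nonneg_left (h t ht).2 (by positivity)

/-- Thermodynamic limit of the Riesz energy of a neutral periodic charge density. -/
theorem IsNeutral.tendsto_riesz (hd : 1 ≤ d) (hf : IsNeutral L f) {m : ℕ}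
    (hm : HasMultipoleOrder L f m) {s : ℝ} (hs : -2 < s) (hsm : (d : ℝ) - m < s) (hsd : s < d) :
    Tendsto (fun R => (∫ p in cellUnion L R ×ˢ cellUnion L R,
        riesz s (p.1 - p.2) * (f p.1 * f p.2)) / volume.real (cellUnion L R))
      atTop (𝓝 (1 / cellVolume L * chargeEnergy L f s)) := by
  obtain ⟨C₁, C₂, h⟩ := hf.exists_gaussEnergy_bounds hm
  have e : ∀ R, (∫ p in cellUnion L R ×ˢ cellUnion L R,
        riesz s (p.1 - p.2) * (f p.1 * f p.2)) / volume.real (cellUnion L R)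
      = mixConst s * ∫ t in Set.Ioi (0 : ℝ), t ^ (s / 2 - 1) *
        ((∫ p in cellUnion L R ×ˢ cellUnion L R, gaussPair f t p)
          / volume.real (cellUnion L R)) := fun R => by
    rw [hf.setIntegral_riesz_eq hd hs hsd]
    simp only [← mul_div_assoc]
    rw [integral_div, mul_div_assoc]
  simp_rw [e]
  have hlim : Tendsto (fun R => ∫ t in Set.Ioi (0 : ℝ), t ^ (s / 2 - 1) *
        ((∫ p in cellUnion L R ×ˢ cellUnion L R, gaussPair f t p)
          / volume.real (cellUnion L R))) atTop
      (𝓝 (∫ t in Set.Ioi (0 : ℝ), t ^ (s / 2 - 1) * (1 / cellVolume L * gaussEnergy L f t))) := by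
    -- For each `t` the integrand converges by averaging over cells; the bound uniform in `R`
    -- dominates.
    refine tendsto_integral_filter_of_dominated_convergence _ ?_ ?_
      (integrableOn_mellin_bound (σ := s / 2) (p := ((m : ℝ) - d) / 2)
        (q := (d : ℝ) / 2) (C₁ := C₁) (C₂ := C₂) (by linarith) (by linarith)) ?_
    · refine Eventually.of_forall fun R => ?_
      exact (Measurable.aestronglyMeasurable (by fun_prop)).mul
        ((measurable_integral_gaussPair hf.measurable _).measurable.div_const _).aestronglyMeasurable
    · refine Eventually.of_forall fun R => ?_
      filter_upwards [ae_restrict_mem measurableSet_Ioi] with t ht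
      have ht : 0 < t := ht
      rw [norm_mul, Real.norm_of_nonneg (by positivity)]
      exact mul_le_mul_of_nonneg_left ((h t ht).1 R) (by positivity)
    · filter_upwards [ae_restrict_mem measurableSet_Ioi] with t ht
      exact (tendsto_setIntegral_cellUnion_prod L (hf.isDiagPeriodic_gaussPair t)
        (integrableOn_gaussPair hf (volume_wignerSeitz_ne_top L) ht)).const_mul _
  have hlim' := hlim.const_mul (mixConst s)
  convert hlim' using 2
  rw [chargeEnergy, ← mul_assoc, mul_comm (1 / cellVolume L), mul_assoc, ← integral_const_mul]
  congr 2
  funext t; ring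

end ChargeEnergy

/-! ### Uniqueness of Fourier coefficients on the cell -/

section FourierUniqueness

variable {d : ℕ} (L : Submodule ℤ (Space d)) [DiscreteTopology L] [IsZLattice ℝ L]

/-- An `ℝ`-basis of the space that generates the lattice `L`. -/
def latticeBasis : Module.Basis (Module.Free.ChooseBasisIndex ℤ L) ℝ (Space d) :=
  (Module.Free.chooseBasis ℤ L).ofZLatticeBasis ℝ L

theorem innerₗ_nondegenerate : (innerₗ (Space d)).Nondegenerate :=
  ⟨fun x h => inner_self_eq_zero.1 (h x), fun x h => inner_self_eq_zero.1 (h x)⟩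

open scoped Classical in
/-- The basis dual to `latticeBasis L`, scaled by `2π`. -/
def reciprocalBasis : Module.Basis (Module.Free.ChooseBasisIndex ℤ L) ℝ (Space d) :=
  (LinearMap.BilinForm.dualBasis (innerₗ (Space d)) innerₗ_nondegenerate (latticeBasis L)).map
    (LinearEquiv.smulOfNeZero ℝ (Space d) (2 * Real.pi) (by positivity))

theorem inner_reciprocalBasis (i : Module.Free.ChooseBasisIndex ℤ L) (x : Space d) :
    inner ℝ (reciprocalBasis L i) x = 2 * Real.pi * (latticeBasis L).repr x i := by
  classical
  have h : innerₗ (Space d) (reciprocalBasis L i)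
      = (2 * Real.pi) • (latticeBasis L).coord i := by
    refine (latticeBasis L).ext fun j => ?_
    have := LinearMap.BilinForm.apply_dualBasis_left (B := innerₗ (Space d))
      innerₗ_nondegenerate (latticeBasis L) i j
    simp only [reciprocalBasis, Module.Basis.map_apply, LinearEquiv.smulOfNeZero_apply, map_smul,
      LinearMap.smul_apply, this, Module.Basis.coord_apply, Module.Basis.repr_self,
      Finsupp.single_apply]
  exact LinearMap.congr_fun h x

/-- The lattice generated by `reciprocalBasis L`. -/
def reciprocal : Submodule ℤ (Space d) := Submodule.span ℤ (Set.range (reciprocalBasis L))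

instance : DiscreteTopology (reciprocal L) :=
  inferInstanceAs (DiscreteTopology (Submodule.span ℤ (Set.range (reciprocalBasis L))))

instance : IsZLattice ℝ (reciprocal L) :=
  inferInstanceAs (IsZLattice ℝ (Submodule.span ℤ (Set.range (reciprocalBasis L))))

theorem span_latticeBasis : Submodule.span ℤ (Set.range (latticeBasis L)) = L :=
  (Module.Free.chooseBasis ℤ L).ofZLatticeBasis_span ℝ

theorem mem_lattice_iff {x : Space d} :
    x ∈ L ↔ ∀ i, ∃ n : ℤ, (n : ℝ) = (latticeBasis L).repr x i := by
  conv_lhs => rw [← span_latticeBasis L]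
  rw [Module.Basis.mem_span_iff_repr_mem]
  simp

/-- This inclusion is enough: the frequencies of `reciprocal L` already give all characters of the
torus in lattice coordinates, and the coefficients are prescribed on the whole dual lattice. -/
theorem reciprocal_subset_dualLattice {k : Space d} (hk : k ∈ reciprocal L) :
    k ∈ dualLattice L := by
  intro z hz
  induction hk using Submodule.span_induction with
  | mem x h =>
    obtain ⟨i, rfl⟩ := h
    obtain ⟨n, hn⟩ := (mem_lattice_iff L).1 hz i
    exact ⟨n, by rw [inner_reciprocalBasis, hn]⟩
  | zero => exact ⟨0, by simp⟩
  | add x y _ _ hx hy =>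
    obtain ⟨m, hm⟩ := hx
    obtain ⟨n, hn⟩ := hy
    exact ⟨m + n, by rw [inner_add_left, hm, hn]; push_cast; ring⟩
  | smul a x _ hx =>
    obtain ⟨m, hm⟩ := hx
    refine ⟨a * m, ?_⟩
    rw [← Int.cast_smul_eq_zsmul ℝ, real_inner_smul_left, hm]; push_cast; ring

/-- The plane wave `e^{-ik·x}`. -/
def wave (k x : Space d) : ℂ := Complex.exp (-(Complex.I * (inner ℝ k x : ℝ)))

theorem norm_wave (k x : Space d) : ‖wave k x‖ = 1 := by
  rw [wave, show -(Complex.I * ((inner ℝ k x : ℝ) : ℂ)) = ((-(inner ℝ k x : ℝ) : ℝ) : ℂ) * Complex.I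
    by push_cast; ring, Complex.norm_exp_ofReal_mul_I]

@[fun_prop]
theorem continuous_wave (k : Space d) : Continuous (wave k) := by
  unfold wave; fun_prop

theorem wave_zero (x : Space d) : wave 0 x = 1 := by simp [wave]

theorem wave_add_right (k x y : Space d) : wave k (x + y) = wave k x * wave k y := by
  rw [wave, wave, wave, ← Complex.exp_add, inner_add_right]
  congr 1; push_cast; ring

theorem wave_add_left (k l x : Space d) : wave (k + l) x = wave k x * wave l x := by
  rw [wave, wave, wave, ← Complex.exp_add, inner_add_left]
  congr 1; push_cast; ring

variable {L} in
theorem wave_lattice {k z : Space d} (hk : k ∈ dualLattice L) (hz : z ∈ L) : wave k z = 1 := by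
  obtain ⟨n, hn⟩ := hk z hz
  rw [wave, hn, Complex.exp_eq_one_iff]
  exact ⟨-n, by push_cast; ring⟩

variable {L} in
theorem wave_periodic {k z : Space d} (hk : k ∈ dualLattice L) (hz : z ∈ L) (x : Space d) :
    wave k (x + z) = wave k x := by
  rw [wave_add_right, wave_lattice hk hz, mul_one]

/-- The projection to the torus given by the coordinates with respect to `latticeBasis L`. -/
def torusMap (x : Space d) : UnitAddTorus (Module.Free.ChooseBasisIndex ℤ L) :=
  fun i => ((latticeBasis L).repr x i : UnitAddCircle)

theorem continuous_torusMap : Continuous (torusMap L) := by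
  refine continuous_pi fun i => (AddCircle.continuous_mk' 1).comp ?_
  exact ((latticeBasis L).coord i).continuous_of_finiteDimensional

theorem mFourier_torusMap (n : Module.Free.ChooseBasisIndex ℤ L → ℤ) (x : Space d) :
    UnitAddTorus.mFourier n (torusMap L x) = wave (∑ i, (-n i) • reciprocalBasis L i) x := by
  simp only [UnitAddTorus.mFourier, ContinuousMap.coe_mk, torusMap, fourier_coe_apply]
  rw [← Complex.exp_sum, wave, sum_inner]
  congr 1
  push_cast
  rw [Finset.mul_sum, ← Finset.sum_neg_distrib]
  refine Finset.sum_congr rfl fun i _ => ?_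
  rw [← Int.cast_smul_eq_zsmul ℝ, real_inner_smul_left, inner_reciprocalBasis]
  push_cast; ring

/-- Two points of the open cell differing by a nonzero lattice vector would each be strictly closer
to the origin than the other. -/
theorem injOn_torusMap : Set.InjOn (torusMap L) (wignerSeitz L) := by
  intro x hx y hy h
  have hz : x - y ∈ L := by
    rw [mem_lattice_iff]
    intro i
    have hi : (((latticeBasis L).repr (x - y) i : ℝ) : UnitAddCircle) = 0 := by
      rw [map_sub, Finsupp.sub_apply, AddCircle.coe_sub]
      exact sub_eq_zero.2 (congrFun h i)
    obtain ⟨n, hn⟩ := (AddCircle.coe_eq_zero_iff 1).1 hi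
    exact ⟨n, by simpa using hn⟩
  by_contra hne
  have h0 : x - y ≠ 0 := sub_ne_zero.2 hne
  have h1 := hx _ hz h0
  have h2 := hy _ (L.neg_mem hz) (neg_ne_zero.2 h0)
  simp only [sub_sub_cancel] at h1
  rw [sub_neg_eq_add, add_sub_cancel] at h2
  exact lt_asymm h1 h2

variable {L}

/-- The functional `φ ↦ ∫_Q D · φ ∘ π` on continuous functions on the torus. -/
def torusFunctional {D : Space d → ℝ} (hD : IntegrableOn D (wignerSeitz L)) :
    C(UnitAddTorus (Module.Free.ChooseBasisIndex ℤ L), ℂ) →L[ℂ] ℂ :=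
  LinearMap.mkContinuous
    { toFun := fun φ => ∫ x in wignerSeitz L, (D x : ℂ) * φ (torusMap L x)
      map_add' := fun φ ψ => by
        simp only [ContinuousMap.add_apply, mul_add]
        have hi : ∀ φ : C(UnitAddTorus (Module.Free.ChooseBasisIndex ℤ L), ℂ),
          IntegrableOn (fun x => (D x : ℂ) * φ (torusMap L x)) (wignerSeitz L) := fun φ =>
          Integrable.mul_bdd (c := ‖φ‖) hD.ofReal
            (φ.continuous.comp (continuous_torusMap L)).aestronglyMeasurable
            (Eventually.of_forall fun x => φ.norm_coe_le_norm _)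
        exact integral_add (hi φ) (hi ψ)
      map_smul' := fun c φ => by
        simp only [ContinuousMap.smul_apply, smul_eq_mul, RingHom.id_apply]
        rw [← integral_const_mul]
        exact integral_congr_ae (Eventually.of_forall fun x => by simp only; ring) }
    (∫ x in wignerSeitz L, |D x|) fun φ => by
      simp only [LinearMap.coe_mk, AddHom.coe_mk]
      refine (norm_integral_le_of_norm_le (hD.abs.mul_const ‖φ‖)
        (Eventually.of_forall fun x => ?_)).trans_eq (integral_mul_const _ _)
      rw [norm_mul, Complex.norm_real, Real.norm_eq_abs]
      exact mul_le_mul_of_nonneg_left (φ.norm_coe_le_norm _) (abs_nonneg _)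

/-- The functional vanishes on the characters, whose span is dense in the continuous functions on
the torus. -/
theorem torusFunctional_eq_zero {D : Space d → ℝ} (hD : IntegrableOn D (wignerSeitz L))
    (h : ∀ k ∈ reciprocal L, ∫ x in wignerSeitz L, (D x : ℂ) * wave k x = 0) :
    torusFunctional hD = 0 := by
  have hle : (Submodule.span ℂ (Set.range UnitAddTorus.mFourier)).topologicalClosure
      ≤ (torusFunctional hD).ker := by
    refine Submodule.topologicalClosure_minimal _ ?_ (torusFunctional hD).isClosed_ker
    rw [Submodule.span_le]
    rintro _ ⟨n, rfl⟩
    change ∫ x in wignerSeitz L, (D x : ℂ) * UnitAddTorus.mFourier n (torusMap L x) = 0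
    simp only [mFourier_torusMap]
    refine h _ (Submodule.sum_mem _ fun i _ => Submodule.smul_mem _ _
      (Submodule.subset_span ⟨i, rfl⟩))
  rw [UnitAddTorus.span_mFourier_closure_eq_top] at hle
  ext φ
  exact LinearMap.mem_ker.1 (hle (Submodule.mem_top (x := φ)))

/-- An integrable function on the Wigner-Seitz cell whose Fourier coefficients vanish is zero. -/
theorem ae_eq_zero_of_fourier_eq_zero {D : Space d → ℝ} (hD : IntegrableOn D (wignerSeitz L))
    (h : ∀ k ∈ reciprocal L, ∫ x in wignerSeitz L, (D x : ℂ) * wave k x = 0) :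
    D =ᵐ[volume.restrict (wignerSeitz L)] 0 := by
  have hT := torusFunctional_eq_zero hD h
  have hΦ := (continuous_torusMap L).measurable
  have hcont : ∀ φ : BoundedContinuousFunction
      (UnitAddTorus (Module.Free.ChooseBasisIndex ℤ L)) ℝ,
      ∫ x in wignerSeitz L, D x * φ (torusMap L x) = 0 := fun φ => by
    have := DFunLike.congr_fun hT
      (⟨fun y => (φ y : ℂ), by fun_prop⟩ : C(UnitAddTorus (Module.Free.ChooseBasisIndex ℤ L), ℂ))
    have h2 : ∫ x in wignerSeitz L, (D x : ℂ) * ((φ (torusMap L x) : ℝ) : ℂ) = 0 := this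
    simp only [← Complex.ofReal_mul] at h2
    rw [integral_complex_ofReal] at h2
    exact_mod_cast h2
  set ν := (volume : Measure (Space d)).restrict (wignerSeitz L)
  have hDm : AEMeasurable D ν := hD.aemeasurable
  have hDn : AEMeasurable (fun x => -D x) ν := hDm.neg
  let μp := ν.withDensity fun x => ENNReal.ofReal (D x)
  let μn := ν.withDensity fun x => ENNReal.ofReal (-D x)
  have : IsFiniteMeasure μp := isFiniteMeasure_withDensity_ofReal hD.2
  have : IsFiniteMeasure μn := isFiniteMeasure_withDensity_ofReal hD.neg.2
  have hint : ∀ φ : BoundedContinuousFunction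
      (UnitAddTorus (Module.Free.ChooseBasisIndex ℤ L)) ℝ, ∀ g : Space d → ℝ, Integrable g ν →
      Integrable (fun x => g x * φ (torusMap L x)) ν := fun φ g hg =>
    Integrable.mul_bdd (c := ‖φ‖) hg
      (φ.continuous.comp (continuous_torusMap L)).aestronglyMeasurable
      (Eventually.of_forall fun x => φ.norm_coe_le_norm _)
  -- The positive and negative parts of `D` push forward to finite measures on the torus having the
  -- same integrals of continuous functions, hence equal.
  have hmap : μp.map (torusMap L) = μn.map (torusMap L) := by
    refine ext_of_forall_integral_eq_of_IsFiniteMeasure fun φ => ?_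
    rw [integral_map hΦ.aemeasurable φ.continuous.aestronglyMeasurable,
      integral_map hΦ.aemeasurable φ.continuous.aestronglyMeasurable,
      integral_withDensity_eq_integral_toReal_smul₀ hDm.ennreal_ofReal
        (Eventually.of_forall fun _ => ENNReal.ofReal_lt_top),
      integral_withDensity_eq_integral_toReal_smul₀ hDn.ennreal_ofReal
        (Eventually.of_forall fun _ => ENNReal.ofReal_lt_top), ← sub_eq_zero, ← integral_sub]
    · rw [← hcont φ]
      refine integral_congr_ae (Eventually.of_forall fun x => ?_)
      simp only [ENNReal.toReal_ofReal', smul_eq_mul]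
      rw [← sub_mul]
      congr 1
      rcases le_total 0 (D x) with h0 | h0
      · rw [max_eq_left h0, max_eq_right (neg_nonpos.2 h0), sub_zero]
      · rw [max_eq_right h0, max_eq_left (neg_nonneg.2 h0)]; ring
    · refine (hint φ _ hD.pos_part).congr (Eventually.of_forall fun x => ?_)
      simp [ENNReal.toReal_ofReal']
    · refine (hint φ _ hD.neg.pos_part).congr (Eventually.of_forall fun x => ?_)
      simp [ENNReal.toReal_ofReal']
  refine ae_eq_zero_of_forall_setIntegral_eq_of_sigmaFinite (fun s _ _ => hD.integrableOn)
    fun s hs _ => ?_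
  have hsQ := hs.inter (measurableSet_wignerSeitz L)
  -- An injective measurable image of a Borel set is Borel, so every Borel part of the cell is
  -- tested by a measurable set of the torus.
  have hB : MeasurableSet (torusMap L '' (s ∩ wignerSeitz L)) :=
    hsQ.image_of_measurable_injOn hΦ
    ((injOn_torusMap L).mono Set.inter_subset_right)
  have hpre : torusMap L ⁻¹' (torusMap L '' (s ∩ wignerSeitz L)) =ᵐ[ν] s := by
    filter_upwards [ae_restrict_mem (measurableSet_wignerSeitz L)] with x hx
    refine propext ⟨?_, fun hxs => ⟨x, ⟨hxs, hx⟩, rfl⟩⟩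
    rintro ⟨y, hy, hyx⟩
    have : y = x := injOn_torusMap L hy.2 hx hyx
    exact this ▸ hy.1
  have hm := congrArg (fun μ => μ (torusMap L '' (s ∩ wignerSeitz L))) hmap
  simp only [Measure.map_apply hΦ hB] at hm
  rw [withDensity_apply _ (hΦ hB), withDensity_apply _ (hΦ hB),
    Measure.restrict_congr_set hpre] at hm
  rw [integral_eq_lintegral_pos_part_sub_lintegral_neg_part hD.integrableOn, hm, sub_self]

end FourierUniqueness

/-! ### Periodized Gaussians and Poisson summation -/

section Theta

variable {d : ℕ} (L : Submodule ℤ (Space d)) [DiscreteTopology L] [IsZLattice ℝ L]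
  {G : Type*} [NormedAddCommGroup G] [NormedSpace ℝ G]

theorem setIntegral_cell (F : Space d → G) (z : Space d) :
    ∫ x in cell L z, F x = ∫ x in wignerSeitz L, F (x + z) := by
  rw [← (measurePreserving_add_right (volume : Measure (Space d)) z).setIntegral_preimage_emb
        (measurableEmbedding_addRight z)]
  have hpre : (fun x => x + z) ⁻¹' cell L z = wignerSeitz L := by ext x; simp [cell]
  rw [hpre]

theorem hasSum_integral_shift {F : Space d → G} (hF : Integrable F) :
    HasSum (fun z : L => ∫ x in wignerSeitz L, F (x + z)) (∫ x, F x) := by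
  rw [← setIntegral_univ, ← setIntegral_congr_set (iUnion_cell_ae_eq L)]
  simp_rw [← setIntegral_cell L F]
  refine hasSum_integral_iUnion (fun u => measurableSet_cell L u) (fun u v huv => ?_)
    hF.integrableOn
  exact cell_disjoint L u.2 v.2 fun h => huv (Subtype.ext h)

theorem integral_tsum_shift {F : Space d → G} (hF : Integrable F) :
    ∫ x in wignerSeitz L, ∑' z : L, F (x + z) = ∫ x, F x := by
  rw [← integral_tsum_of_summable_integral_norm
    (fun z : L => (hF.comp_add_right (z : Space d)).integrableOn)
    (hasSum_integral_shift L hF.norm).summable]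
  exact (hasSum_integral_shift L hF).tsum_eq

/-- The periodized Gaussian. -/
def theta (t : ℝ) (x : Space d) : ℝ := ∑' z : L, Real.exp (-(t * ‖x + z‖ ^ 2))

theorem theta_nonneg (t : ℝ) (x : Space d) : 0 ≤ theta L t x :=
  tsum_nonneg fun _ => (Real.exp_pos _).le

variable {L} in
theorem theta_periodic (t : ℝ) {z : Space d} (hz : z ∈ L) (x : Space d) :
    theta L t (x + z) = theta L t x := by
  rw [theta, theta, ← (Equiv.addLeft (⟨z, hz⟩ : L)).tsum_eq (fun w : L =>
    Real.exp (-(t * ‖x + w‖ ^ 2)))]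
  exact tsum_congr fun w => by simp [add_assoc]

/-- Through series in `ℝ≥0∞`, which are measurable without any convergence. The identity with the
real series also covers `t ≤ 0`, where both sides are read as `0` upon divergence. -/
theorem measurable_theta : Measurable fun q : ℝ × Space d => theta L q.1 q.2 := by
  have h : (fun q : ℝ × Space d => theta L q.1 q.2) = fun q : ℝ × Space d =>
      (∑' z : L, ENNReal.ofReal (Real.exp (-(q.1 * ‖q.2 + z‖ ^ 2)))).toReal := by
    funext q
    rw [ENNReal.tsum_toReal_eq fun _ => ENNReal.ofReal_ne_top]
    exact tsum_congr fun z => (ENNReal.toReal_ofReal (Real.exp_pos _).le).symm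
  rw [h]
  exact (Measurable.tsum fun z => by fun_prop).ennreal_toReal

theorem integral_theta {t : ℝ} (ht : 0 < t) : IntegrableOn (theta L t) (wignerSeitz L) ∧
    ∫ x in wignerSeitz L, theta L t x = (Real.pi / t) ^ ((d : ℝ) / 2) := by
  have h := integral_tsum_shift L (integrable_gaussian (d := d) ht)
  rw [integral_gaussian_space ht] at h
  -- A nonzero Bochner integral certifies integrability.
  refine ⟨not_imp_comm.1 integral_undef (ne_of_eq_of_ne h (by positivity)), h⟩

theorem integral_gaussian_wave {t : ℝ} (ht : 0 < t) (k : Space d) :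
    ∫ x : Space d, ((Real.exp (-(t * ‖x‖ ^ 2)) : ℝ) : ℂ) * wave k x
      = (((Real.pi / t) ^ ((d : ℝ) / 2) * Real.exp (-(‖k‖ ^ 2 / (4 * t))) : ℝ) : ℂ) := by
  have h := GaussianFourier.integral_cexp_neg_mul_sq_norm_add (V := Space d) (b := (t : ℂ))
    (by simpa using ht) (-Complex.I) k
  rw [finrank_euclideanSpace_fin] at h
  have e : ∀ x : Space d, ((Real.exp (-(t * ‖x‖ ^ 2)) : ℝ) : ℂ) * wave k x
      = Complex.exp (-(t : ℂ) * (‖x‖ : ℂ) ^ 2 + -Complex.I * ((inner ℝ k x : ℝ) : ℂ)) := fun x => by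
    rw [wave, Complex.ofReal_exp, ← Complex.exp_add]
    congr 1; push_cast; ring
  simp_rw [e]
  rw [h, Complex.ofReal_mul, Complex.ofReal_cpow (by positivity), Complex.ofReal_exp]
  congr 2
  · push_cast; rfl
  · push_cast; rfl
  · rw [neg_sq, Complex.I_sq]; push_cast; ring

variable {L} in
theorem integral_theta_wave {t : ℝ} (ht : 0 < t) {k : Space d} (hk : k ∈ dualLattice L) :
    ∫ x in wignerSeitz L, (theta L t x : ℂ) * wave k x
      = (((Real.pi / t) ^ ((d : ℝ) / 2) * Real.exp (-(‖k‖ ^ 2 / (4 * t))) : ℝ) : ℂ) := by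
  have hF : Integrable fun x : Space d => ((Real.exp (-(t * ‖x‖ ^ 2)) : ℝ) : ℂ) * wave k x :=
    (integrable_gaussian ht).ofReal.mul_bdd (c := 1)
      (continuous_wave k).aestronglyMeasurable
      (Eventually.of_forall fun x => (norm_wave k x).le)
  rw [← integral_gaussian_wave ht k, ← integral_tsum_shift L hF]
  refine integral_congr_ae (Eventually.of_forall fun x => ?_)
  simp only [theta]
  rw [Complex.ofReal_tsum, ← tsum_mul_right]
  exact tsum_congr fun z => by rw [wave_periodic hk z.2]

theorem isAddFundamentalDomain_cell (v : Space d) :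
    IsAddFundamentalDomain L (cell L v) (volume : Measure (Space d)) := by
  rw [← cell_eq_image]
  exact (isAddFundamentalDomain_wignerSeitz L).image_of_equiv (Equiv.addLeft v)
    (measurePreserving_add_left volume (-v)).quasiMeasurePreserving
    (Equiv.refl _) fun z x => by
      simp only [Submodule.vadd_def, vadd_eq_add, Equiv.coe_addLeft, Equiv.refl_apply]
      abel

variable {L} in
theorem setIntegral_wignerSeitz_add {g : Space d → G} (hg : ∀ z ∈ L, ∀ x, g (x + z) = g x)
    (v : Space d) : ∫ x in wignerSeitz L, g (x + v) = ∫ x in wignerSeitz L, g x := by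
  rw [← setIntegral_cell]
  have hfd' := isAddFundamentalDomain_cell L v
  refine hfd'.setIntegral_eq (isAddFundamentalDomain_wignerSeitz L) fun z x => ?_
  rw [Submodule.vadd_def, vadd_eq_add, add_comm]
  exact hg _ z.2 _

variable {L} in
theorem integral_wave {k : Space d} (hk : k ∈ dualLattice L) :
    ∫ x in wignerSeitz L, wave k x = if k = 0 then (cellVolume L : ℂ) else 0 := by
  split_ifs with h
  · subst h
    simp [wave_zero, cellVolume, Measure.real]
  -- Shifting by this vector multiplies the wave by `-1`, while the integral of a periodic function
  -- over the cell does not change.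
  · set v : Space d := (Real.pi / ‖k‖ ^ 2) • k
    have hv : wave k v = -1 := by
      have hk2 : ‖k‖ ^ 2 ≠ 0 := by simpa using h
      rw [wave, real_inner_smul_right, real_inner_self_eq_norm_sq, div_mul_cancel₀ _ hk2,
        mul_comm, Complex.exp_neg, Complex.exp_pi_mul_I]
      norm_num
    have h1 := setIntegral_wignerSeitz_add (L := L) (g := wave k)
      (fun z hz x => wave_periodic hk hz x) v
    simp only [wave_add_right, hv, mul_neg, mul_one, integral_neg] at h1
    exact self_eq_neg.1 h1.symm

/-- The Fourier series of the periodized Gaussian. -/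
def thetaCoeff (t : ℝ) (k : Space d) : ℝ :=
  (Real.pi / t) ^ ((d : ℝ) / 2) * Real.exp (-(‖k‖ ^ 2 / (4 * t))) / cellVolume L

theorem thetaCoeff_nonneg {t : ℝ} (ht : 0 < t) (k : Space d) : 0 ≤ thetaCoeff L t k := by
  have := cellVolume_pos L
  unfold thetaCoeff; positivity

/-- From `exp (-y) ≤ n! / y ^ n` with `n = d + 1`. Then the power `2(d + 1)` of `‖k‖⁻¹` is summable
over a lattice of rank `d`, and `t ^ (d + 1)` overcompensates the prefactor `t ^ (-d/2)`. -/
theorem thetaCoeff_le {t : ℝ} (ht : 0 < t) {k : Space d} (hk : k ≠ 0) :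
    thetaCoeff L t k ≤ (Real.pi / t) ^ ((d : ℝ) / 2) / cellVolume L * (d + 1).factorial
      * (4 * t) ^ (d + 1) * (‖k‖⁻¹) ^ (2 * (d + 1)) := by
  have hQ := cellVolume_pos L
  have hk0 : 0 < ‖k‖ := norm_pos_iff.2 hk
  have hy : 0 < ‖k‖ ^ 2 / (4 * t) := by positivity
  have h := Real.pow_div_factorial_le_exp _ hy.le (d + 1)
  have h2 : Real.exp (-(‖k‖ ^ 2 / (4 * t)))
      ≤ (d + 1).factorial * (4 * t) ^ (d + 1) * (‖k‖⁻¹) ^ (2 * (d + 1)) := by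
    rw [Real.exp_neg]
    refine (inv_anti₀ (by positivity) h).trans_eq ?_
    rw [inv_div, div_pow, inv_pow, pow_mul]
    field_simp
  rw [thetaCoeff, mul_div_right_comm]
  refine (mul_le_mul_of_nonneg_left h2 (by positivity)).trans_eq (by ring)

theorem summable_reciprocal : Summable fun k : reciprocal L => (‖k‖⁻¹) ^ (2 * (d + 1)) := by
  refine ZLattice.summable_norm_pow_inv (reciprocal L) _ ?_
  rw [ZLattice.rank ℝ, finrank_euclideanSpace_fin]; omega

theorem summable_thetaCoeff {t : ℝ} (ht : 0 < t) :
    Summable fun k : reciprocal L => thetaCoeff L t k := by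
  refine Summable.of_norm_bounded_eventually ((summable_reciprocal L).mul_left
    ((Real.pi / t) ^ ((d : ℝ) / 2) / cellVolume L * (d + 1).factorial * (4 * t) ^ (d + 1))) ?_
  refine (Set.finite_singleton (0 : reciprocal L)).subset fun k hk => ?_
  by_contra h0
  refine hk ?_
  change ‖thetaCoeff L t k‖ ≤ _
  rw [Real.norm_of_nonneg (thetaCoeff_nonneg L ht k)]
  exact thetaCoeff_le L ht fun h => h0 (Subtype.ext h)

/-- The Fourier series of the periodized Gaussian. -/
def thetaSeries (t : ℝ) (x : Space d) : ℂ :=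
  ∑' k : reciprocal L, (thetaCoeff L t k : ℂ) * wave k x

theorem summable_thetaSeries {t : ℝ} (ht : 0 < t) (x : Space d) :
    Summable fun k : reciprocal L => (thetaCoeff L t k : ℂ) * wave k x := by
  refine Summable.of_norm_bounded (summable_thetaCoeff L ht) fun k => ?_
  rw [norm_mul, norm_wave, mul_one, Complex.norm_real,
    Real.norm_of_nonneg (thetaCoeff_nonneg L ht k)]

theorem conj_wave (k x : Space d) : (starRingEnd ℂ) (wave k x) = wave (-k) x := by
  rw [wave, wave, ← Complex.exp_conj]
  simp

theorem ofReal_re_thetaSeries (t : ℝ) (x : Space d) :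
    ((thetaSeries L t x).re : ℂ) = thetaSeries L t x := by
  rw [← Complex.conj_eq_iff_re, thetaSeries, Complex.conj_tsum,
    ← (Equiv.neg (reciprocal L)).tsum_eq]
  refine tsum_congr fun k => ?_
  rw [map_mul, Complex.conj_ofReal, conj_wave]
  simp [thetaCoeff]

theorem integral_thetaSeries_wave {t : ℝ} (ht : 0 < t) {l : Space d} (hl : l ∈ reciprocal L) :
    ∫ x in wignerSeitz L, thetaSeries L t x * wave l x
      = (((Real.pi / t) ^ ((d : ℝ) / 2) * Real.exp (-(‖l‖ ^ 2 / (4 * t))) : ℝ) : ℂ) := by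
  have hQ := cellVolume_pos L
  have hfin : IsFiniteMeasure ((volume : Measure (Space d)).restrict (wignerSeitz L)) :=
    ⟨by rw [Measure.restrict_apply_univ]; exact (volume_wignerSeitz_ne_top L).lt_top⟩
  have hw : ∀ k : reciprocal L, ∀ x, ‖wave k x * wave l x‖ = 1 := fun k x => by
    rw [norm_mul, norm_wave, norm_wave, mul_one]
  have hi : ∀ k : reciprocal L, Integrable
      (fun x => (thetaCoeff L t k : ℂ) * (wave k x * wave l x))
      (volume.restrict (wignerSeitz L)) := fun k =>
    (Integrable.of_bound (Continuous.aestronglyMeasurable (by fun_prop)) 1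
      (Eventually.of_forall fun x => (hw k x).le)).const_mul _
  have hs : Summable fun k : reciprocal L =>
        ∫ x in wignerSeitz L, ‖(thetaCoeff L t k : ℂ) * (wave k x * wave l x)‖ := by
    have e : ∀ k : reciprocal L, ∀ x, ‖(thetaCoeff L t k : ℂ) * (wave k x * wave l x)‖
        = thetaCoeff L t k := fun k x => by
      rw [norm_mul, hw, mul_one, Complex.norm_real,
        Real.norm_of_nonneg (thetaCoeff_nonneg L ht k)]
    simp only [e, integral_const, smul_eq_mul]
    exact (summable_thetaCoeff L ht).mul_left _
  have e : ∀ x, thetaSeries L t x * wave l x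
      = ∑' k : reciprocal L, (thetaCoeff L t k : ℂ) * (wave k x * wave l x) := fun x => by
    rw [thetaSeries, ← tsum_mul_right]
    exact tsum_congr fun k => mul_assoc _ _ _
  simp_rw [e]
  rw [← integral_tsum_of_summable_integral_norm hi hs]
  simp_rw [integral_const_mul, ← wave_add_left]
  rw [tsum_eq_single (-⟨l, hl⟩ : reciprocal L)]
  · simp only [NegMemClass.coe_neg, neg_add_cancel]
    rw [integral_wave (reciprocal_subset_dualLattice L (Submodule.zero_mem _)), if_pos rfl,
      ← Complex.ofReal_mul, thetaCoeff, norm_neg, div_mul_cancel₀ _ hQ.ne']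
  · intro k hk
    rw [integral_wave (reciprocal_subset_dualLattice L (Submodule.add_mem _ k.2 hl)), if_neg,
      mul_zero]
    exact fun h => hk (Subtype.ext (eq_neg_of_add_eq_zero_left h))

theorem integrableOn_thetaSeries {t : ℝ} (ht : 0 < t) :
    IntegrableOn (thetaSeries L t) (wignerSeitz L) := by
  have h := integral_thetaSeries_wave L ht (Submodule.zero_mem _)
  simp only [wave_zero, mul_one] at h
  refine not_imp_comm.1 integral_undef (ne_of_eq_of_ne h ?_)
  rw [Complex.ofReal_ne_zero]; positivity

/-- Poisson summation, read off from the equality of all Fourier coefficients. It is needed only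
almost everywhere, so no pointwise regularity of the periodized Gaussian is used. -/
theorem theta_ae_eq {t : ℝ} (ht : 0 < t) :
    ∀ᵐ x ∂(volume.restrict (wignerSeitz L)), theta L t x = (thetaSeries L t x).re := by
  have hS := integrableOn_thetaSeries L ht
  have hθ := (integral_theta L ht).1
  have h := ae_eq_zero_of_fourier_eq_zero (L := L) (hθ.sub hS.re) fun k hk => by
    have e : ∀ x, ((theta L t - fun x => RCLike.re (thetaSeries L t x)) x : ℂ) * wave k x
        = (theta L t x : ℂ) * wave k x - thetaSeries L t x * wave k x := fun x => by
      rw [Pi.sub_apply, Complex.ofReal_sub, sub_mul]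
      congr 2
      exact ofReal_re_thetaSeries L t x
    simp_rw [e]
    rw [integral_sub, integral_theta_wave ht (reciprocal_subset_dualLattice L hk),
      integral_thetaSeries_wave L ht hk, sub_self]
    · exact hθ.ofReal.mul_bdd (c := 1) (continuous_wave k).aestronglyMeasurable
        (Eventually.of_forall fun x => (norm_wave k x).le)
    · exact hS.mul_bdd (c := 1) (continuous_wave k).aestronglyMeasurable
        (Eventually.of_forall fun x => (norm_wave k x).le)
  filter_upwards [h] with x hx
  exact sub_eq_zero.1 hx

/-- The mean of the periodized Gaussian. -/
def thetaMean (t : ℝ) : ℝ := (Real.pi / t) ^ ((d : ℝ) / 2) / cellVolume L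

/-- Removing the zero frequency leaves coefficients decaying faster than any power as `t → 0`. The
order `t` is all that is required: `t ^ (s/2 - 1) * t` is integrable at `0` when `s > -2`. -/
theorem exists_theta_sub_mean_le : ∃ C : ℝ, 0 ≤ C ∧ ∀ t : ℝ, 0 < t → t ≤ 1 →
    ∀ᵐ x ∂(volume.restrict (wignerSeitz L)), |theta L t x - thetaMean L t| ≤ C * t := by
  have hQ := cellVolume_pos L
  set σ := ∑' k : reciprocal L, (‖k‖⁻¹) ^ (2 * (d + 1))
  have hσ : 0 ≤ σ := tsum_nonneg fun _ => by positivity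
  refine ⟨Real.pi ^ ((d : ℝ) / 2) / cellVolume L * (d + 1).factorial * 4 ^ (d + 1) * σ,
    by positivity, fun t ht ht1 => ?_⟩
  filter_upwards [theta_ae_eq L ht] with x hx
  have hsum := summable_thetaSeries L ht x
  classical
  have h0 : thetaSeries L t x = (thetaMean L t : ℂ) + ∑' k : reciprocal L,
      if k = 0 then 0 else (thetaCoeff L t k : ℂ) * wave k x := by
    rw [thetaSeries, hsum.tsum_eq_add_tsum_ite 0]
    congr 1
    simp [wave_zero, thetaCoeff, thetaMean]
  set A := (Real.pi / t) ^ ((d : ℝ) / 2) / cellVolume L * (d + 1).factorial * (4 * t) ^ (d + 1)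
  have hA : 0 ≤ A := by positivity
  have hb : ‖∑' k : reciprocal L, if k = 0 then 0 else (thetaCoeff L t k : ℂ) * wave k x‖
      ≤ A * σ := by
    refine tsum_of_norm_bounded ((summable_reciprocal L).hasSum.mul_left A) fun k => ?_
    split_ifs with hk
    · rw [norm_zero]; positivity
    · rw [norm_mul, norm_wave, mul_one, Complex.norm_real,
        Real.norm_of_nonneg (thetaCoeff_nonneg L ht k)]
      exact thetaCoeff_le L ht fun h => hk (Subtype.ext h)
  have hre : theta L t x - thetaMean L t = (∑' k : reciprocal L,
      if k = 0 then 0 else (thetaCoeff L t k : ℂ) * wave k x).re := by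
    rw [hx, h0, Complex.add_re, Complex.ofReal_re]; ring
  rw [hre]
  refine (Complex.abs_re_le_norm _).trans (hb.trans ?_)
  have hpow : (Real.pi / t) ^ ((d : ℝ) / 2) * t ^ (d + 1) ≤ Real.pi ^ ((d : ℝ) / 2) * t := by
    rw [Real.div_rpow Real.pi_pos.le ht.le, div_mul_eq_mul_div, mul_div_assoc]
    refine mul_le_mul_of_nonneg_left ?_ (by positivity)
    rw [← Real.rpow_natCast, ← Real.rpow_sub ht]
    calc t ^ (((d + 1 : ℕ) : ℝ) - (d : ℝ) / 2) ≤ t ^ (1 : ℝ) :=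
          Real.rpow_le_rpow_of_exponent_ge ht ht1 (by push_cast; linarith [(d.cast_nonneg : (0 : ℝ) ≤ d)])
      _ = t := Real.rpow_one t
  calc A * σ = ((Real.pi / t) ^ ((d : ℝ) / 2) * t ^ (d + 1))
        * ((cellVolume L)⁻¹ * (d + 1).factorial * 4 ^ (d + 1) * σ) := by
        simp only [A]; rw [mul_pow]; ring
    _ ≤ (Real.pi ^ ((d : ℝ) / 2) * t)
        * ((cellVolume L)⁻¹ * (d + 1).factorial * 4 ^ (d + 1) * σ) :=
        mul_le_mul_of_nonneg_right hpow (by positivity)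
    _ = _ := by ring

theorem exists_integral_theta_sub_mean_le : ∃ C₁ C₂ : ℝ, ∀ t : ℝ, 0 < t →
    ∫ x in wignerSeitz L, |theta L t x - thetaMean L t|
      ≤ if t ≤ 1 then C₁ * t ^ (1 : ℝ) else C₂ * t ^ (-((d : ℝ) / 2)) := by
  have hQ := cellVolume_pos L
  obtain ⟨C, hC, h⟩ := exists_theta_sub_mean_le L
  have hfin : IsFiniteMeasure ((volume : Measure (Space d)).restrict (wignerSeitz L)) :=
    ⟨by rw [Measure.restrict_apply_univ]; exact (volume_wignerSeitz_ne_top L).lt_top⟩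
  refine ⟨C * cellVolume L, 2 * Real.pi ^ ((d : ℝ) / 2), fun t ht => ?_⟩
  have hi := ((integral_theta L ht).1.sub (integrable_const (thetaMean L t))).abs
  split_ifs with ht1
  · refine (integral_mono_ae hi (integrable_const (C * t)) (h t ht ht1)).trans_eq ?_
    rw [integral_const, smul_eq_mul, measureReal_restrict_apply_univ, Real.rpow_one, cellVolume]
    ring
  · have hμ : 0 ≤ thetaMean L t := by unfold thetaMean; positivity
    have hi2 := (integral_theta L ht).1.add (integrable_const (μ := volume.restrict (wignerSeitz L)) (thetaMean L t))
    refine (integral_mono hi hi2 fun x => ?_).trans_eq ?_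
    · simp only [Pi.add_apply, Pi.sub_apply]
      refine (abs_sub _ _).trans_eq ?_
      rw [abs_of_nonneg (theta_nonneg L t x), abs_of_nonneg hμ]
    · simp only [Pi.add_apply]
      rw [integral_add (integral_theta L ht).1 (integrable_const _), (integral_theta L ht).2,
        integral_const, smul_eq_mul, measureReal_restrict_apply_univ, thetaMean, ← cellVolume,
        mul_div_cancel₀ _ hQ.ne', Real.div_rpow Real.pi_pos.le ht.le, Real.rpow_neg ht.le]
      ring

end Theta

/-! ### Construction and uniqueness of the periodic Riesz potential -/

section PeriodicRiesz

variable {d : ℕ} (L : Submodule ℤ (Space d)) [DiscreteTopology L] [IsZLattice ℝ L]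

theorem isFiniteMeasure_restrict_wignerSeitz :
    IsFiniteMeasure ((volume : Measure (Space d)).restrict (wignerSeitz L)) :=
  ⟨by rw [Measure.restrict_apply_univ]; exact (volume_wignerSeitz_ne_top L).lt_top⟩

theorem integrableOn_theta_sub_mean {t : ℝ} (ht : 0 < t) :
    IntegrableOn (fun x => theta L t x - thetaMean L t) (wignerSeitz L) := by
  have := isFiniteMeasure_restrict_wignerSeitz L
  exact (integral_theta L ht).1.sub (integrable_const _)

theorem integral_theta_sub_mean {t : ℝ} (ht : 0 < t) :
    ∫ x in wignerSeitz L, (theta L t x - thetaMean L t) = 0 := by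
  have := isFiniteMeasure_restrict_wignerSeitz L
  rw [integral_sub (integral_theta L ht).1 (integrable_const _), (integral_theta L ht).2,
    integral_const, smul_eq_mul, measureReal_restrict_apply_univ, thetaMean, ← cellVolume,
    mul_div_cancel₀ _ (cellVolume_pos L).ne', sub_self]

theorem measurable_thetaMean : Measurable (thetaMean L) := by
  unfold thetaMean; fun_prop

theorem measurable_theta_mix (s : ℝ) : Measurable fun q : Space d × ℝ =>
    q.2 ^ (s / 2 - 1) * (theta L q.2 q.1 - thetaMean L q.2) :=
  (by fun_prop : Measurable fun q : Space d × ℝ => q.2 ^ (s / 2 - 1)).mul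
    (((measurable_theta L).comp measurable_swap).sub
      ((measurable_thetaMean L).comp measurable_snd))

theorem integrableOn_mellin_of_le {F : ℝ → ℝ} (hF : Measurable F) {s p q C₁ C₂ : ℝ}
    (hp : -p < s / 2) (hq : s / 2 < q)
    (h : ∀ t, 0 < t → |F t| ≤ if t ≤ 1 then C₁ * t ^ p else C₂ * t ^ (-q)) :
    IntegrableOn (fun t : ℝ => t ^ (s / 2 - 1) * F t) (Set.Ioi 0) := by
  refine Integrable.mono' (integrableOn_mellin_bound (C₁ := C₁) (C₂ := C₂) hp hq)
    (Measurable.aestronglyMeasurable (by fun_prop)) ?_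
  filter_upwards [ae_restrict_mem measurableSet_Ioi] with t ht
  have ht : 0 < t := ht
  rw [norm_mul, Real.norm_of_nonneg (by positivity)]
  exact mul_le_mul_of_nonneg_left (h t ht) (by positivity)

variable {s : ℝ}

/-- In `L¹` of the cell, the periodized Gaussian minus its mean is `O(t)` at `0` and `O(t ^ (-d/2))`
at infinity, so the mixture converges absolutely exactly in the range `-2 < s < d` of these bounds.
-/
theorem integrable_theta_mix (hs : -2 < s) (hsd : s < d) :
    Integrable (fun q : Space d × ℝ =>
      q.2 ^ (s / 2 - 1) * (theta L q.2 q.1 - thetaMean L q.2))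
      ((volume.restrict (wignerSeitz L)).prod (volume.restrict (Set.Ioi 0))) := by
  have := isFiniteMeasure_restrict_wignerSeitz L
  obtain ⟨C₁, C₂, h⟩ := exists_integral_theta_sub_mean_le L
  rw [integrable_prod_iff' (measurable_theta_mix L s).aestronglyMeasurable]
  constructor
  · filter_upwards [ae_restrict_mem measurableSet_Ioi] with t ht
    exact (integrableOn_theta_sub_mean L ht).const_mul _
  · have hm : Measurable fun t : ℝ =>
        ∫ x in wignerSeitz L, |theta L t x - thetaMean L t| := by
      refine (StronglyMeasurable.integral_prod_right' (ν := volume.restrict (wignerSeitz L))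
        (f := fun q : ℝ × Space d => |theta L q.1 q.2 - thetaMean L q.1|)
        (Measurable.stronglyMeasurable ?_)).measurable
      have h1 := measurable_theta L
      have h2 := measurable_thetaMean L
      fun_prop
    refine (integrableOn_mellin_of_le (s := s) hm (p := 1) (q := (d : ℝ) / 2) (by linarith)
      (by linarith) (C₁ := C₁) (C₂ := C₂) fun t ht => ?_).congr ?_
    · rw [abs_of_nonneg (integral_nonneg fun _ => abs_nonneg _)]
      exact h t ht
    · filter_upwards [ae_restrict_mem measurableSet_Ioi] with t ht
      have ht : 0 < t := ht
      rw [← integral_const_mul]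
      refine integral_congr_ae (Eventually.of_forall fun x => ?_)
      simp only [norm_mul, Real.norm_eq_abs]
      rw [abs_of_nonneg (by positivity : 0 ≤ t ^ (s / 2 - 1))]

/-- The periodic Riesz potential, as a mixture of periodized Gaussians. -/
def periodicRiesz (s : ℝ) (x : Space d) : ℝ :=
  mixConst s * ∫ t in Set.Ioi (0 : ℝ), t ^ (s / 2 - 1) * (theta L t x - thetaMean L t)

theorem measurable_periodicRiesz (s : ℝ) : Measurable (periodicRiesz L s) :=
  ((measurable_theta_mix L s).stronglyMeasurable.integral_prod_right'
    (ν := volume.restrict (Set.Ioi 0))).measurable.const_mul _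

theorem integral_rpow_mul_exp_neg_div {a c : ℝ} (ha : 0 < a) (hc : 0 < c) :
    ∫ t in Set.Ioi (0 : ℝ), t ^ (-a - 1) * Real.exp (-(c / t)) = c ^ (-a) * Real.Gamma a := by
  have h := integral_comp_rpow_Ioi (fun u : ℝ => u ^ (a - 1) * Real.exp (-(c * u)))
    (p := -1) (by norm_num)
  rw [Real.integral_rpow_mul_exp_neg_mul_Ioi ha hc, one_div, Real.inv_rpow hc.le,
    ← Real.rpow_neg hc.le] at h
  rw [← h]
  refine setIntegral_congr_fun measurableSet_Ioi fun t ht => ?_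
  have ht : 0 < t := ht
  simp only [abs_neg, abs_one, one_mul, smul_eq_mul, Real.rpow_neg_one]
  rw [← mul_assoc, Real.inv_rpow ht.le, ← Real.rpow_neg ht.le, ← Real.rpow_add ht, div_eq_mul_inv]
  congr 2; ring

/-- The origin of `c_s`: the Gaussian of parameter `t` contributes `(π/t)^{d/2} e^{-k²/4t}` at
frequency `k`, and integrating over the mixture yields `Γ((d-s)/2)`. -/
theorem mixConst_mul_eq_fourierConst (hs : -2 < s) (hsd : s < d) {k : ℝ} (hk : 0 < k) :
    mixConst s * (Real.pi ^ ((d : ℝ) / 2) *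
      ((k ^ 2 / 4) ^ (-(((d : ℝ) - s) / 2)) * Real.Gamma (((d : ℝ) - s) / 2)))
      = fourierConst d s * k ^ (s - d) := by
  have e : (k ^ 2 / 4) ^ (-(((d : ℝ) - s) / 2)) = 2 ^ ((d : ℝ) - s) * k ^ (s - d) := by
    rw [show k ^ 2 / 4 = (k / 2) ^ (2 : ℝ) by rw [Real.rpow_two]; ring,
      ← Real.rpow_mul (by positivity), show 2 * -(((d : ℝ) - s) / 2) = s - d by ring,
      Real.div_rpow hk.le zero_le_two, show (d : ℝ) - s = -(s - d) by ring,
      Real.rpow_neg zero_le_two]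
    field_simp
  rw [e]
  by_cases h : s = 0
  · subst h
    rw [mixConst, fourierConst, if_pos rfl, if_pos rfl, sub_zero, Real.rpow_sub_one two_ne_zero]
    ring
  · rw [mixConst_of_ne h, fourierConst, if_neg h]
    ring

theorem integrableOn_periodicRiesz (hs : -2 < s) (hsd : s < d) :
    IntegrableOn (periodicRiesz L s) (wignerSeitz L) :=
  (integrable_theta_mix L hs hsd).integral_prod_left.const_mul _

theorem integral_periodicRiesz_wave (hs : -2 < s) (hsd : s < d) (k : Space d) :
    ∫ x in wignerSeitz L, (periodicRiesz L s x : ℂ) * wave k x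
      = mixConst s * ∫ t in Set.Ioi (0 : ℝ), ((t ^ (s / 2 - 1) : ℝ) : ℂ) *
        ∫ x in wignerSeitz L, ((theta L t x - thetaMean L t : ℝ) : ℂ) * wave k x := by
  have e : ∀ x, (periodicRiesz L s x : ℂ) * wave k x = mixConst s *
      ∫ t in Set.Ioi (0 : ℝ), ((t ^ (s / 2 - 1) * (theta L t x - thetaMean L t) : ℝ) : ℂ)
        * wave k x := fun x => by
    rw [periodicRiesz, Complex.ofReal_mul, integral_mul_const, ← integral_complex_ofReal]
    ring
  simp_rw [e]
  rw [integral_const_mul, integral_integral_swap]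
  · congr 1
    refine integral_congr_ae (Eventually.of_forall fun t => ?_)
    simp only
    rw [← integral_const_mul]
    refine integral_congr_ae (Eventually.of_forall fun x => ?_)
    simp only
    push_cast; ring
  · exact (integrable_theta_mix L hs hsd).ofReal.mul_bdd (c := 1)
      ((continuous_wave k).comp continuous_fst).aestronglyMeasurable
      (Eventually.of_forall fun q => (norm_wave k q.1).le)

/-- Fubini reduces the coefficients to those of the periodized Gaussians. Subtracting the mean
removes the zero frequency and does not affect the others. -/
theorem isPeriodicRiesz_periodicRiesz (hs : -2 < s) (hsd : s < d) :
    IsPeriodicRiesz L s (periodicRiesz L s) where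
  periodic z hz x := by simp only [periodicRiesz, theta_periodic _ hz]
  integrable := integrableOn_periodicRiesz L hs hsd
  mean_zero := by
    have h := integral_periodicRiesz_wave L hs hsd 0
    simp only [wave_zero, mul_one] at h
    simp only [integral_complex_ofReal] at h
    rw [setIntegral_congr_fun (g := fun _ => (0 : ℂ)) measurableSet_Ioi
      (fun t ht => by simp only [integral_theta_sub_mean L ht, Complex.ofReal_zero, mul_zero]),
      integral_zero, mul_zero] at h
    exact_mod_cast h
  fourier k hk hk0 := by
    have := isFiniteMeasure_restrict_wignerSeitz L
    have h := integral_periodicRiesz_wave L hs hsd k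
    have hk1 : 0 < ‖k‖ := norm_pos_iff.2 hk0
    refine h.trans ?_
    rw [← mixConst_mul_eq_fourierConst hs hsd hk1, Complex.ofReal_mul,
      ← integral_rpow_mul_exp_neg_div (by linarith) (by positivity),
      ← integral_const_mul (Real.pi ^ ((d : ℝ) / 2)), ← integral_complex_ofReal]
    congr 1
    refine setIntegral_congr_fun measurableSet_Ioi fun t ht => ?_
    have ht : 0 < t := ht
    have e : ∫ x in wignerSeitz L, ((theta L t x - thetaMean L t : ℝ) : ℂ) * wave k x
        = (((Real.pi / t) ^ ((d : ℝ) / 2) * Real.exp (-(‖k‖ ^ 2 / (4 * t))) : ℝ) : ℂ) := by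
      simp only [Complex.ofReal_sub, sub_mul]
      rw [integral_sub, integral_theta_wave ht hk, integral_const_mul, integral_wave hk,
        if_neg hk0, mul_zero, sub_zero]
      · exact (integral_theta L ht).1.ofReal.mul_bdd (c := 1)
          (continuous_wave k).aestronglyMeasurable
          (Eventually.of_forall fun x => (norm_wave k x).le)
      · exact (Integrable.of_bound (continuous_wave k).aestronglyMeasurable 1
          (Eventually.of_forall fun x => (norm_wave k x).le)).const_mul _
    rw [e, ← Complex.ofReal_mul]
    congr 1
    rw [Real.div_rpow Real.pi_pos.le ht.le, show -(((d : ℝ) - s) / 2) - 1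
      = (s / 2 - 1) - (d : ℝ) / 2 by ring, Real.rpow_sub ht (s / 2 - 1) ((d : ℝ) / 2), div_div]
    ring

variable {L}

/-- Fourier uniqueness settles the cell; the set where the two functions differ is lattice
invariant, hence null as soon as its part in a fundamental domain is. -/
theorem IsPeriodicRiesz.ae_eq {V W : Space d → ℝ} (hV : IsPeriodicRiesz L s V)
    (hW : IsPeriodicRiesz L s W) : V =ᵐ[volume] W := by
  have h := ae_eq_zero_of_fourier_eq_zero (L := L) (hV.integrable.sub hW.integrable) fun k hk => by
    have hb : ∀ {U : Space d → ℝ}, IntegrableOn U (wignerSeitz L) →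
        IntegrableOn (fun x => (U x : ℂ) * wave k x) (wignerSeitz L) := fun hU =>
      hU.ofReal.mul_bdd (c := 1) (continuous_wave k).aestronglyMeasurable
        (Eventually.of_forall fun x => (norm_wave k x).le)
    simp only [Pi.sub_apply, Complex.ofReal_sub, sub_mul]
    rw [integral_sub (hb hV.integrable) (hb hW.integrable)]
    by_cases hk0 : k = 0
    · subst hk0
      simp only [wave_zero, mul_one]
      rw [integral_complex_ofReal, integral_complex_ofReal, hV.mean_zero, hW.mean_zero, sub_self]
    · have hk' := reciprocal_subset_dualLattice L hk
      exact sub_eq_zero.2 ((hV.fourier k hk' hk0).trans (hW.fourier k hk' hk0).symm)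
  rw [EventuallyEq, ae_iff]
  refine (isAddFundamentalDomain_wignerSeitz L).measure_zero_of_invariant _ (fun z => ?_) ?_
  · ext x
    rw [Set.mem_vadd_set_iff_neg_vadd_mem, Submodule.vadd_def, vadd_eq_add, add_comm]
    simp only [Set.mem_ofPred_eq]
    rw [hV.periodic _ (-z).2, hW.periodic _ (-z).2]
  · rw [EventuallyEq, ae_restrict_iff' (measurableSet_wignerSeitz L), ae_iff] at h
    refine measure_mono_null (fun x hx => ?_) h
    simp only [Set.mem_ofPred_eq, Classical.not_imp]
    exact ⟨hx.2, fun h0 => hx.1 (sub_eq_zero.1 h0)⟩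

end PeriodicRiesz

/-! ### Interaction through the periodic potential -/

section PairEnergy

variable {d : ℕ} {L : Submodule ℤ (Space d)} [DiscreteTopology L] [IsZLattice ℝ L]

theorem setIntegral_prod_cell {G : Type*} [NormedAddCommGroup G] [NormedSpace ℝ G]
    (F : Space d × Space d → G) (u : Space d) :
    ∫ p in wignerSeitz L ×ˢ cell L u, F p
      = ∫ p in wignerSeitz L ×ˢ wignerSeitz L, F (p.1, p.2 + u) := by
  have hmp : MeasurePreserving (Prod.map id (fun y : Space d => y + u))
      (volume : Measure (Space d × Space d)) volume :=
    (MeasurePreserving.id _).prod (measurePreserving_add_right volume u)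
  have hemb : MeasurableEmbedding (Prod.map id (fun y : Space d => y + u) :
      Space d × Space d → Space d × Space d) :=
    MeasurableEmbedding.id.prodMap (measurableEmbedding_addRight u)
  rw [← hmp.setIntegral_preimage_emb hemb]
  have hpre : Prod.map id (fun y : Space d => y + u) ⁻¹' (wignerSeitz L ×ˢ cell L u)
      = wignerSeitz L ×ˢ wignerSeitz L := by
    ext p; simp [cell]
  rw [hpre]
  rfl

section Periodic

variable {h : Space d → ℝ}


theorem preimage_sub_left_cell (x : Space d) :
    (fun y => x - y) ⁻¹' cell L x = wignerSeitz L := by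
  ext y
  simp only [cell, Set.mem_preimage, Set.mem_ofPred_eq, sub_sub_cancel_left]
  exact neg_mem_wignerSeitz_iff L

theorem integrableOn_sub_left (hper : ∀ z ∈ L, ∀ x, h (x + z) = h x)
    (hi : IntegrableOn h (wignerSeitz L)) (x : Space d) :
    IntegrableOn (fun y => h (x - y)) (wignerSeitz L) := by
  rw [← preimage_sub_left_cell x]
  refine ((Measure.measurePreserving_sub_left (volume : Measure (Space d))
    x).integrableOn_comp_preimage (MeasurableEquiv.subLeft x).measurableEmbedding).2 ?_
  refine ((isAddFundamentalDomain_cell L x).integrableOn_iff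
    (isAddFundamentalDomain_wignerSeitz L) fun z x => ?_).2 hi
  rw [Submodule.vadd_def, vadd_eq_add, add_comm]
  exact hper _ z.2 _

theorem setIntegral_sub_left (hper : ∀ z ∈ L, ∀ x, h (x + z) = h x) (x : Space d) :
    ∫ y in wignerSeitz L, h (x - y) = ∫ y in wignerSeitz L, h y := by
  have e := (Measure.measurePreserving_sub_left (volume : Measure (Space d))
    x).setIntegral_preimage_emb (MeasurableEquiv.subLeft x).measurableEmbedding h (cell L x)
  rw [preimage_sub_left_cell] at e
  rw [e]
  refine (isAddFundamentalDomain_cell L x).setIntegral_eq (f := h)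
    (isAddFundamentalDomain_wignerSeitz L) fun z x => ?_
  rw [Submodule.vadd_def, vadd_eq_add, add_comm]
  exact hper _ z.2 _

theorem integrableOn_conv_periodic (hper : ∀ z ∈ L, ∀ x, h (x + z) = h x) (hm : Measurable h)
    (hi : IntegrableOn h (wignerSeitz L)) :
    IntegrableOn (fun p : Space d × Space d => h (p.1 - p.2)) (wignerSeitz L ×ˢ wignerSeitz L) ∧
    ∫ p in wignerSeitz L ×ˢ wignerSeitz L, |h (p.1 - p.2)|
      = cellVolume L * ∫ x in wignerSeitz L, |h x| := by
  have := isFiniteMeasure_restrict_wignerSeitz L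
  have h1 : IntegrableOn (fun p : Space d × Space d => h (p.1 - p.2))
      (wignerSeitz L ×ˢ wignerSeitz L) := by
    have hm' : Measurable fun p : Space d × Space d => h (p.1 - p.2) := by fun_prop
    rw [IntegrableOn, Measure.volume_eq_prod, ← Measure.prod_restrict, integrable_prod_iff
      hm'.aestronglyMeasurable]
    refine ⟨Eventually.of_forall fun x => integrableOn_sub_left hper hi x, ?_⟩
    simp only [Real.norm_eq_abs]
    simp_rw [setIntegral_sub_left (h := fun x => |h x|) (fun z hz x => by rw [hper z hz])]
    exact integrable_const _
  refine ⟨h1, ?_⟩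
  have h2 := h1.abs
  rw [Measure.volume_eq_prod, ← Measure.prod_restrict] at h2
  rw [Measure.volume_eq_prod, ← Measure.prod_restrict, integral_prod _ h2]
  simp only
  simp_rw [setIntegral_sub_left (h := fun x => |h x|) (fun z hz x => by rw [hper z hz])]
  rw [integral_const, smul_eq_mul, measureReal_restrict_apply_univ, cellVolume]

/-- Constants do not interact with a mean zero periodic potential. -/
theorem integral_conv_periodic_add_const (hper : ∀ z ∈ L, ∀ x, h (x + z) = h x)
    (hm : Measurable h) (hi : IntegrableOn h (wignerSeitz L))
    (h0 : ∫ x in wignerSeitz L, h x = 0) {f : Space d → ℝ} (hf : Measurable f) {K : ℝ}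
    (hK : ∀ x, |f x| ≤ K) (c : ℝ) :
    IntegrableOn (fun p : Space d × Space d => h (p.1 - p.2) * ((f p.1 + c) * (f p.2 + c)))
      (wignerSeitz L ×ˢ wignerSeitz L) ∧
    ∫ p in wignerSeitz L ×ˢ wignerSeitz L, h (p.1 - p.2) * ((f p.1 + c) * (f p.2 + c))
      = ∫ p in wignerSeitz L ×ˢ wignerSeitz L, h (p.1 - p.2) * (f p.1 * f p.2) := by
  have hconv := (integrableOn_conv_periodic hper hm hi).1
  have i1 : IntegrableOn (fun p : Space d × Space d => h (p.1 - p.2) * f p.1)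
      (wignerSeitz L ×ˢ wignerSeitz L) :=
    hconv.mul_bdd (c := K) (hf.comp measurable_fst).aestronglyMeasurable
      (Eventually.of_forall fun p => hK _)
  have i2 : IntegrableOn (fun p : Space d × Space d => h (p.1 - p.2) * f p.2)
      (wignerSeitz L ×ˢ wignerSeitz L) :=
    hconv.mul_bdd (c := K) (hf.comp measurable_snd).aestronglyMeasurable
      (Eventually.of_forall fun p => hK _)
  have i3 : IntegrableOn (fun p : Space d × Space d => h (p.1 - p.2) * (f p.1 * f p.2))
      (wignerSeitz L ×ˢ wignerSeitz L) :=
    hconv.mul_bdd (c := K ^ 2) (by fun_prop : Measurable fun p : Space d × Space d =>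
      f p.1 * f p.2).aestronglyMeasurable
      (Eventually.of_forall fun p => abs_mul_le_of_bounded hK _ _)
  have e : (fun p : Space d × Space d => h (p.1 - p.2) * ((f p.1 + c) * (f p.2 + c)))
      = fun p => h (p.1 - p.2) * (f p.1 * f p.2) + (c * (h (p.1 - p.2) * f p.1)
        + (c * (h (p.1 - p.2) * f p.2) + c ^ 2 * h (p.1 - p.2))) := by
    funext p; ring
  have z1 : ∀ g : Space d → ℝ, IntegrableOn (fun p : Space d × Space d => h (p.1 - p.2) * g p.1)
      (wignerSeitz L ×ˢ wignerSeitz L) →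
      ∫ p in wignerSeitz L ×ˢ wignerSeitz L, h (p.1 - p.2) * g p.1 = 0 := fun g hg => by
    rw [IntegrableOn, Measure.volume_eq_prod, ← Measure.prod_restrict] at hg
    rw [Measure.volume_eq_prod, ← Measure.prod_restrict, integral_prod _ hg]
    simp only [integral_mul_const]
    simp_rw [setIntegral_sub_left hper, h0, zero_mul, integral_zero]
  have z2 : ∫ p in wignerSeitz L ×ˢ wignerSeitz L, h (p.1 - p.2) * f p.2 = 0 := by
    have hg := i2
    rw [IntegrableOn, Measure.volume_eq_prod, ← Measure.prod_restrict] at hg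
    rw [Measure.volume_eq_prod, ← Measure.prod_restrict, integral_prod_symm _ hg]
    simp only [integral_mul_const, sub_eq_add_neg]
    simp_rw [setIntegral_wignerSeitz_add hper, h0, zero_mul, integral_zero]
  have z3 : ∫ p in wignerSeitz L ×ˢ wignerSeitz L, h (p.1 - p.2) = 0 := by
    simpa using z1 (fun _ => 1) (by simpa using hconv)
  have j1 := i1.const_mul c
  have j2 := i2.const_mul c
  have j3 := hconv.const_mul (c ^ 2)
  have j23 : IntegrableOn (fun p : Space d × Space d => c * (h (p.1 - p.2) * f p.2)
    + c ^ 2 * h (p.1 - p.2)) (wignerSeitz L ×ˢ wignerSeitz L) := j2.add j3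
  have j123 : IntegrableOn (fun p : Space d × Space d => c * (h (p.1 - p.2) * f p.1)
    + (c * (h (p.1 - p.2) * f p.2) + c ^ 2 * h (p.1 - p.2)))
    (wignerSeitz L ×ˢ wignerSeitz L) := j1.add j23
  rw [e]
  refine ⟨i3.add j123, ?_⟩
  rw [integral_add i3 j123, integral_add j1 j23, integral_add j2 j3,
    integral_const_mul, integral_const_mul, integral_const_mul, z1 f i1, z2, z3]
  ring

end Periodic

variable {f : Space d → ℝ}

/-- Summing the Gaussian over lattice translates on `Q × Q` is the same as letting the second point
range over all cells, by periodicity of `f`. The mean drops out by neutrality. -/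
theorem IsNeutral.integral_theta_pair (hf : IsNeutral L f) {t : ℝ} (ht : 0 < t) :
    ∫ p in wignerSeitz L ×ˢ wignerSeitz L,
      (theta L t (p.1 - p.2) - thetaMean L t) * (f p.1 * f p.2) = gaussEnergy L f t := by
  obtain ⟨K, hK⟩ := hf.bounded
  have hfm := hf.measurable
  have hconv := (integrableOn_conv_periodic (L := L) (h := theta L t)
    (fun z hz x => theta_periodic t hz x)
    ((measurable_theta L).comp measurable_prodMk_left) (integral_theta L ht).1).1
  have hffm : Measurable fun p : Space d × Space d => f p.1 * f p.2 := by fun_prop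
  have hbdd : ∀ᵐ p ∂((volume : Measure (Space d × Space d)).restrict
      (wignerSeitz L ×ˢ wignerSeitz L)), ‖f p.1 * f p.2‖ ≤ K ^ 2 :=
    Eventually.of_forall fun p => abs_mul_le_of_bounded hK _ _
  have i1 := hconv.mul_bdd hffm.aestronglyMeasurable hbdd
  have i2 : IntegrableOn (fun p : Space d × Space d => f p.1 * f p.2)
      (wignerSeitz L ×ˢ wignerSeitz L) :=
    IntegrableOn.of_bound ((isBounded_wignerSeitz L).prod
      (isBounded_wignerSeitz L)).measure_lt_top hffm.aestronglyMeasurable _ hbdd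
  have hff : ∫ p in wignerSeitz L ×ˢ wignerSeitz L, f p.1 * f p.2 = 0 := by
    rw [Measure.volume_eq_prod, ← Measure.prod_restrict, integral_prod_mul,
      hf.integral_eq_zero, zero_mul]
  simp_rw [sub_mul]
  rw [integral_sub i1 (i2.const_mul _), integral_const_mul, hff, mul_zero, sub_zero]
  set g : Space d × Space d → ℝ := fun p => Real.exp (-(t * ‖p.1 - p.2‖ ^ 2))
  have hg : IntegrableOn g (wignerSeitz L ×ˢ Set.univ) :=
    integrableOn_conv (𝕜 := ℝ) (volume_wignerSeitz_ne_top L) (integrable_gaussian ht)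
  have hsub : ∀ u : Space d, wignerSeitz L ×ˢ cell L u
      ⊆ (wignerSeitz L ×ˢ Set.univ : Set (Space d × Space d)) := fun u =>
    Set.prod_mono_right (Set.subset_univ _)
  have hFi : ∀ u : L, IntegrableOn (fun p : Space d × Space d =>
      Real.exp (-(t * ‖p.1 - p.2 + u‖ ^ 2)) * (f p.1 * f p.2))
      (wignerSeitz L ×ˢ wignerSeitz L) := fun u =>
    IntegrableOn.of_bound ((isBounded_wignerSeitz L).prod
      (isBounded_wignerSeitz L)).measure_lt_top (Measurable.aestronglyMeasurable (by fun_prop))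
      (K ^ 2) (Eventually.of_forall fun p => by
        rw [norm_mul, ← one_mul (K ^ 2)]
        refine mul_le_mul ?_ (abs_mul_le_of_bounded hK _ _) (norm_nonneg _) zero_le_one
        rw [Real.norm_of_nonneg (Real.exp_pos _).le, Real.exp_le_one_iff]
        have : 0 ≤ t * ‖p.1 - p.2 + u‖ ^ 2 := by positivity
        linarith)
  have hnn : ∀ u : L, ∫ p in wignerSeitz L ×ˢ cell L (-u : L), g p
      = ∫ p in wignerSeitz L ×ˢ wignerSeitz L, Real.exp (-(t * ‖p.1 - p.2 + u‖ ^ 2)) := fun u => by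
    rw [setIntegral_prod_cell]
    refine integral_congr_ae (Eventually.of_forall fun p => ?_)
    simp only [g, NegMemClass.coe_neg]
    rw [show p.1 - (p.2 + -(u : Space d)) = p.1 - p.2 + u by abel]
  have hgi : ∀ u : L, IntegrableOn (fun p : Space d × Space d =>
      Real.exp (-(t * ‖p.1 - p.2 + u‖ ^ 2))) (wignerSeitz L ×ˢ wignerSeitz L) := fun u =>
    IntegrableOn.of_bound ((isBounded_wignerSeitz L).prod
      (isBounded_wignerSeitz L)).measure_lt_top (Measurable.aestronglyMeasurable (by fun_prop))
      1 (Eventually.of_forall fun p => by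
        rw [Real.norm_of_nonneg (Real.exp_pos _).le, Real.exp_le_one_iff]
        have : 0 ≤ t * ‖p.1 - p.2 + u‖ ^ 2 := by positivity
        linarith)
  have hs : Summable fun u : L => ∫ p in wignerSeitz L ×ˢ wignerSeitz L,
      ‖Real.exp (-(t * ‖p.1 - p.2 + u‖ ^ 2)) * (f p.1 * f p.2)‖ := by
    have h1 := ((Equiv.neg L).summable_iff.2 (hasSum_integral_cells L hg).summable).mul_left (K ^ 2)
    refine Summable.of_nonneg_of_le (fun u => integral_nonneg fun _ => norm_nonneg _) (fun u => ?_) h1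
    simp only [Function.comp, Equiv.neg_apply]
    rw [hnn, ← integral_const_mul]
    refine integral_mono (hFi u).norm ((hgi u).const_mul _) fun p => ?_
    simp only [norm_mul]
    rw [Real.norm_of_nonneg (Real.exp_pos _).le, mul_comm, ← norm_mul]
    exact mul_le_mul_of_nonneg_right (abs_mul_le_of_bounded hK _ _) (Real.exp_pos _).le
  have hsum := (hasSum_integral_cells L
    (integrableOn_gaussPair hf (volume_wignerSeitz_ne_top L) ht)).tsum_eq
  -- The second point in the cell at `-u` produces the difference `x - y + u` that occurs in
  -- `theta`.
  rw [gaussEnergy, ← hsum, ← (Equiv.neg L).tsum_eq]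
  have e : ∀ u : L, ∫ p in wignerSeitz L ×ˢ cell L (Equiv.neg L u), gaussPair f t p
      = ∫ p in wignerSeitz L ×ˢ wignerSeitz L,
        Real.exp (-(t * ‖p.1 - p.2 + u‖ ^ 2)) * (f p.1 * f p.2) := fun u => by
    rw [setIntegral_prod_cell]
    refine integral_congr_ae (Eventually.of_forall fun p => ?_)
    simp only [gaussPair, Equiv.neg_apply, NegMemClass.coe_neg]
    rw [show p.1 - (p.2 + -(u : Space d)) = p.1 - p.2 + u by abel,
      hf.periodic _ (L.neg_mem u.2)]
  simp_rw [e]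
  rw [integral_tsum_of_summable_integral_norm hFi hs]
  refine integral_congr_ae (Eventually.of_forall fun p => ?_)
  simp only [theta]
  rw [tsum_mul_right]

variable {s : ℝ}

/-- Fubini in `t`, justified by the `L¹` bound on the periodized Gaussians. No multipole condition
enters here, in contrast to the thermodynamic limit. -/
theorem IsNeutral.integral_periodicRiesz_pair (hf : IsNeutral L f) (hs : -2 < s) (hsd : s < d) :
    ∫ p in wignerSeitz L ×ˢ wignerSeitz L, periodicRiesz L s (p.1 - p.2) * (f p.1 * f p.2)
      = chargeEnergy L f s := by
  obtain ⟨K, hK⟩ := hf.bounded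
  have hfm := hf.measurable
  have hQ := cellVolume_pos L
  obtain ⟨C₁, C₂, hC⟩ := exists_integral_theta_sub_mean_le L
  have hθ := measurable_theta L
  have hμ := measurable_thetaMean L
  have hconv : ∀ t : ℝ, 0 < t → _ := fun t ht =>
    integrableOn_conv_periodic (L := L) (h := fun x => theta L t x - thetaMean L t)
    (fun z hz x => by rw [theta_periodic t hz x]) (by fun_prop)
    (integrableOn_theta_sub_mean L ht)
  have hint : Integrable (fun q : (Space d × Space d) × ℝ =>
      q.2 ^ (s / 2 - 1) * (theta L q.2 (q.1.1 - q.1.2) - thetaMean L q.2))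
      ((volume.restrict (wignerSeitz L ×ˢ wignerSeitz L)).prod (volume.restrict (Set.Ioi 0))) := by
    rw [integrable_prod_iff' (Measurable.aestronglyMeasurable (by fun_prop))]
    constructor
    · filter_upwards [ae_restrict_mem measurableSet_Ioi] with t ht
      exact (hconv t ht).1.const_mul _
    · have hm : Measurable fun t : ℝ =>
          ∫ x in wignerSeitz L, |theta L t x - thetaMean L t| :=
        (StronglyMeasurable.integral_prod_right' (ν := volume.restrict (wignerSeitz L))
          (f := fun q : ℝ × Space d => |theta L q.1 q.2 - thetaMean L q.1|)
          (Measurable.stronglyMeasurable (by fun_prop))).measurable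
      refine ((integrableOn_mellin_of_le (s := s) hm (p := 1) (q := (d : ℝ) / 2) (by linarith)
        (by linarith) (C₁ := C₁) (C₂ := C₂) fun t ht => ?_).const_mul (cellVolume L)).congr ?_
      · rw [abs_of_nonneg (integral_nonneg fun _ => abs_nonneg _)]
        exact hC t ht
      · filter_upwards [ae_restrict_mem measurableSet_Ioi] with t ht
        have ht : 0 < t := ht
        rw [mul_left_comm, ← (hconv t ht).2, ← integral_const_mul]
        refine integral_congr_ae (Eventually.of_forall fun x => ?_)
        simp only [norm_mul, Real.norm_eq_abs]
        rw [abs_of_nonneg (by positivity : 0 ≤ t ^ (s / 2 - 1))]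
  have hint2 := hint.mul_bdd (c := K ^ 2) (g := fun q : (Space d × Space d) × ℝ =>
      f q.1.1 * f q.1.2) (Measurable.aestronglyMeasurable (by fun_prop))
    (Eventually.of_forall fun q => abs_mul_le_of_bounded hK _ _)
  have e : ∀ p : Space d × Space d, periodicRiesz L s (p.1 - p.2) * (f p.1 * f p.2)
      = mixConst s * ∫ t in Set.Ioi (0 : ℝ), t ^ (s / 2 - 1)
        * (theta L t (p.1 - p.2) - thetaMean L t) * (f p.1 * f p.2) := fun p => by
    rw [periodicRiesz, integral_mul_const, mul_assoc]
  simp_rw [e]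
  rw [integral_const_mul, integral_integral_swap hint2, chargeEnergy]
  congr 1
  refine setIntegral_congr_fun measurableSet_Ioi fun t ht => ?_
  rw [← hf.integral_theta_pair ht, ← integral_const_mul]
  refine integral_congr_ae (Eventually.of_forall fun x => ?_)
  simp only; ring

/-- The interaction energy with the periodic Riesz potential. -/
theorem IsNeutral.integral_isPeriodicRiesz (hf : IsNeutral L f) (hs : -2 < s) (hsd : s < d)
    {V : Space d → ℝ} (hV : IsPeriodicRiesz L s V) {ρ : Space d → ℝ} {c : ℝ}
    (hρ : ρ =ᵐ[volume] fun x => f x + c) :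
    IntegrableOn (fun p : Space d × Space d => V (p.1 - p.2) * ρ p.1 * ρ p.2)
      (wignerSeitz L ×ˢ wignerSeitz L) ∧
    ∫ p in wignerSeitz L ×ˢ wignerSeitz L, V (p.1 - p.2) * ρ p.1 * ρ p.2
      = chargeEnergy L f s := by
  obtain ⟨K, hK⟩ := hf.bounded
  have hW := isPeriodicRiesz_periodicRiesz L hs hsd
  have h := integral_conv_periodic_add_const hW.periodic (measurable_periodicRiesz L s)
    hW.integrable hW.mean_zero hf.measurable hK c
  have e : (fun p : Space d × Space d => V (p.1 - p.2) * ρ p.1 * ρ p.2) =ᵐ[volume]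
      fun p => periodicRiesz L s (p.1 - p.2) * ((f p.1 + c) * (f p.2 + c)) := by
    filter_upwards [ae_prod_of_ae_sub (hV.ae_eq hW),
      Measure.quasiMeasurePreserving_fst.ae hρ, Measure.quasiMeasurePreserving_snd.ae hρ]
      with p h1 h2 h3
    rw [h1, h2, h3, mul_assoc]
  refine ⟨h.1.congr (ae_restrict_of_ae e.symm), ?_⟩
  rw [integral_congr_ae (ae_restrict_of_ae e), h.2, hf.integral_periodicRiesz_pair hs hsd]

end PairEnergy

/-! ### Thermodynamic limits for clustering processes -/

section Limits

variable {d : ℕ}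

/-- Correlation functions of an `L`-periodic process, with `ρ₁ = f + c` for a neutral charge
density `f`, with repulsion and clustering. -/
structure IsClustering (L : Submodule ℤ (Space d)) (f : Space d → ℝ) (c : ℝ)
    (ρ₁ : Space d → ℝ) (ρ₂ : Space d × Space d → ℝ) (a b C : ℝ) : Prop where
  neutral : IsNeutral L f
  one : ρ₁ =ᵐ[volume] fun x => f x + c
  measurable_one : Measurable ρ₁
  measurable_two : Measurable ρ₂
  periodic : IsDiagPeriodic L ρ₂
  a_pos : 0 < a
  b_pos : 0 < b
  C_pos : 0 < C
  repulsion : ∀ᵐ p : Space d × Space d, |ρ₂ p| ≤ C * Real.exp (-(1 / (C * ‖p.1 - p.2‖ ^ a)))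
  clustering : ∀ᵐ p : Space d × Space d,
      |ρ₂ p - ρ₁ p.1 * ρ₁ p.2| ≤ C / (1 + ‖p.1 - p.2‖ ^ b)

variable {L : Submodule ℤ (Space d)} {f ρ₁ : Space d → ℝ} {ρ₂ : Space d × Space d → ℝ}
  {a b C c s : ℝ}

/-- The truncated two-point function. -/
def truncated (ρ₁ : Space d → ℝ) (ρ₂ : Space d × Space d → ℝ) (p : Space d × Space d) : ℝ :=
  ρ₂ p - ρ₁ p.1 * ρ₁ p.2

namespace IsClustering

theorem measurable_truncated (h : IsClustering L f c ρ₁ ρ₂ a b C) :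
    Measurable (truncated ρ₁ ρ₂) := by
  have h1 := h.measurable_one
  have h2 := h.measurable_two
  unfold truncated; fun_prop

theorem two_le (h : IsClustering L f c ρ₁ ρ₂ a b C) :
    ∀ᵐ p : Space d × Space d, |ρ₂ p| ≤ C := by
  filter_upwards [h.repulsion] with p hp
  refine hp.trans (mul_le_of_le_one_right h.C_pos.le (Real.exp_le_one_iff.2 ?_))
  have := h.C_pos
  have : 0 ≤ 1 / (C * ‖p.1 - p.2‖ ^ a) := by positivity
  linarith

theorem truncated_periodic (h : IsClustering L f c ρ₁ ρ₂ a b C) :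
    IsDiagPeriodic L (truncated ρ₁ ρ₂) := by
  intro z hz
  have e := h.one
  have hq : ∀ᵐ x : Space d, ρ₁ (x + z) = ρ₁ x := by
    filter_upwards [e, (measurePreserving_add_right volume z).quasiMeasurePreserving.ae e]
      with x h1 h2
    rw [h1, h2, h.neutral.periodic z hz]
  filter_upwards [h.periodic z hz, Measure.quasiMeasurePreserving_fst.ae hq,
    Measure.quasiMeasurePreserving_snd.ae hq] with p h1 h2 h3
  rw [truncated, truncated, h1, Prod.fst_add, Prod.snd_add, h2, h3]

theorem exists_near_bound (hd : 1 ≤ d) (h : IsClustering L f c ρ₁ ρ₂ a b C) (σ : ℝ) :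
    ∃ K : ℝ, 0 ≤ K ∧ ∀ᵐ p : Space d × Space d, ‖p.1 - p.2‖ ≤ 1 →
      |ρ₂ p| * ‖p.1 - p.2‖ ^ (-σ) ≤ K := by
  obtain ⟨K, hK, hb⟩ := exists_exp_neg_inv_mul_rpow_le h.a_pos h.C_pos σ
  refine ⟨C * K, mul_nonneg h.C_pos.le hK, ?_⟩
  filter_upwards [h.repulsion, ae_prod_of_ae_sub (ae_ne_zero hd)] with p hp h0 h1
  refine (mul_le_mul_of_nonneg_right hp (by positivity)).trans ?_
  rw [mul_assoc]
  exact mul_le_mul_of_nonneg_left (hb _ (norm_pos_iff.2 h0) h1) h.C_pos.le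

/-- Within distance one, repulsion makes ρ₂|x-y|^{-s} bounded; beyond it ρ₂ is bounded and the power
is integrable since `s > d`. -/
theorem integrableOn_short (hd : 1 ≤ d) (h : IsClustering L f c ρ₁ ρ₂ a b C) (hs : (d : ℝ) < s)
    {A : Set (Space d)} (hA : volume A ≠ ∞) :
    IntegrableOn (fun p : Space d × Space d => ρ₂ p * ‖p.1 - p.2‖ ^ (-s)) (A ×ˢ Set.univ) := by
  obtain ⟨K, hK, hb⟩ := h.exists_near_bound hd s
  have hm : MeasurableSet {x : Space d | 1 ≤ ‖x‖} := measurableSet_le (by fun_prop) (by fun_prop)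
  have i1 : Integrable (Set.indicator (Metric.closedBall (0 : Space d) 1) fun _ => K) :=
    (integrable_indicator_iff Metric.isClosed_closedBall.measurableSet).2
      (integrableOn_const Metric.isBounded_closedBall.measure_lt_top.ne)
  have i2 : Integrable (Set.indicator {x : Space d | 1 ≤ ‖x‖} fun x => C * ‖x‖ ^ (-s)) :=
    (integrable_indicator_iff hm).2 ((integrable_indicator_rpow hd hs).const_mul C)
  have h2 := h.measurable_two
  refine Integrable.mono' (integrableOn_conv (𝕜 := ℝ) hA (i1.add i2))
    (Measurable.aestronglyMeasurable (by fun_prop)) (ae_restrict_of_ae ?_)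
  filter_upwards [hb, h.two_le] with p hp hC
  have hC0 := h.C_pos
  rw [norm_mul, Real.norm_eq_abs, Real.norm_of_nonneg (by positivity), Pi.add_apply]
  by_cases hle : ‖p.1 - p.2‖ ≤ 1
  · rw [Set.indicator_of_mem (mem_closedBall_zero_iff.2 hle)]
    refine (hp hle).trans (le_add_of_nonneg_right (Set.indicator_nonneg (fun x _ => ?_) _))
    positivity
  · have h1 : (1 : ℝ) ≤ ‖p.1 - p.2‖ := (not_le.1 hle).le
    rw [Set.indicator_of_mem (s := {x : Space d | 1 ≤ ‖x‖}) h1]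
    refine (mul_le_mul_of_nonneg_right hC (by positivity)).trans
      (le_add_of_nonneg_left (Set.indicator_nonneg (fun x _ => hK) _))

/-- Clustering dominates the integrand by a function of `x - y` that is integrable for `d - b < s <
d`. -/
theorem integrableOn_long (hd : 1 ≤ d) (h : IsClustering L f c ρ₁ ρ₂ a b C)
    (hsb : (d : ℝ) - b < s) (hsd : s < d) {A : Set (Space d)} (hA : volume A ≠ ∞) :
    IntegrableOn (fun p : Space d × Space d => riesz s (p.1 - p.2) * truncated ρ₁ ρ₂ p)
      (A ×ˢ Set.univ) := by
  have h1 := h.measurable_truncated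
  have h2 := measurable_riesz (d := d) s
  refine Integrable.mono' (integrableOn_conv (𝕜 := ℝ) hA
    ((integrable_riesz_div_one_add hd hsb hsd).const_mul C))
    (Measurable.aestronglyMeasurable (by fun_prop)) (ae_restrict_of_ae ?_)
  filter_upwards [h.clustering] with p hp
  rw [norm_mul, Real.norm_eq_abs, Real.norm_eq_abs]
  refine (mul_le_mul_of_nonneg_left hp (abs_nonneg _)).trans_eq (by ring)

variable [DiscreteTopology L] [IsZLattice ℝ L] {P : Measure (Config d)} [IsProbabilityMeasure P]

theorem short_range (hd : 1 ≤ d) (h : IsClustering L f c ρ₁ ρ₂ a b C)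
    (hρ₂ : IsTwoPointCorrelation P ρ₂) (hs : (d : ℝ) < s) :
    (∀ R : ℝ, Integrable (fun X => energy s X) (localize P (cellUnion L R))) ∧
      IntegrableOn (fun p : Space d × Space d => ρ₂ p / ‖p.1 - p.2‖ ^ s)
        (wignerSeitz L ×ˢ Set.univ) ∧
      Tendsto (fun R : ℝ => (∫ X, energy s X ∂(localize P (cellUnion L R)))
          / volume.real (cellUnion L R)) atTop
        (𝓝 (1 / (2 * cellVolume L) *
          (∫ p in wignerSeitz L ×ˢ Set.univ, ρ₂ p / ‖p.1 - p.2‖ ^ s))) := by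
  have hs0 : 0 < s := lt_of_le_of_lt d.cast_nonneg hs
  have e : ∀ p : Space d × Space d, ρ₂ p / ‖p.1 - p.2‖ ^ s = ρ₂ p * ‖p.1 - p.2‖ ^ (-s) :=
    fun p => by rw [Real.rpow_neg (norm_nonneg _), div_eq_mul_inv]
  have e' : ∀ p : Space d × Space d, ρ₂ p * riesz s (p.1 - p.2) = ρ₂ p * ‖p.1 - p.2‖ ^ (-s) :=
    fun p => by rw [riesz, if_pos hs0]
  simp_rw [e]
  have hR : ∀ R, _ := fun R => energy_localize (P := P) (s := s) (measurableSet_cellUnion L R)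
    (isBounded_cellUnion L R) hρ₂ (by
      simp_rw [e']
      exact (h.integrableOn_short hd hs (isBounded_cellUnion L R).measure_lt_top.ne).mono_set
        (Set.prod_mono_right (Set.subset_univ _)))
  have hQ := h.integrableOn_short hd hs (volume_wignerSeitz_ne_top L)
  refine ⟨fun R => (hR R).1, hQ, ?_⟩
  have hper : IsDiagPeriodic L fun p : Space d × Space d => ρ₂ p * ‖p.1 - p.2‖ ^ (-s) := by
    intro z hz
    filter_upwards [h.periodic z hz] with p hp
    rw [hp]; simp
  have hlim := (tendsto_setIntegral_cellUnion_prod L hper hQ).const_mul (1 / 2)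
  have e2 : ∀ R, (∫ X, energy s X ∂(localize P (cellUnion L R))) / volume.real (cellUnion L R)
      = 1 / 2 * ((∫ p in cellUnion L R ×ˢ cellUnion L R, ρ₂ p * ‖p.1 - p.2‖ ^ (-s))
        / volume.real (cellUnion L R)) := fun R => by
    rw [(hR R).2, mul_div_assoc]; simp_rw [e']
  simp_rw [e2]
  convert hlim using 2
  field_simp

theorem exists_one_bound (h : IsClustering L f c ρ₁ ρ₂ a b C) :
    ∃ K, ∀ᵐ x : Space d, ‖ρ₁ x‖ ≤ K := by
  obtain ⟨K, hK⟩ := h.neutral.bounded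
  refine ⟨K + |c|, ?_⟩
  filter_upwards [h.one] with x hx
  rw [hx]
  exact (norm_add_le _ _).trans (add_le_add (hK x) le_rfl)

/-- Completing the square: with ρ₂ replaced by its truncation plus ρ₁⊗ρ₁, the background terms
combine as `(ρ₁ - c)⊗(ρ₁ - c) = f⊗f`. Symmetry of the potential identifies the two cross terms. -/
theorem jellium (hd : 1 ≤ d) (h : IsClustering L f c ρ₁ ρ₂ a b C)
    (hρ₁ : IsOnePointCorrelation P ρ₁) (hρ₂ : IsTwoPointCorrelation P ρ₂)
    (hsb : (d : ℝ) - b < s) (hsd : s < d) (R : ℝ) :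
    Integrable (fun X => jelliumEnergy s X (cellUnion L R) c) (localize P (cellUnion L R)) ∧
    ∫ X, jelliumEnergy s X (cellUnion L R) c ∂(localize P (cellUnion L R))
      = 1 / 2 * (∫ p in cellUnion L R ×ˢ cellUnion L R,
          riesz s (p.1 - p.2) * truncated ρ₁ ρ₂ p)
        + 1 / 2 * (∫ p in cellUnion L R ×ˢ cellUnion L R,
          riesz s (p.1 - p.2) * (f p.1 * f p.2)) := by
  have hb := isBounded_cellUnion L R
  have hΩ := measurableSet_cellUnion L R
  set Ω := cellUnion L R
  obtain ⟨K, hK⟩ := h.exists_one_bound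
  have hK1 : ∀ᵐ p : Space d × Space d, ‖ρ₁ p.1‖ ≤ K := Measure.quasiMeasurePreserving_fst.ae hK
  have hK2 : ∀ᵐ p : Space d × Space d, ‖ρ₁ p.2‖ ≤ K := Measure.quasiMeasurePreserving_snd.ae hK
  have hm1 := h.measurable_one
  have hV : IntegrableOn (fun p : Space d × Space d => riesz s (p.1 - p.2)) (Ω ×ˢ Ω) :=
    integrableOn_conv_of_locallyIntegrable (𝕜 := ℝ) hb (integrableOn_ball_riesz hd hsd)
  have i1 : IntegrableOn (fun p : Space d × Space d => riesz s (p.1 - p.2) * ρ₁ p.1) (Ω ×ˢ Ω) :=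
    hV.mul_bdd (hm1.comp measurable_fst).aestronglyMeasurable (ae_restrict_of_ae hK1)
  have i2 : IntegrableOn (fun p : Space d × Space d => riesz s (p.1 - p.2) * ρ₁ p.2) (Ω ×ˢ Ω) :=
    hV.mul_bdd (hm1.comp measurable_snd).aestronglyMeasurable (ae_restrict_of_ae hK2)
  have i3 : IntegrableOn (fun p : Space d × Space d =>
      riesz s (p.1 - p.2) * ρ₁ p.1 * ρ₁ p.2) (Ω ×ˢ Ω) :=
    i1.mul_bdd (hm1.comp measurable_snd).aestronglyMeasurable (ae_restrict_of_ae hK2)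
  have iT : IntegrableOn (fun p : Space d × Space d =>
      riesz s (p.1 - p.2) * truncated ρ₁ ρ₂ p) (Ω ×ˢ Ω) :=
    (h.integrableOn_long hd hsb hsd hb.measure_lt_top.ne).mono_set
      (Set.prod_mono_right (Set.subset_univ _))
  have e2 : (fun p : Space d × Space d => ρ₂ p * riesz s (p.1 - p.2)) = fun p =>
      riesz s (p.1 - p.2) * truncated ρ₁ ρ₂ p + riesz s (p.1 - p.2) * ρ₁ p.1 * ρ₁ p.2 := by
    funext p; rw [truncated]; ring
  have iρ : IntegrableOn (fun p : Space d × Space d => ρ₂ p * riesz s (p.1 - p.2)) (Ω ×ˢ Ω) := by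
    rw [e2]; exact iT.add i3
  have hprod : ∀ g : Space d × Space d → ℝ, IntegrableOn g (Ω ×ˢ Ω) →
      IntegrableOn (fun x => ∫ y in Ω, g (x, y)) Ω ∧
      ∫ p in Ω ×ˢ Ω, g p = ∫ x in Ω, ∫ y in Ω, g (x, y) := fun g hg => by
    rw [IntegrableOn, Measure.volume_eq_prod, ← Measure.prod_restrict] at hg
    refine ⟨hg.integral_prod_left, ?_⟩
    rw [Measure.volume_eq_prod, ← Measure.prod_restrict, integral_prod _ hg]
  have e1 : ∀ x, ∫ y in Ω, riesz s (x - y) * ρ₁ x = ρ₁ x * ∫ y in Ω, riesz s (x - y) := fun x => by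
    rw [integral_mul_const, mul_comm]
  have iρ1 : IntegrableOn (fun x => ρ₁ x * ∫ y in Ω, riesz s (x - y)) Ω := by
    have := (hprod _ i1).1
    simpa only [e1] using this
  obtain ⟨j1, j2⟩ := jelliumEnergy_localize (P := P) hΩ hb hρ₂ hρ₁ c iρ iρ1
  refine ⟨j1, j2.trans ?_⟩
  have hsym : ∫ p in Ω ×ˢ Ω, riesz s (p.1 - p.2) * ρ₁ p.2
      = ∫ p in Ω ×ˢ Ω, riesz s (p.1 - p.2) * ρ₁ p.1 := by
    have := setIntegral_prod_swap (μ := (volume : Measure (Space d)))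
      (ν := (volume : Measure (Space d))) Ω Ω
      (fun p : Space d × Space d => riesz s (p.1 - p.2) * ρ₁ p.1)
    rw [Measure.volume_eq_prod, ← this]
    refine integral_congr_ae (Eventually.of_forall fun p => ?_)
    simp only [Prod.fst_swap, Prod.snd_swap, riesz, norm_sub_rev]
  have t1 : ∫ x in Ω, ρ₁ x * ∫ y in Ω, riesz s (x - y)
      = ∫ p in Ω ×ˢ Ω, riesz s (p.1 - p.2) * ρ₁ p.1 := by
    rw [(hprod _ i1).2]; simp only [e1]
  have t2 : ∫ x in Ω, ∫ y in Ω, riesz s (x - y) = ∫ p in Ω ×ˢ Ω, riesz s (p.1 - p.2) :=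
    (hprod _ hV).2.symm
  have eff : (fun p : Space d × Space d => riesz s (p.1 - p.2) * (f p.1 * f p.2))
      =ᵐ[volume.restrict (Ω ×ˢ Ω)] fun p => riesz s (p.1 - p.2) * ρ₁ p.1 * ρ₁ p.2
        - c * (riesz s (p.1 - p.2) * ρ₁ p.1) - c * (riesz s (p.1 - p.2) * ρ₁ p.2)
        + c ^ 2 * riesz s (p.1 - p.2) := by
    refine ae_restrict_of_ae ?_
    filter_upwards [Measure.quasiMeasurePreserving_fst.ae h.one,
      Measure.quasiMeasurePreserving_snd.ae h.one] with p h1 h2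
    rw [h1, h2]; ring
  have k1 : IntegrableOn (fun p : Space d × Space d => riesz s (p.1 - p.2) * ρ₁ p.1 * ρ₁ p.2
        - c * (riesz s (p.1 - p.2) * ρ₁ p.1)) (Ω ×ˢ Ω) := i3.sub (i1.const_mul c)
  have k2 : IntegrableOn (fun p : Space d × Space d => riesz s (p.1 - p.2) * ρ₁ p.1 * ρ₁ p.2
        - c * (riesz s (p.1 - p.2) * ρ₁ p.1) - c * (riesz s (p.1 - p.2) * ρ₁ p.2)) (Ω ×ˢ Ω) :=
    k1.sub (i2.const_mul c)
  rw [t1, t2, e2, integral_add iT i3, integral_congr_ae eff,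
    integral_add k2 (hV.const_mul (c ^ 2)), integral_sub k1 (i2.const_mul c),
    integral_sub i3 (i1.const_mul c), integral_const_mul, integral_const_mul, integral_const_mul,
    hsym]
  ring

theorem long_range (hd : 1 ≤ d) (h : IsClustering L f c ρ₁ ρ₂ a b C)
    (hρ₁ : IsOnePointCorrelation P ρ₁) (hρ₂ : IsTwoPointCorrelation P ρ₂) {m : ℕ}
    (hm : HasMultipoleOrder L f m) (hs : -2 < s) (hsm : (d : ℝ) - m < s)
    (hsb : (d : ℝ) - b < s) (hsd : s < d) :
    Tendsto (fun R : ℝ => (∫ X, jelliumEnergy s X (cellUnion L R) c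
        ∂(localize P (cellUnion L R))) / volume.real (cellUnion L R)) atTop
      (𝓝 (1 / (2 * cellVolume L) * ((∫ p in wignerSeitz L ×ˢ Set.univ,
        riesz s (p.1 - p.2) * truncated ρ₁ ρ₂ p) + chargeEnergy L f s))) := by
  have hper : IsDiagPeriodic L fun p : Space d × Space d =>
      riesz s (p.1 - p.2) * truncated ρ₁ ρ₂ p := by
    intro z hz
    filter_upwards [h.truncated_periodic z hz] with p hp
    rw [hp]; simp
  have l1 := (tendsto_setIntegral_cellUnion_prod L hper
    (h.integrableOn_long hd hsb hsd (volume_wignerSeitz_ne_top L))).const_mul (1 / 2)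
  have l2 := (h.neutral.tendsto_riesz hd hm hs hsm hsd).const_mul (1 / 2)
  have e : ∀ R, (∫ X, jelliumEnergy s X (cellUnion L R) c
      ∂(localize P (cellUnion L R))) / volume.real (cellUnion L R) = _ := fun R => by
    rw [(h.jellium hd hρ₁ hρ₂ hsb hsd R).2, add_div, mul_div_assoc, mul_div_assoc]
  simp_rw [e]
  convert l1.add l2 using 2
  field_simp

end IsClustering

end Limits

/-! ### Differentiating integrals of powers; Mellin transforms of Gaussian means -/

section MellinTransform

/-- Bounds the derivative of the power uniformly over an interval of exponents by powers at three
exponents only, each of which will lie in the strip of integrability. -/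
theorem abs_log_mul_rpow_le {r σ x ε : ℝ} (hr : 0 < r) (hε : 0 < ε) (hx : |x - σ| ≤ ε) :
    |Real.log r| * r ^ (-x)
      ≤ (r ^ (-(σ - 2 * ε)) + 2 * r ^ (-σ) + r ^ (-(σ + 2 * ε))) / ε := by
  have h1 := Real.log_le_rpow_div hr.le hε
  have h2 := Real.log_le_rpow_div (inv_nonneg.2 hr.le) hε
  rw [Real.log_inv, Real.inv_rpow hr.le, ← Real.rpow_neg hr.le] at h2
  have p1 := Real.rpow_pos_of_pos hr ε
  have p2 := Real.rpow_pos_of_pos hr (-ε)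
  have hlog : |Real.log r| ≤ (r ^ ε + r ^ (-ε)) / ε := by
    have : 0 ≤ r ^ ε / ε := by positivity
    have : 0 ≤ r ^ (-ε) / ε := by positivity
    rw [add_div, abs_le]
    constructor <;> linarith
  have hx' := abs_le.1 hx
  have hpow : r ^ (-x) ≤ r ^ (-σ + ε) + r ^ (-σ + -ε) := by
    have q1 := Real.rpow_pos_of_pos hr (-σ + ε)
    have q2 := Real.rpow_pos_of_pos hr (-σ + -ε)
    rcases le_total 1 r with h | h
    · have := Real.rpow_le_rpow_of_exponent_le h (show -x ≤ -σ + ε by linarith)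
      linarith
    · have := Real.rpow_le_rpow_of_exponent_ge hr h (show -σ + -ε ≤ -x by linarith)
      linarith
  have p3 := Real.rpow_pos_of_pos hr (-x)
  refine (mul_le_mul hlog hpow p3.le (by positivity)).trans_eq ?_
  rw [show -(σ - 2 * ε) = -σ + ε + ε by ring, show -(σ + 2 * ε) = -σ + -ε + -ε by ring,
    Real.rpow_add hr (-σ + ε) ε, Real.rpow_add hr (-σ + -ε) (-ε), Real.rpow_add hr (-σ) ε,
    Real.rpow_add hr (-σ) (-ε)]
  have e : r ^ ε * r ^ (-ε) = 1 := by rw [← Real.rpow_add hr, add_neg_cancel, Real.rpow_zero]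
  field_simp
  linear_combination 2 * e

variable {α : Type*} [MeasurableSpace α] {μ : Measure α} {g r : α → ℝ}

theorem norm_ofReal_mul_cpow {x : ℝ} (hx : 0 < x) (y : ℝ) (s : ℂ) :
    ‖(y : ℂ) * (x : ℂ) ^ (-s)‖ = ‖y * x ^ (-s.re)‖ := by
  rw [norm_mul, norm_mul, Complex.norm_real, Complex.norm_cpow_eq_rpow_re_of_pos hx,
    Complex.neg_re, Real.norm_of_nonneg (Real.rpow_nonneg hx.le _)]

theorem integrable_mul_cpow (hg : AEStronglyMeasurable g μ) (hr : Measurable r)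
    (hpos : ∀ᵐ x ∂μ, 0 < r x) {s : ℂ} (hint : Integrable (fun x => g x * r x ^ (-s.re)) μ) :
    Integrable (fun x => (g x : ℂ) * (r x : ℂ) ^ (-s)) μ := by
  refine hint.congr' ((Complex.continuous_ofReal.comp_aestronglyMeasurable hg).mul
    (Measurable.aestronglyMeasurable (by fun_prop))) ?_
  filter_upwards [hpos] with x hx
  exact (norm_ofReal_mul_cpow hx _ _).symm

/-- Differentiation of a mixture of powers with respect to the exponent. -/
theorem hasDerivAt_integral_cpow (hg : AEStronglyMeasurable g μ) (hr : Measurable r)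
    (hpos : ∀ᵐ x ∂μ, 0 < r x) {A B : ℝ}
    (hint : ∀ σ ∈ Set.Ioo A B, Integrable (fun x => g x * r x ^ (-σ)) μ) {s : ℂ}
    (hs : s.re ∈ Set.Ioo A B) :
    HasDerivAt (fun s : ℂ => ∫ x, (g x : ℂ) * (r x : ℂ) ^ (-s) ∂μ)
      (∫ x, (g x : ℂ) * ((r x : ℂ) ^ (-s) * (Real.log (r x) : ℂ) * -1) ∂μ) s := by
  -- A third of the distance to the edge keeps the exponents `s.re ± 2ε` inside the strip.
  set ε := min ((s.re - A) / 3) ((B - s.re) / 3)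
  have hε : 0 < ε := lt_min (by linarith [hs.1]) (by linarith [hs.2])
  have hε1 : ε ≤ (s.re - A) / 3 := min_le_left _ _
  have hε2 : ε ≤ (B - s.re) / 3 := min_le_right _ _
  have hb : Integrable (fun x => |g x| * ((r x ^ (-(s.re - 2 * ε)) + 2 * r x ^ (-s.re)
      + r x ^ (-(s.re + 2 * ε))) / ε)) μ := by
    have i1 := (hint (s.re - 2 * ε) ⟨by linarith, by linarith⟩).abs
    have i2 := (hint s.re hs).abs
    have i3 := (hint (s.re + 2 * ε) ⟨by linarith, by linarith⟩).abs
    refine (((i1.add (i2.const_mul 2)).add i3).div_const ε).congr ?_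
    filter_upwards [hpos] with x hx
    simp only [Pi.add_apply, abs_mul, abs_of_nonneg (Real.rpow_nonneg hx.le _)]
    ring
  have hgm : AEStronglyMeasurable (fun x => (g x : ℂ)) μ :=
    Complex.continuous_ofReal.comp_aestronglyMeasurable hg
  refine (hasDerivAt_integral_of_dominated_loc_of_deriv_le (Metric.ball_mem_nhds s hε)
    (F' := fun z x => (g x : ℂ) * ((r x : ℂ) ^ (-z) * (Real.log (r x) : ℂ) * -1))
    (Eventually.of_forall fun z => hgm.mul (Measurable.aestronglyMeasurable (by fun_prop)))
    (integrable_mul_cpow hg hr hpos (hint _ hs))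
    (hgm.mul (Measurable.aestronglyMeasurable (by fun_prop))) ?_ hb ?_).2
  · filter_upwards [hpos] with x hx z hz
    rw [norm_mul, Complex.norm_real, Real.norm_eq_abs, norm_mul, norm_neg, norm_one, mul_one,
      norm_mul, Complex.norm_cpow_eq_rpow_re_of_pos hx, Complex.norm_real, Real.norm_eq_abs,
      mul_comm (r x ^ _)]
    refine mul_le_mul_of_nonneg_left (abs_log_mul_rpow_le hx hε ?_) (abs_nonneg _)
    have := Complex.abs_re_le_norm (z - s)
    rw [mem_ball_iff_norm] at hz
    exact this.trans hz.le
  · filter_upwards [hpos] with x hx z _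
    have h := ((hasDerivAt_id z).neg.const_cpow (c := (r x : ℂ))
      (Or.inl (Complex.ofReal_ne_zero.2 hx.ne'))).const_mul (g x : ℂ)
    rw [Complex.ofReal_log hx.le]
    exact h

/-- The Mellin transform of `F` at `s / 2`. -/
def mellinHalf (F : ℝ → ℝ) (s : ℂ) : ℂ :=
  ∫ t in Set.Ioi (0 : ℝ), (t : ℂ) ^ (s / 2 - 1) * (F t : ℂ)

theorem rpow_neg_half_cpow {t : ℝ} (ht : 0 < t) (s : ℂ) :
    ((t ^ (-(1 / 2) : ℝ) : ℝ) : ℂ) ^ (-s) = (t : ℂ) ^ (s / 2) := by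
  have h1 : ((t ^ (-(1 / 2) : ℝ) : ℝ) : ℂ) ≠ 0 :=
    Complex.ofReal_ne_zero.2 (Real.rpow_pos_of_pos ht _).ne'
  rw [Complex.cpow_def_of_ne_zero h1, Complex.cpow_def_of_ne_zero (Complex.ofReal_ne_zero.2 ht.ne'),
    ← Complex.ofReal_log (Real.rpow_nonneg ht.le _), Real.log_rpow ht, ← Complex.ofReal_log ht.le]
  congr 1
  push_cast; ring

/-- With `r = t ^ (-1/2)` the Mellin transform is an integral of `r ^ (-s)`, so the differentiation
lemma for Riesz means applies to it as well. -/
theorem mellinHalf_eq (F : ℝ → ℝ) (s : ℂ) :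
    mellinHalf F s = ∫ t in Set.Ioi (0 : ℝ), ((t⁻¹ * F t : ℝ) : ℂ)
      * ((t ^ (-(1 / 2) : ℝ) : ℝ) : ℂ) ^ (-s) := by
  refine setIntegral_congr_fun measurableSet_Ioi fun t ht => ?_
  have ht : 0 < t := ht
  rw [rpow_neg_half_cpow ht, Complex.cpow_sub _ _ (Complex.ofReal_ne_zero.2 ht.ne'),
    Complex.cpow_one]
  push_cast; ring

theorem differentiableAt_mellinHalf {F : ℝ → ℝ} (hF : Measurable F) {A B : ℝ}
    (hint : ∀ σ ∈ Set.Ioo A B, IntegrableOn (fun t : ℝ => t ^ (σ / 2 - 1) * F t) (Set.Ioi 0))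
    {s : ℂ} (hs : s.re ∈ Set.Ioo A B) : DifferentiableAt ℂ (mellinHalf F) s := by
  rw [show mellinHalf F = _ from funext (mellinHalf_eq F)]
  refine (hasDerivAt_integral_cpow (g := fun t => t⁻¹ * F t)
    (Measurable.aestronglyMeasurable (by fun_prop)) (by fun_prop) ?_ (A := A) (B := B)
    (fun σ hσ => ?_) hs).differentiableAt
  · filter_upwards [ae_restrict_mem measurableSet_Ioi] with t ht
    exact Real.rpow_pos_of_pos ht _
  · refine (hint σ hσ).congr ?_
    filter_upwards [ae_restrict_mem measurableSet_Ioi] with t ht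
    have ht : 0 < t := ht
    rw [← Real.rpow_mul ht.le, Real.rpow_sub_one ht.ne', show -(1 / 2) * -σ = σ / 2 by ring]
    field_simp

theorem integrableOn_mellinHalf {F : ℝ → ℝ} (hF : Measurable F) {s : ℂ}
    (hint : IntegrableOn (fun t : ℝ => t ^ (s.re / 2 - 1) * F t) (Set.Ioi 0)) :
    IntegrableOn (fun t : ℝ => (t : ℂ) ^ (s / 2 - 1) * (F t : ℂ)) (Set.Ioi 0) := by
  refine Integrable.congr' hint (Measurable.aestronglyMeasurable (by fun_prop)) ?_
  filter_upwards [ae_restrict_mem measurableSet_Ioi] with t ht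
  have ht : 0 < t := ht
  rw [norm_mul, norm_mul, Complex.norm_real, Complex.norm_cpow_eq_rpow_re_of_pos ht,
    Real.norm_of_nonneg (Real.rpow_nonneg ht.le _)]
  simp

/-- The Mellin transform of a mixture of Gaussians. -/
theorem mellinHalf_integral_exp [SFinite μ] (hg : Measurable g) (hr : Measurable r)
    (hpos : ∀ᵐ x ∂μ, 0 < r x) {s : ℂ} (hs : 0 < s.re)
    (hint : Integrable (fun x => g x * r x ^ (-s.re)) μ) :
    IntegrableOn (fun t : ℝ => t ^ (s.re / 2 - 1) * ∫ x, Real.exp (-(t * r x ^ 2)) * g x ∂μ)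
      (Set.Ioi 0) ∧
    mellinHalf (fun t => ∫ x, Real.exp (-(t * r x ^ 2)) * g x ∂μ) s
      = Complex.Gamma (s / 2) * ∫ x, (g x : ℂ) * (r x : ℂ) ^ (-s) ∂μ := by
  have hI : Integrable (fun q : α × ℝ =>
      q.2 ^ (s.re / 2 - 1) * (Real.exp (-(q.2 * r q.1 ^ 2)) * g q.1))
      (μ.prod (volume.restrict (Set.Ioi 0))) := by
    rw [integrable_prod_iff (Measurable.aestronglyMeasurable (by fun_prop))]
    have hone : ∀ x, 0 < r x → IntegrableOn (fun t : ℝ => t ^ (s.re / 2 - 1)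
        * Real.exp (-(t * r x ^ 2))) (Set.Ioi 0) := fun x hx => by
      have h := integrableOn_rpow_mul_exp_neg_mul_rpow (s := s.re / 2 - 1) (p := 1)
        (b := r x ^ 2) (by linarith) one_pos (by positivity)
      simp only [Real.rpow_one] at h
      refine h.congr_fun (fun t _ => ?_) measurableSet_Ioi
      simp only
      rw [neg_mul, mul_comm (r x ^ 2)]
    constructor
    · filter_upwards [hpos] with x hx
      refine ((hone x hx).mul_const (g x)).congr (Eventually.of_forall fun t => ?_)
      simp only; ring
    · refine (hint.norm.const_mul (Real.Gamma (s.re / 2))).congr ?_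
      filter_upwards [hpos] with x hx
      have e : ∫ t in Set.Ioi (0 : ℝ), ‖t ^ (s.re / 2 - 1) * (Real.exp (-(t * r x ^ 2)) * g x)‖
          = ∫ t in Set.Ioi (0 : ℝ), t ^ (s.re / 2 - 1) * Real.exp (-(r x ^ 2 * t)) * |g x| := by
        refine setIntegral_congr_fun measurableSet_Ioi fun t ht => ?_
        have ht : 0 < t := ht
        simp only [norm_mul, Real.norm_eq_abs]
        rw [abs_of_nonneg (by positivity : 0 ≤ t ^ (s.re / 2 - 1)),
          abs_of_pos (Real.exp_pos _), mul_comm t, mul_assoc]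
      rw [e, integral_mul_const, Real.integral_rpow_mul_exp_neg_mul_Ioi (by linarith)
        (by positivity), one_div, Real.inv_rpow (by positivity), ← Real.rpow_neg (by positivity),
        norm_mul, Real.norm_eq_abs, Real.norm_of_nonneg (by positivity), ← Real.rpow_natCast,
        ← Real.rpow_mul hx.le, show ((2 : ℕ) : ℝ) * -(s.re / 2) = -s.re by push_cast; ring]
      ring
  have hIc : Integrable (fun q : α × ℝ =>
      (q.2 : ℂ) ^ (s / 2 - 1) * ((Real.exp (-(q.2 * r q.1 ^ 2)) * g q.1 : ℝ) : ℂ))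
      (μ.prod (volume.restrict (Set.Ioi 0))) := by
    refine hI.congr' (Measurable.aestronglyMeasurable (by fun_prop)) ?_
    have ht : ∀ᵐ q ∂(μ.prod (volume.restrict (Set.Ioi (0 : ℝ)))), 0 < q.2 :=
      Measure.quasiMeasurePreserving_snd.ae (ae_restrict_mem measurableSet_Ioi)
    filter_upwards [ht] with q hq
    rw [norm_mul, Real.norm_of_nonneg (Real.rpow_nonneg hq.le _), norm_mul (_ ^ _ : ℂ),
      Complex.norm_cpow_eq_rpow_re_of_pos hq, Complex.norm_real]
    simp
  constructor
  · refine hI.integral_prod_right.congr (Eventually.of_forall fun t => ?_)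
    simp only
    rw [integral_const_mul]
  · rw [mellinHalf, ← integral_const_mul]
    have e : ∀ t : ℝ, (t : ℂ) ^ (s / 2 - 1) * ((∫ x, Real.exp (-(t * r x ^ 2)) * g x ∂μ : ℝ) : ℂ)
        = ∫ x, (t : ℂ) ^ (s / 2 - 1) * ((Real.exp (-(t * r x ^ 2)) * g x : ℝ) : ℂ) ∂μ :=
      fun t => by rw [integral_const_mul, integral_complex_ofReal]
    simp_rw [e]
    rw [← integral_integral_swap hIc]
    refine integral_congr_ae ?_
    filter_upwards [hpos] with x hx
    have h := Complex.integral_cpow_mul_exp_neg_mul_Ioi (a := s / 2) (r := r x ^ 2)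
      (by simpa using hs) (by positivity)
    have e2 : ∀ t : ℝ, (t : ℂ) ^ (s / 2 - 1) * ((Real.exp (-(t * r x ^ 2)) * g x : ℝ) : ℂ)
        = (t : ℂ) ^ (s / 2 - 1) * Complex.exp (-(((r x ^ 2 : ℝ) : ℂ) * t)) * g x := fun t => by
      push_cast
      rw [mul_comm (t : ℂ) ((r x : ℂ) ^ 2)]; ring
    simp_rw [e2]
    rw [integral_mul_const, h]
    have e3 : (1 / ((r x ^ 2 : ℝ) : ℂ)) ^ (s / 2) = (r x : ℂ) ^ (-s) := by
      have hu : ((r x ^ 2)⁻¹ : ℝ) ^ (-(1 / 2) : ℝ) = r x := by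
        rw [← Real.rpow_natCast, ← Real.rpow_neg hx.le, ← Real.rpow_mul hx.le]
        norm_num
      have h2 := rpow_neg_half_cpow (t := (r x ^ 2)⁻¹) (by positivity) s
      rw [hu] at h2
      rw [h2, one_div, Complex.ofReal_inv]
    rw [e3]; ring

end MellinTransform

/-! ### Continuation of a Mellin transform across a pole -/

section MellinContinuation

variable {N G : ℝ → ℝ}

theorem integrableOn_Ioc_mellin_mono {F : ℝ → ℝ} (hF : Measurable F) {σ τ : ℝ} (h : σ ≤ τ)
    (hi : IntegrableOn (fun t : ℝ => t ^ (σ / 2 - 1) * F t) (Set.Ioi 0)) :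
    IntegrableOn (fun t : ℝ => t ^ (τ / 2 - 1) * F t) (Set.Ioc 0 1) := by
  refine Integrable.mono (hi.mono_set Set.Ioc_subset_Ioi_self)
    (Measurable.aestronglyMeasurable (by fun_prop)) ?_
  filter_upwards [ae_restrict_mem measurableSet_Ioc] with t ht
  rw [norm_mul, norm_mul]
  refine mul_le_mul_of_nonneg_right ?_ (norm_nonneg _)
  rw [Real.norm_of_nonneg (Real.rpow_nonneg ht.1.le _),
    Real.norm_of_nonneg (Real.rpow_nonneg ht.1.le _)]
  exact Real.rpow_le_rpow_of_exponent_ge ht.1 ht.2 (by linarith)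

theorem integrableOn_Ioi_mellin_mono {F : ℝ → ℝ} (hF : Measurable F) {σ τ : ℝ} (h : τ ≤ σ)
    (hi : IntegrableOn (fun t : ℝ => t ^ (σ / 2 - 1) * F t) (Set.Ioi 0)) :
    IntegrableOn (fun t : ℝ => t ^ (τ / 2 - 1) * F t) (Set.Ioi 1) := by
  refine Integrable.mono (hi.mono_set (Set.Ioi_subset_Ioi zero_le_one))
    (Measurable.aestronglyMeasurable (by fun_prop)) ?_
  filter_upwards [ae_restrict_mem measurableSet_Ioi] with t ht
  have ht : 1 < t := ht
  have ht0 : 0 ≤ t := by linarith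
  rw [norm_mul, norm_mul]
  refine mul_le_mul_of_nonneg_right ?_ (norm_nonneg _)
  rw [Real.norm_of_nonneg (Real.rpow_nonneg ht0 _), Real.norm_of_nonneg (Real.rpow_nonneg ht0 _)]
  exact Real.rpow_le_rpow_of_exponent_le ht.le (by linarith)

/-- `N` on `(0, 1]` and `G` on `(1, ∞)`. -/
def glue (N G : ℝ → ℝ) (t : ℝ) : ℝ := if t ≤ 1 then N t else G t

theorem measurable_glue (hN : Measurable N) (hG : Measurable G) : Measurable (glue N G) :=
  Measurable.ite measurableSet_Iic hN hG

theorem integrableOn_mellin_glue (hNm : Measurable N) (hGm : Measurable G) {σ σ₀ σ₁ : ℝ}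
    (h0 : σ₀ ≤ σ) (h1 : σ ≤ σ₁)
    (hN : IntegrableOn (fun t : ℝ => t ^ (σ₀ / 2 - 1) * N t) (Set.Ioi 0))
    (hG : IntegrableOn (fun t : ℝ => t ^ (σ₁ / 2 - 1) * G t) (Set.Ioi 0)) :
    IntegrableOn (fun t : ℝ => t ^ (σ / 2 - 1) * glue N G t) (Set.Ioi 0) := by
  rw [← Set.Ioc_union_Ioi_eq_Ioi zero_le_one]
  refine IntegrableOn.union ?_ ?_
  · refine (integrableOn_Ioc_mellin_mono hNm h0 hN).congr_fun (fun t ht => ?_) measurableSet_Ioc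
    simp only [glue, if_pos ht.2]
  · refine (integrableOn_Ioi_mellin_mono hGm h1 hG).congr_fun (fun t ht => ?_) measurableSet_Ioi
    simp only [glue, if_neg (not_le.2 (Set.mem_Ioi.1 ht))]

theorem mellinHalf_eq_add {F : ℝ → ℝ} {s : ℂ}
    (hF : IntegrableOn (fun t : ℝ => (t : ℂ) ^ (s / 2 - 1) * (F t : ℂ)) (Set.Ioi 0)) :
    mellinHalf F s = (∫ t in Set.Ioc (0 : ℝ) 1, (t : ℂ) ^ (s / 2 - 1) * (F t : ℂ))
      + ∫ t in Set.Ioi (1 : ℝ), (t : ℂ) ^ (s / 2 - 1) * (F t : ℂ) := by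
  rw [mellinHalf, ← Set.Ioc_union_Ioi_eq_Ioi zero_le_one, setIntegral_union
    (Set.Ioc_disjoint_Ioi le_rfl) measurableSet_Ioi (hF.mono_set Set.Ioc_subset_Ioi_self)
    (hF.mono_set (Set.Ioi_subset_Ioi zero_le_one))]

theorem cpow_mul_ofReal_rpow {t : ℝ} (ht : 0 < t) (K δ : ℝ) (s : ℂ) :
    (t : ℂ) ^ (s / 2 - 1) * ((K * t ^ (-(δ / 2)) : ℝ) : ℂ) = K * (t : ℂ) ^ ((s - δ) / 2 - 1) := by
  rw [Complex.ofReal_mul, Complex.ofReal_cpow ht.le, mul_left_comm,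
    ← Complex.cpow_add _ _ (Complex.ofReal_ne_zero.2 ht.ne')]
  congr 2
  push_cast; ring

theorem integral_Ioc_cpow {z : ℂ} (hz : 0 < z.re) :
    IntegrableOn (fun t : ℝ => (t : ℂ) ^ (z / 2 - 1)) (Set.Ioc 0 1) ∧
    ∫ t in Set.Ioc (0 : ℝ) 1, (t : ℂ) ^ (z / 2 - 1) = 2 / z := by
  have hz0 : z ≠ 0 := fun h => by simp [h] at hz
  have hre : -1 < (z / 2 - 1).re := by simp; linarith
  constructor
  · rw [← intervalIntegrable_iff_integrableOn_Ioc_of_le zero_le_one]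
    exact intervalIntegral.intervalIntegrable_cpow' hre
  · rw [← intervalIntegral.integral_of_le zero_le_one, integral_cpow (Or.inl hre)]
    have h2 : z / 2 - 1 + 1 = z / 2 := by ring
    have h3 : z / 2 ≠ 0 := by simpa using hz0
    rw [h2, Complex.ofReal_one, Complex.ofReal_zero, Complex.one_cpow, Complex.zero_cpow h3]
    field_simp; ring

theorem integral_Ioi_one_cpow {z : ℂ} (hz : z.re < 0) :
    IntegrableOn (fun t : ℝ => (t : ℂ) ^ (z / 2 - 1)) (Set.Ioi 1) ∧
    ∫ t in Set.Ioi (1 : ℝ), (t : ℂ) ^ (z / 2 - 1) = -(2 / z) := by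
  have hz0 : z ≠ 0 := fun h => by simp [h] at hz
  have hre : (z / 2 - 1).re < -1 := by simp; linarith
  refine ⟨integrableOn_Ioi_cpow_of_lt hre one_pos, ?_⟩
  rw [integral_Ioi_cpow_of_lt hre one_pos]
  have h2 : z / 2 - 1 + 1 = z / 2 := by ring
  rw [h2, Complex.ofReal_one, Complex.one_cpow]
  field_simp

variable {K β δ : ℝ}

/-- Convergence at `0` comes from `N` at an exponent below `σ`, convergence at infinity from `G` at
an exponent above `σ`; so the glued function has no upper limit on its strip. -/
theorem integrableOn_mellin_glue_of_lt
    (hNm : Measurable N) (hGm : Measurable G) (hβ : β < δ)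
    (hN : ∀ σ ∈ Set.Ioo β δ, IntegrableOn (fun t : ℝ => t ^ (σ / 2 - 1) * N t) (Set.Ioi 0))
    (hG : ∀ σ, δ < σ → IntegrableOn (fun t : ℝ => t ^ (σ / 2 - 1) * G t) (Set.Ioi 0))
    {σ : ℝ} (hσ : β < σ) :
    IntegrableOn (fun t : ℝ => t ^ (σ / 2 - 1) * glue N G t) (Set.Ioi 0) := by
  obtain ⟨σ₀, h1, h2⟩ := exists_between (lt_min hσ hβ)
  refine integrableOn_mellin_glue hNm hGm (h2.le.trans (min_le_left _ _))
    (σ₁ := max σ δ + 1) (by linarith [le_max_left σ δ])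
    (hN σ₀ ⟨h1, h2.trans_le (min_le_right _ _)⟩) (hG _ (by linarith [le_max_right σ δ]))

theorem differentiableAt_mellinHalf_glue
    (hNm : Measurable N) (hGm : Measurable G) (hβ : β < δ)
    (hN : ∀ σ ∈ Set.Ioo β δ, IntegrableOn (fun t : ℝ => t ^ (σ / 2 - 1) * N t) (Set.Ioi 0))
    (hG : ∀ σ, δ < σ → IntegrableOn (fun t : ℝ => t ^ (σ / 2 - 1) * G t) (Set.Ioi 0))
    {s : ℂ} (hs : β < s.re) :
    DifferentiableAt ℂ (mellinHalf (glue N G)) s :=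
  differentiableAt_mellinHalf (measurable_glue hNm hGm) (A := β) (B := s.re + 1)
    (fun _ hσ => integrableOn_mellin_glue_of_lt hNm hGm hβ hN hG hσ.1) ⟨hs, by linarith⟩

/-- On `(1, ∞)`, `N` is `G` minus the power, whose integral there converges for `Re s < δ` and
contributes `2K/(s - δ)`. -/
theorem mellinHalf_eq_glue_of_lt
    (hNm : Measurable N) (hGm : Measurable G) (hβ : β < δ)
    (hGN : ∀ t, 0 < t → G t = N t + K * t ^ (-(δ / 2)))
    (hN : ∀ σ ∈ Set.Ioo β δ, IntegrableOn (fun t : ℝ => t ^ (σ / 2 - 1) * N t) (Set.Ioi 0))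
    (hG : ∀ σ, δ < σ → IntegrableOn (fun t : ℝ => t ^ (σ / 2 - 1) * G t) (Set.Ioi 0))
    {s : ℂ} (hs : β < s.re) (hsδ : s.re < δ) :
    mellinHalf N s = mellinHalf (glue N G) s + K * (2 / (s - δ)) := by
  have i1 := integrableOn_mellinHalf hNm (hN s.re ⟨hs, hsδ⟩)
  have i2 := integrableOn_mellinHalf (measurable_glue hNm hGm)
    (integrableOn_mellin_glue_of_lt hNm hGm hβ hN hG hs)
  obtain ⟨j1, j2⟩ := integral_Ioi_one_cpow (z := s - δ) (by simpa using hsδ)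
  rw [mellinHalf_eq_add i1, mellinHalf_eq_add i2, add_assoc]
  congr 1
  · refine setIntegral_congr_fun measurableSet_Ioc fun t ht => ?_
    simp only [glue, if_pos ht.2]
  · have h := integral_sub (i2.mono_set (Set.Ioi_subset_Ioi zero_le_one)) (j1.const_mul (K : ℂ))
    rw [integral_const_mul, j2] at h
    rw [mul_neg, sub_neg_eq_add] at h
    rw [← h]
    refine setIntegral_congr_fun measurableSet_Ioi fun t ht => ?_
    have ht' : 1 < t := ht
    have ht0 : 0 < t := by linarith
    simp only [glue, if_neg (not_le.2 ht')]
    rw [← cpow_mul_ofReal_rpow ht0, hGN t ht0]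
    push_cast; ring

/-- On `(0, 1]`, `G` is `N` plus the power, whose integral there converges for `Re s > δ` and
contributes the same rational function. -/
theorem mellinHalf_eq_glue_of_gt
    (hNm : Measurable N) (hGm : Measurable G) (hβ : β < δ)
    (hGN : ∀ t, 0 < t → G t = N t + K * t ^ (-(δ / 2)))
    (hN : ∀ σ ∈ Set.Ioo β δ, IntegrableOn (fun t : ℝ => t ^ (σ / 2 - 1) * N t) (Set.Ioi 0))
    (hG : ∀ σ, δ < σ → IntegrableOn (fun t : ℝ => t ^ (σ / 2 - 1) * G t) (Set.Ioi 0))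
    {s : ℂ} (hsδ : δ < s.re) :
    mellinHalf G s = mellinHalf (glue N G) s + K * (2 / (s - δ)) := by
  have i1 := integrableOn_mellinHalf hGm (hG s.re hsδ)
  have i2 := integrableOn_mellinHalf (measurable_glue hNm hGm)
    (integrableOn_mellin_glue_of_lt hNm hGm hβ hN hG (hβ.trans hsδ))
  obtain ⟨j1, j2⟩ := integral_Ioc_cpow (z := s - δ) (by simpa using hsδ)
  rw [mellinHalf_eq_add i1, mellinHalf_eq_add i2, add_right_comm]
  congr 1
  · have h := integral_add (i2.mono_set Set.Ioc_subset_Ioi_self) (j1.const_mul (K : ℂ))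
    rw [integral_const_mul, j2] at h
    rw [← h]
    refine setIntegral_congr_fun measurableSet_Ioc fun t ht => ?_
    simp only [glue, if_pos ht.2]
    rw [← cpow_mul_ofReal_rpow ht.1, hGN t ht.1]
    push_cast; ring
  · refine setIntegral_congr_fun measurableSet_Ioi fun t ht => ?_
    simp only [glue, if_neg (not_le.2 (Set.mem_Ioi.1 ht))]

theorem mellinHalf_add {F F' : ℝ → ℝ} {s : ℂ}
    (hF : IntegrableOn (fun t : ℝ => (t : ℂ) ^ (s / 2 - 1) * (F t : ℂ)) (Set.Ioi 0))
    (hF' : IntegrableOn (fun t : ℝ => (t : ℂ) ^ (s / 2 - 1) * (F' t : ℂ)) (Set.Ioi 0)) :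
    mellinHalf (fun t => F t + F' t) s = mellinHalf F s + mellinHalf F' s := by
  rw [mellinHalf, mellinHalf, mellinHalf, ← integral_add hF hF']
  refine integral_congr_ae (Eventually.of_forall fun t => ?_)
  simp only; push_cast; ring

theorem mellinHalf_ofReal (F : ℝ → ℝ) (s : ℝ) :
    mellinHalf F s = ((∫ t in Set.Ioi (0 : ℝ), t ^ (s / 2 - 1) * F t : ℝ) : ℂ) := by
  rw [mellinHalf, ← integral_complex_ofReal]
  refine setIntegral_congr_fun measurableSet_Ioi fun t ht => ?_
  have ht : 0 < t := ht
  simp only [Complex.ofReal_mul, Complex.ofReal_cpow ht.le]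
  push_cast; rfl

end MellinContinuation

/-! ### Analytic continuation of the short-range formula -/

section Continuation

variable {d : ℕ} {L : Submodule ℤ (Space d)} {f ρ₁ : Space d → ℝ}
  {ρ₂ : Space d × Space d → ℝ} {a b C c : ℝ}

/-- The mean of a Gaussian of the distance against the pair function `g`. -/
def gaussMean (L : Submodule ℤ (Space d)) (g : Space d × Space d → ℝ) (t : ℝ) : ℝ :=
  ∫ p in wignerSeitz L ×ˢ Set.univ, Real.exp (-(t * ‖p.1 - p.2‖ ^ 2)) * g p

theorem measurable_gaussMean {g : Space d × Space d → ℝ} (hg : Measurable g) :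
    Measurable (gaussMean L g) := by
  have h : Measurable fun q : (Space d × Space d) × ℝ =>
    Real.exp (-(q.2 * ‖q.1.1 - q.1.2‖ ^ 2)) * g q.1 := by fun_prop
  exact (h.stronglyMeasurable.integral_prod_left'
    (μ := (volume : Measure (Space d × Space d)).restrict (wignerSeitz L ×ˢ Set.univ))).measurable

/-- `∬_{Q × ℝᵈ} g(x,y) |x-y|^{-s} dx dy`. -/
def rieszMean (L : Submodule ℤ (Space d)) (g : Space d × Space d → ℝ) (s : ℂ) : ℂ :=
  ∫ p in wignerSeitz L ×ˢ Set.univ, (g p : ℂ) * ((‖p.1 - p.2‖ : ℝ) : ℂ) ^ (-s)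

theorem ae_norm_sub_pos (hd : 1 ≤ d) (A : Set (Space d × Space d)) :
    ∀ᵐ p ∂((volume : Measure (Space d × Space d)).restrict A), 0 < ‖p.1 - p.2‖ := by
  refine ae_restrict_of_ae ?_
  filter_upwards [ae_prod_of_ae_sub (ae_ne_zero hd)] with p hp
  exact norm_pos_iff.2 hp

theorem mellinHalf_gaussMean (hd : 1 ≤ d) {g : Space d × Space d → ℝ} (hg : Measurable g) {s : ℂ}
    (hs : 0 < s.re)
    (hint : IntegrableOn (fun p : Space d × Space d => g p * ‖p.1 - p.2‖ ^ (-s.re))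
      (wignerSeitz L ×ˢ Set.univ)) :
    IntegrableOn (fun t : ℝ => t ^ (s.re / 2 - 1) * gaussMean L g t) (Set.Ioi 0) ∧
      mellinHalf (gaussMean L g) s = Complex.Gamma (s / 2) * rieszMean L g s :=
  mellinHalf_integral_exp hg (by fun_prop) (ae_norm_sub_pos hd _) hs hint

variable [DiscreteTopology L] [IsZLattice ℝ L]

/-- With the difference as a new variable, the inner integral of `f` runs over a translate of the
cell, where the total charge still vanishes. -/
theorem IsNeutral.integral_conv_snd (hf : IsNeutral L f) {φ : Space d → ℝ} (hφ : Integrable φ) :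
    ∫ p in wignerSeitz L ×ˢ Set.univ, φ (p.1 - p.2) * f p.2 = 0 := by
  obtain ⟨K, hK⟩ := hf.bounded
  have hfm := hf.measurable
  have := isFiniteMeasure_restrict_wignerSeitz L
  have h := integral_shear (A := wignerSeitz L)
    (fun p : Space d × Space d => φ p.2 * f (p.1 - p.2))
  simp only [sub_sub_cancel] at h
  rw [h, Measure.volume_eq_prod, ← Measure.prod_restrict, Measure.restrict_univ, integral_prod_symm]
  · simp only [integral_const_mul, sub_eq_add_neg]
    simp_rw [setIntegral_wignerSeitz_add hf.periodic, hf.integral_eq_zero, mul_zero, integral_zero]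
  · exact (hφ.comp_snd (volume.restrict (wignerSeitz L))).mul_bdd (c := K)
      (by fun_prop : Measurable fun p : Space d × Space d => f (p.1 - p.2)).aestronglyMeasurable
      (Eventually.of_forall fun p => hK _)

namespace IsClustering

theorem integrableOn_truncated_rpow (hd : 1 ≤ d) (h : IsClustering L f c ρ₁ ρ₂ a b C) {σ : ℝ}
    (h1 : (d : ℝ) - b < σ) (h2 : σ < d) :
    IntegrableOn (fun p : Space d × Space d => truncated ρ₁ ρ₂ p * ‖p.1 - p.2‖ ^ (-σ))
      (wignerSeitz L ×ˢ Set.univ) := by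
  have hm := h.measurable_truncated
  refine Integrable.mono' (integrableOn_conv (𝕜 := ℝ) (volume_wignerSeitz_ne_top L)
    ((integrable_rpow_div_one_add hd h1 h2).const_mul C))
    (Measurable.aestronglyMeasurable (by fun_prop)) (ae_restrict_of_ae ?_)
  filter_upwards [h.clustering] with p hp
  rw [norm_mul, Real.norm_eq_abs, Real.norm_of_nonneg (Real.rpow_nonneg (norm_nonneg _) _)]
  refine (mul_le_mul_of_nonneg_right hp (by positivity)).trans_eq (by ring)

theorem integrableOn_gauss_truncated (h : IsClustering L f c ρ₁ ρ₂ a b C) {t : ℝ} (ht : 0 < t) :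
    IntegrableOn (fun p : Space d × Space d =>
      Real.exp (-(t * ‖p.1 - p.2‖ ^ 2)) * truncated ρ₁ ρ₂ p) (wignerSeitz L ×ˢ Set.univ) := by
  have hg : IntegrableOn (fun p : Space d × Space d => Real.exp (-(t * ‖p.1 - p.2‖ ^ 2)))
      (wignerSeitz L ×ˢ Set.univ) :=
    integrableOn_conv (𝕜 := ℝ) (volume_wignerSeitz_ne_top L) (integrable_gaussian ht)
  refine hg.mul_bdd (c := C) h.measurable_truncated.aestronglyMeasurable (ae_restrict_of_ae ?_)
  filter_upwards [h.clustering] with p hp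
  refine hp.trans (div_le_self h.C_pos.le ?_)
  linarith [Real.rpow_nonneg (norm_nonneg (p.1 - p.2)) b]

/-- The decomposition of the Gaussian mean of the two-point function. -/
theorem gaussMean_two (h : IsClustering L f c ρ₁ ρ₂ a b C) {t : ℝ} (ht : 0 < t) :
    gaussMean L ρ₂ t = gaussMean L (truncated ρ₁ ρ₂) t + gaussEnergy L f t
      + c ^ 2 * cellVolume L * Real.pi ^ ((d : ℝ) / 2) * t ^ (-((d : ℝ) / 2)) := by
  obtain ⟨K, hK⟩ := h.neutral.bounded
  have hfm := h.neutral.measurable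
  have hφ := integrable_gaussian (d := d) ht
  have hg : IntegrableOn (fun p : Space d × Space d => Real.exp (-(t * ‖p.1 - p.2‖ ^ 2)))
      (wignerSeitz L ×ˢ Set.univ) :=
    integrableOn_conv (𝕜 := ℝ) (volume_wignerSeitz_ne_top L) hφ
  have iT := h.integrableOn_gauss_truncated ht
  have iH := integrableOn_gaussPair h.neutral (volume_wignerSeitz_ne_top L) ht
  have i1 : IntegrableOn (fun p : Space d × Space d =>
      Real.exp (-(t * ‖p.1 - p.2‖ ^ 2)) * f p.1) (wignerSeitz L ×ˢ Set.univ) :=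
    hg.mul_bdd (c := K) (hfm.comp measurable_fst).aestronglyMeasurable
      (Eventually.of_forall fun p => hK _)
  have i2 : IntegrableOn (fun p : Space d × Space d =>
      Real.exp (-(t * ‖p.1 - p.2‖ ^ 2)) * f p.2) (wignerSeitz L ×ˢ Set.univ) :=
    hg.mul_bdd (c := K) (hfm.comp measurable_snd).aestronglyMeasurable
      (Eventually.of_forall fun p => hK _)
  have z1 : ∫ p in wignerSeitz L ×ˢ Set.univ,
      Real.exp (-(t * ‖p.1 - p.2‖ ^ 2)) * f p.1 = 0 := by
    have := integral_mul_conv (A := wignerSeitz L) f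
      (fun x : Space d => Real.exp (-(t * ‖x‖ ^ 2)))
    rw [h.neutral.integral_eq_zero, zero_mul] at this
    simpa only [mul_comm] using this
  have z2 := h.neutral.integral_conv_snd hφ
  have z3 : ∫ p in wignerSeitz L ×ˢ Set.univ, Real.exp (-(t * ‖p.1 - p.2‖ ^ 2))
      = cellVolume L * (Real.pi / t) ^ ((d : ℝ) / 2) := by
    have := integral_mul_conv (A := wignerSeitz L) (fun _ => (1 : ℝ))
      (fun x : Space d => Real.exp (-(t * ‖x‖ ^ 2)))
    rw [integral_gaussian_space ht, integral_const, measureReal_restrict_apply_univ,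
      smul_eq_mul, mul_one] at this
    simpa only [one_mul, cellVolume] using this
  have e : (fun p : Space d × Space d => Real.exp (-(t * ‖p.1 - p.2‖ ^ 2)) * ρ₂ p)
      =ᵐ[volume.restrict (wignerSeitz L ×ˢ Set.univ)] fun p =>
      Real.exp (-(t * ‖p.1 - p.2‖ ^ 2)) * truncated ρ₁ ρ₂ p + (gaussPair f t p
        + (c * (Real.exp (-(t * ‖p.1 - p.2‖ ^ 2)) * f p.1)
        + (c * (Real.exp (-(t * ‖p.1 - p.2‖ ^ 2)) * f p.2)
        + c ^ 2 * Real.exp (-(t * ‖p.1 - p.2‖ ^ 2))))) := by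
    refine ae_restrict_of_ae ?_
    filter_upwards [Measure.quasiMeasurePreserving_fst.ae h.one,
      Measure.quasiMeasurePreserving_snd.ae h.one] with p h1 h2
    rw [truncated, gaussPair, h1, h2]; ring
  have k1 : IntegrableOn (fun p : Space d × Space d =>
      c * (Real.exp (-(t * ‖p.1 - p.2‖ ^ 2)) * f p.2)
        + c ^ 2 * Real.exp (-(t * ‖p.1 - p.2‖ ^ 2))) (wignerSeitz L ×ˢ Set.univ) :=
    (i2.const_mul c).add (hg.const_mul (c ^ 2))
  have k2 : IntegrableOn (fun p : Space d × Space d =>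
      c * (Real.exp (-(t * ‖p.1 - p.2‖ ^ 2)) * f p.1)
      + (c * (Real.exp (-(t * ‖p.1 - p.2‖ ^ 2)) * f p.2)
        + c ^ 2 * Real.exp (-(t * ‖p.1 - p.2‖ ^ 2)))) (wignerSeitz L ×ˢ Set.univ) :=
    (i1.const_mul c).add k1
  have k3 : IntegrableOn (fun p : Space d × Space d => gaussPair f t p
      + (c * (Real.exp (-(t * ‖p.1 - p.2‖ ^ 2)) * f p.1)
      + (c * (Real.exp (-(t * ‖p.1 - p.2‖ ^ 2)) * f p.2)
        + c ^ 2 * Real.exp (-(t * ‖p.1 - p.2‖ ^ 2))))) (wignerSeitz L ×ˢ Set.univ) := iH.add k2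
  rw [gaussMean, integral_congr_ae e, integral_add iT k3, integral_add iH k2,
    integral_add (i1.const_mul c) k1, integral_add (i2.const_mul c) (hg.const_mul (c ^ 2)),
    integral_const_mul, integral_const_mul, integral_const_mul, z1, z2, z3, gaussMean, gaussEnergy,
    Real.div_rpow Real.pi_pos.le ht.le, Real.rpow_neg ht.le]
  ring

variable {m : ℕ}

/-- The long-range formula for complex exponents. -/
def longRangeMean (L : Submodule ℤ (Space d)) (f ρ₁ : Space d → ℝ)
    (ρ₂ : Space d × Space d → ℝ) (s : ℂ) : ℂ :=
  rieszMean L (truncated ρ₁ ρ₂) s + (Complex.Gamma (s / 2))⁻¹ * mellinHalf (gaussEnergy L f) s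

/-- The continuation of the short-range formula. -/
def continuedMean (L : Submodule ℤ (Space d)) (f ρ₁ : Space d → ℝ)
    (ρ₂ : Space d × Space d → ℝ) (c : ℝ) (s : ℂ) : ℂ :=
  (Complex.Gamma (s / 2))⁻¹ * (mellinHalf (glue (fun t => gaussMean L (truncated ρ₁ ρ₂) t
      + gaussEnergy L f t) (gaussMean L ρ₂)) s
    + ((c ^ 2 * cellVolume L * Real.pi ^ ((d : ℝ) / 2) : ℝ) : ℂ) * (2 / (s - (d : ℝ))))

theorem measurable_gaussEnergy (hf : Measurable f) : Measurable (gaussEnergy L f) :=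
  (measurable_integral_gaussPair hf _).measurable

/-- The extra lower bound `0` comes only from the truncated part, whose Mellin transform is taken
Gaussian by Gaussian and needs `Re s > 0`. -/
theorem integrableOn_mellin_neutral (hd : 1 ≤ d) (h : IsClustering L f c ρ₁ ρ₂ a b C)
    (hm : HasMultipoleOrder L f m) {σ : ℝ}
    (hσ : σ ∈ Set.Ioo (max 0 (max ((d : ℝ) - m) (d - b))) (d : ℝ)) :
    IntegrableOn (fun t : ℝ => t ^ (σ / 2 - 1) * gaussMean L (truncated ρ₁ ρ₂) t) (Set.Ioi 0) ∧
    IntegrableOn (fun t : ℝ => t ^ (σ / 2 - 1) * gaussEnergy L f t) (Set.Ioi 0) := by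
  obtain ⟨h1, h2⟩ := hσ
  simp only [max_lt_iff] at h1
  refine ⟨?_, h.neutral.integrableOn_mellin_gaussEnergy hm h1.2.1 h2⟩
  have := (mellinHalf_gaussMean (L := L) hd h.measurable_truncated (s := (σ : ℂ))
    (by simpa using h1.1) (h.integrableOn_truncated_rpow hd
      (by simpa using h1.2.2) (by simpa using h2))).1
  simpa using this

theorem integrableOn_mellin_two (hd : 1 ≤ d) (h : IsClustering L f c ρ₁ ρ₂ a b C) {σ : ℝ}
    (hσ : (d : ℝ) < σ) :
    IntegrableOn (fun t : ℝ => t ^ (σ / 2 - 1) * gaussMean L ρ₂ t) (Set.Ioi 0) := by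
  have hd0 : (0 : ℝ) ≤ d := d.cast_nonneg
  have := (mellinHalf_gaussMean (L := L) hd h.measurable_two (s := (σ : ℂ))
    (by simp only [Complex.ofReal_re]; linarith) (h.integrableOn_short hd
      (by simpa using hσ) (volume_wignerSeitz_ne_top L))).1
  simpa using this

theorem lower_lt (hd : 1 ≤ d) (h : IsClustering L f c ρ₁ ρ₂ a b C)
    (hm : HasMultipoleOrder L f m) : max 0 (max ((d : ℝ) - m) (d - b)) < d := by
  have hd' : (1 : ℝ) ≤ d := by exact_mod_cast hd
  have hm' : (0 : ℝ) < m := by rcases hm with rfl | ⟨rfl, _⟩ <;> norm_num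
  have := h.b_pos
  simp only [max_lt_iff]
  refine ⟨?_, ?_, ?_⟩ <;> linarith

theorem measurable_neutral (h : IsClustering L f c ρ₁ ρ₂ a b C) :
    Measurable fun t => gaussMean L (truncated ρ₁ ρ₂) t + gaussEnergy L f t :=
  (measurable_gaussMean h.measurable_truncated).add (measurable_gaussEnergy h.neutral.measurable)

theorem gamma_half_ne_zero {s : ℂ} (hs : 0 < s.re) : Complex.Gamma (s / 2) ≠ 0 :=
  Complex.Gamma_ne_zero_of_re_pos (by simpa using hs)

theorem integrableOn_mellin_neutral_add (hd : 1 ≤ d) (h : IsClustering L f c ρ₁ ρ₂ a b C)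
    (hm : HasMultipoleOrder L f m) : ∀ σ ∈ Set.Ioo (max 0 (max ((d : ℝ) - m) (d - b))) (d : ℝ),
    IntegrableOn (fun t : ℝ => t ^ (σ / 2 - 1) *
      (gaussMean L (truncated ρ₁ ρ₂) t + gaussEnergy L f t)) (Set.Ioi 0) := fun σ hσ => by
  obtain ⟨i1, i2⟩ := h.integrableOn_mellin_neutral hd hm hσ
  simp_rw [mul_add]
  exact i1.add i2

/-- In this strip the Mellin transform of the neutral part is `Γ(s/2)` times the long-range formula,
and it agrees with the glued function plus its pole. -/
theorem longRangeMean_eq (hd : 1 ≤ d) (h : IsClustering L f c ρ₁ ρ₂ a b C)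
    (hm : HasMultipoleOrder L f m) {s : ℂ}
    (hs : max 0 (max ((d : ℝ) - m) (d - b)) < s.re) (hsd : s.re < d) :
    longRangeMean L f ρ₁ ρ₂ s = continuedMean L f ρ₁ ρ₂ c s := by
  have hs' := hs
  simp only [max_lt_iff] at hs'
  obtain ⟨i1, i2⟩ := h.integrableOn_mellin_neutral hd hm ⟨hs, hsd⟩
  have hT := mellinHalf_gaussMean (L := L) hd h.measurable_truncated hs'.1
    (h.integrableOn_truncated_rpow hd hs'.2.2 hsd)
  have hΓ := gamma_half_ne_zero hs'.1
  rw [continuedMean, ← mellinHalf_eq_glue_of_lt h.measurable_neutral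
    (measurable_gaussMean h.measurable_two) (h.lower_lt hd hm) (fun t ht => h.gaussMean_two ht)
    (h.integrableOn_mellin_neutral_add hd hm) (fun σ hσ => h.integrableOn_mellin_two hd hσ) hs hsd,
    mellinHalf_add (integrableOn_mellinHalf (measurable_gaussMean h.measurable_truncated) i1)
      (integrableOn_mellinHalf (measurable_gaussEnergy h.neutral.measurable) i2), hT.2,
    longRangeMean, mul_add, inv_mul_cancel_left₀ hΓ]

theorem rieszMean_two_eq (hd : 1 ≤ d) (h : IsClustering L f c ρ₁ ρ₂ a b C)
    (hm : HasMultipoleOrder L f m) {s : ℂ} (hsd : (d : ℝ) < s.re) :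
    rieszMean L ρ₂ s = continuedMean L f ρ₁ ρ₂ c s := by
  have hs : 0 < s.re := lt_of_le_of_lt d.cast_nonneg hsd
  have hT := mellinHalf_gaussMean (L := L) hd h.measurable_two hs
    (h.integrableOn_short hd hsd (volume_wignerSeitz_ne_top L))
  rw [continuedMean, ← mellinHalf_eq_glue_of_gt h.measurable_neutral
    (measurable_gaussMean h.measurable_two) (h.lower_lt hd hm) (fun t ht => h.gaussMean_two ht)
    (h.integrableOn_mellin_neutral_add hd hm) (fun σ hσ => h.integrableOn_mellin_two hd hσ) hsd,
    hT.2, inv_mul_cancel_left₀ (gamma_half_ne_zero hs)]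

theorem hasDerivAt_rieszMean (hd : 1 ≤ d) (h : IsClustering L f c ρ₁ ρ₂ a b C) {s : ℂ}
    (h1 : (d : ℝ) - b < s.re) (h2 : s.re < d) :
    HasDerivAt (rieszMean L (truncated ρ₁ ρ₂))
      (∫ p in wignerSeitz L ×ˢ Set.univ, (truncated ρ₁ ρ₂ p : ℂ) *
        (((‖p.1 - p.2‖ : ℝ) : ℂ) ^ (-s) * (Real.log ‖p.1 - p.2‖ : ℂ) * -1)) s :=
  hasDerivAt_integral_cpow h.measurable_truncated.aestronglyMeasurable (by fun_prop)
    (ae_norm_sub_pos hd _) (fun _ hσ => h.integrableOn_truncated_rpow hd hσ.1 hσ.2) ⟨h1, h2⟩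

theorem differentiableAt_mellin_gaussEnergy (h : IsClustering L f c ρ₁ ρ₂ a b C)
    (hm : HasMultipoleOrder L f m) {s : ℂ} (h1 : (d : ℝ) - m < s.re) (h2 : s.re < d) :
    DifferentiableAt ℂ (mellinHalf (gaussEnergy L f)) s :=
  differentiableAt_mellinHalf (measurable_gaussEnergy h.neutral.measurable)
    (fun _ hσ => h.neutral.integrableOn_mellin_gaussEnergy hm hσ.1 hσ.2) ⟨h1, h2⟩

theorem differentiable_inv_gamma_half : Differentiable ℂ fun s : ℂ => (Complex.Gamma (s / 2))⁻¹ :=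
  Complex.differentiable_one_div_Gamma.comp (differentiable_id.div_const 2)

/-- Both terms are analytic without the restriction `Re s > 0`: the truncated part is kept as a
Riesz mean, and `1/Γ(s/2)` is entire. -/
theorem differentiableAt_longRangeMean (hd : 1 ≤ d) (h : IsClustering L f c ρ₁ ρ₂ a b C)
    (hm : HasMultipoleOrder L f m) {s : ℂ} (h1 : max ((d : ℝ) - m) (d - b) < s.re)
    (h2 : s.re < d) : DifferentiableAt ℂ (longRangeMean L f ρ₁ ρ₂) s := by
  rw [max_lt_iff] at h1
  exact (h.hasDerivAt_rieszMean hd h1.2 h2).differentiableAt.add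
    ((differentiable_inv_gamma_half s).mul (h.differentiableAt_mellin_gaussEnergy hm h1.1 h2))

theorem differentiableAt_glue (hd : 1 ≤ d) (h : IsClustering L f c ρ₁ ρ₂ a b C)
    (hm : HasMultipoleOrder L f m) {s : ℂ} (h1 : max 0 (max ((d : ℝ) - m) (d - b)) < s.re) :
    DifferentiableAt ℂ (mellinHalf (glue (fun t => gaussMean L (truncated ρ₁ ρ₂) t
      + gaussEnergy L f t) (gaussMean L ρ₂))) s :=
  differentiableAt_mellinHalf_glue h.measurable_neutral
    (measurable_gaussMean h.measurable_two) (h.lower_lt hd hm)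
    (h.integrableOn_mellin_neutral_add hd hm) (fun _ hσ => h.integrableOn_mellin_two hd hσ) h1

theorem meromorphicAt_continuedMean (hd : 1 ≤ d) (h : IsClustering L f c ρ₁ ρ₂ a b C)
    (hm : HasMultipoleOrder L f m) {s : ℂ} (h1 : max 0 (max ((d : ℝ) - m) (d - b)) < s.re) :
    MeromorphicAt (continuedMean L f ρ₁ ρ₂ c) s ∧
      (s ≠ (d : ℝ) → AnalyticAt ℂ (continuedMean L f ρ₁ ρ₂ c) s) := by
  have ho : IsOpen {s : ℂ | max 0 (max ((d : ℝ) - m) (d - b)) < s.re} :=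
    isOpen_lt continuous_const Complex.continuous_re
  have hA : AnalyticAt ℂ (mellinHalf (glue (fun t => gaussMean L (truncated ρ₁ ρ₂) t
      + gaussEnergy L f t) (gaussMean L ρ₂))) s :=
    DifferentiableOn.analyticAt (s := {s : ℂ | max 0 (max ((d : ℝ) - m) (d - b)) < s.re})
      (fun z hz => (h.differentiableAt_glue hd hm hz).differentiableWithinAt) (ho.mem_nhds h1)
  have hΓ : AnalyticAt ℂ (fun s : ℂ => (Complex.Gamma (s / 2))⁻¹) s :=
    differentiable_inv_gamma_half.analyticAt s
  have hsub : AnalyticAt ℂ (fun s : ℂ => s - (d : ℝ)) s := analyticAt_id.sub analyticAt_const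
  constructor
  · exact hΓ.meromorphicAt.mul (hA.meromorphicAt.add
      ((MeromorphicAt.const _ s).mul ((MeromorphicAt.const 2 s).div hsub.meromorphicAt)))
  · intro hne
    exact hΓ.mul (hA.add (analyticAt_const.mul (analyticAt_const.div hsub (sub_ne_zero.2 hne))))

theorem rieszMean_ofReal (g : Space d × Space d → ℝ) (s : ℝ) :
    rieszMean L g s = ((∫ p in wignerSeitz L ×ˢ Set.univ, g p * ‖p.1 - p.2‖ ^ (-s) : ℝ) : ℂ) := by
  rw [rieszMean, ← integral_complex_ofReal]
  refine integral_congr_ae (Eventually.of_forall fun p => ?_)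
  simp only
  rw [Complex.ofReal_mul, Complex.ofReal_cpow (norm_nonneg _), Complex.ofReal_neg]

/-- For `s ≠ 0` the potential is `sign s` times the power and `mixConst s` is `sign s / Γ(s/2)`, so
one global sign relates the energy to the continuation. -/
theorem longRangeMean_ofReal {s : ℝ} (hs : s ≠ 0) :
    longRangeMean L f ρ₁ ρ₂ s = Real.sign s * ((∫ p in wignerSeitz L ×ˢ Set.univ,
      riesz s (p.1 - p.2) * truncated ρ₁ ρ₂ p) + chargeEnergy L f s : ℝ) := by
  have hsign : Real.sign s * Real.sign s = 1 := by
    rcases hs.lt_or_gt with h | h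
    · rw [Real.sign_of_neg h]; norm_num
    · rw [Real.sign_of_pos h]; norm_num
  have hr : ∀ x : Space d, riesz s x = Real.sign s * ‖x‖ ^ (-s) := fun x => by
    rcases hs.lt_or_gt with h | h
    · rw [riesz, if_neg h.not_gt, if_neg hs, Real.sign_of_neg h, neg_one_mul]
    · rw [riesz, if_pos h, Real.sign_of_pos h, one_mul]
  have e : ∀ p : Space d × Space d, riesz s (p.1 - p.2) * truncated ρ₁ ρ₂ p
      = Real.sign s * (truncated ρ₁ ρ₂ p * ‖p.1 - p.2‖ ^ (-s)) := fun p => by rw [hr]; ring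
  simp_rw [e]
  rw [integral_const_mul, chargeEnergy, mixConst_of_ne hs, longRangeMean, rieszMean_ofReal,
    mellinHalf_ofReal, show ((s : ℂ) / 2) = ((s / 2 : ℝ) : ℂ) by push_cast; rfl,
    Complex.Gamma_ofReal, ← Complex.ofReal_inv, ← Complex.ofReal_mul, ← Complex.ofReal_add,
    ← Complex.ofReal_mul, Complex.ofReal_inj]
  rw [mul_add, ← mul_assoc, ← mul_assoc, ← mul_div_assoc, hsign]
  ring

/-- The derivative of `r ^ (-s)` at `0` is `-log r`. Writing `1/Γ(s/2) = (s/2)/Γ(s/2 + 1)`, the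
second term has as derivative half its Mellin integral, and this half is `mixConst 0`. -/
theorem hasDerivAt_longRangeMean_zero (hd : 1 ≤ d) (h : IsClustering L f c ρ₁ ρ₂ a b C)
    (hm : HasMultipoleOrder L f m) (h1 : max ((d : ℝ) - m) (d - b) < 0) :
    HasDerivAt (longRangeMean L f ρ₁ ρ₂) (((∫ p in wignerSeitz L ×ˢ Set.univ,
      riesz 0 (p.1 - p.2) * truncated ρ₁ ρ₂ p) + chargeEnergy L f 0 : ℝ) : ℂ) 0 := by
  have hd0 : (0 : ℝ) < d := by exact_mod_cast hd
  rw [max_lt_iff] at h1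
  have D1 := h.hasDerivAt_rieszMean hd (s := 0) (by simpa using h1.2) (by simpa using hd0)
  have D2 := h.differentiableAt_mellin_gaussEnergy hm (s := 0) (by simpa using h1.1)
    (by simpa using hd0)
  have D3 : DifferentiableAt ℂ (fun s : ℂ => (Complex.Gamma (s / 2 + 1))⁻¹
      * mellinHalf (gaussEnergy L f) s) 0 :=
    (Complex.differentiable_one_div_Gamma.comp
      ((differentiable_id.div_const 2).add_const 1) 0).mul D2
  have D4 := ((hasDerivAt_id (0 : ℂ)).div_const 2).mul D3.hasDerivAt
  have e : (fun s : ℂ => (Complex.Gamma (s / 2))⁻¹ * mellinHalf (gaussEnergy L f) s)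
      = fun s => s / 2 * ((Complex.Gamma (s / 2 + 1))⁻¹ * mellinHalf (gaussEnergy L f) s) := by
    funext s
    rw [Complex.one_div_Gamma_eq_self_mul_one_div_Gamma_add_one, mul_assoc]
  have D5 : HasDerivAt (fun s : ℂ => (Complex.Gamma (s / 2))⁻¹ * mellinHalf (gaussEnergy L f) s)
      ((chargeEnergy L f 0 : ℝ) : ℂ) 0 := by
    rw [e]
    refine D4.congr_deriv ?_
    have h0 := mellinHalf_ofReal (gaussEnergy L f) 0
    rw [Complex.ofReal_zero] at h0
    simp only [id, zero_div, zero_mul, add_zero, zero_add, Complex.Gamma_one, inv_one, one_mul]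
    rw [h0, chargeEnergy, mixConst, if_pos rfl]
    push_cast; rfl
  have D6 : HasDerivAt (rieszMean L (truncated ρ₁ ρ₂)) (((∫ p in wignerSeitz L ×ˢ Set.univ,
      riesz 0 (p.1 - p.2) * truncated ρ₁ ρ₂ p : ℝ)) : ℂ) 0 := by
    refine D1.congr_deriv ?_
    rw [← integral_complex_ofReal]
    refine integral_congr_ae (Eventually.of_forall fun p => ?_)
    simp only [riesz, lt_irrefl, if_false, if_true, neg_zero, Complex.cpow_zero]
    push_cast; ring
  rw [Complex.ofReal_add]
  exact D6.add D5

end IsClustering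

end Continuation

/-! ### Assembly for periodic point processes -/

section Main

variable {d : ℕ} {L : Submodule ℤ (Space d)} [DiscreteTopology L] [IsZLattice ℝ L]
  {f ρ₁ : Space d → ℝ} {ρ₂ : Space d × Space d → ℝ} {a b C c : ℝ}

/-- A periodic point process with repulsion and clustering has correlation functions as required in
`IsClustering`, with `c` its mean density. -/
theorem IsPeriodic.exists_isClustering {P : Measure (Config d)} (hper : IsPeriodic L P)
    (hρ₁ : IsOnePointCorrelation P ρ₁) (hρ₂ : IsTwoPointCorrelation P ρ₂)
    (ha : 0 < a) (hb : 0 < b) (hC : 0 < C)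
    (hrep : ∀ᵐ p : Space d × Space d, |ρ₂ p| ≤ C * Real.exp (-(1 / (C * ‖p.1 - p.2‖ ^ a))))
    (hclust : ∀ᵐ p : Space d × Space d,
      |ρ₂ p - ρ₁ p.1 * ρ₁ p.2| ≤ C / (1 + ‖p.1 - p.2‖ ^ b)) :
    ∃ f : Space d → ℝ, IsClustering L f (meanDensity L ρ₁) ρ₁ ρ₂ a b C := by
  have hA : ∀ᵐ p : Space d × Space d, |ρ₂ p| ≤ C := by
    filter_upwards [hrep] with p hp
    refine hp.trans (mul_le_of_le_one_right hC.le (Real.exp_le_one_iff.2 ?_))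
    have : 0 ≤ 1 / (C * ‖p.1 - p.2‖ ^ a) := by positivity
    linarith
  obtain ⟨K, hK0, hK⟩ := ae_onePoint_le hC hA hclust
  obtain ⟨ρ, hρm, hρK, hρp, hρe⟩ := exists_periodic_version hρ₁ (hper.onePoint hρ₁) hK0 hK
  have := isFiniteMeasure_restrict_wignerSeitz L
  have hint : IntegrableOn ρ (wignerSeitz L) :=
    Integrable.of_bound hρm.aestronglyMeasurable K (Eventually.of_forall hρK)
  refine ⟨fun x => ρ x - meanDensity L ρ₁,
    ⟨hρm.sub_const _, ⟨K + |meanDensity L ρ₁|, fun x => ?_⟩, fun z hz x => ?_, ?_⟩,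
    ?_, hρ₁.measurable, hρ₂.measurable, hper.twoPoint hρ₂, ha, hb, hC, hrep, hclust⟩
  · exact (abs_sub _ _).trans (add_le_add (hρK x) le_rfl)
  · simp only [hρp z hz]
  · rw [integral_sub hint (integrable_const _), integral_const, measureReal_restrict_apply_univ,
      smul_eq_mul, meanDensity, integral_congr_ae (ae_restrict_of_ae hρe),
      ← cellVolume, mul_inv_cancel_left₀ (cellVolume_pos L).ne', sub_self]
  · filter_upwards [hρe] with x hx
    rw [hx, sub_add_cancel]

theorem setIntegral_wignerSeitz_id : ∫ x in wignerSeitz L, x = 0 := by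
  have h := (Measure.measurePreserving_neg (volume : Measure (Space d))).setIntegral_preimage_emb
    (MeasurableEquiv.neg (Space d)).measurableEmbedding (fun x => x) (wignerSeitz L)
  rw [neg_preimage_wignerSeitz, integral_neg] at h
  have h2 : (2 : ℝ) • ∫ x in wignerSeitz L, x = 0 := by
    rw [two_smul]
    nth_rewrite 1 [← h]
    exact neg_add_cancel _
  exact (smul_eq_zero.1 h2).resolve_left two_ne_zero

namespace IsClustering

/-- The cell is symmetric about the origin, so the constant `c` has no dipole and `f` has the same
dipole as ρ₁. -/
theorem hasMultipoleOrder_four (h : IsClustering L f c ρ₁ ρ₂ a b C)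
    (h0 : ∫ y in wignerSeitz L, ρ₁ y • y = 0) : HasMultipoleOrder L f 4 := by
  refine Or.inr ⟨rfl, ?_⟩
  obtain ⟨K, hK⟩ := h.neutral.bounded
  have := isFiniteMeasure_restrict_wignerSeitz L
  have i1 : IntegrableOn (fun x : Space d => x) (wignerSeitz L) :=
    Integrable.of_bound measurable_id.aestronglyMeasurable (cellRadius L)
      ((ae_restrict_mem (measurableSet_wignerSeitz L)).mono fun x hx => norm_le_cellRadius L hx)
  have i2 : IntegrableOn (fun x : Space d => f x • x) (wignerSeitz L) :=
    i1.bdd_smul K h.neutral.measurable.aestronglyMeasurable (Eventually.of_forall hK)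
  have e : (fun x : Space d => ρ₁ x • x) =ᵐ[volume.restrict (wignerSeitz L)]
      fun x => f x • x + c • x := by
    refine ae_restrict_of_ae ?_
    filter_upwards [h.one] with x hx
    rw [hx, add_smul]
  have i3 : IntegrableOn (fun x : Space d => c • x) (wignerSeitz L) := i1.smul c
  rwa [integral_congr_ae e, integral_add i2 i3, integral_smul,
    setIntegral_wignerSeitz_id, smul_zero, add_zero] at h0

theorem longRangeEnergy_eq (h : IsClustering L f c ρ₁ ρ₂ a b C) {s : ℝ} (hs : -2 < s)
    (hsd : s < d) {V : Space d → ℝ} (hV : IsPeriodicRiesz L s V) :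
    longRangeEnergy L ρ₁ ρ₂ s V = 1 / (2 * cellVolume L) *
      ((∫ p in wignerSeitz L ×ˢ Set.univ, riesz s (p.1 - p.2) * truncated ρ₁ ρ₂ p)
        + chargeEnergy L f s) := by
  rw [longRangeEnergy, (h.neutral.integral_isPeriodicRiesz hs hsd hV h.one).2, mul_add]
  rfl

/-- The meromorphic continuation of the short-range energy. -/
def continuedEnergy (L : Submodule ℤ (Space d)) (f ρ₁ : Space d → ℝ)
    (ρ₂ : Space d × Space d → ℝ) (c : ℝ) (s : ℂ) : ℂ :=
  1 / (2 * (cellVolume L : ℂ)) *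
    if s.re < d then longRangeMean L f ρ₁ ρ₂ s else continuedMean L f ρ₁ ρ₂ c s

theorem continuedEnergy_eventuallyEq_of_lt {s : ℂ} (hs : s.re < d) :
    continuedEnergy L f ρ₁ ρ₂ c =ᶠ[𝓝 s]
      fun s => 1 / (2 * (cellVolume L : ℂ)) * longRangeMean L f ρ₁ ρ₂ s := by
  filter_upwards [(isOpen_lt Complex.continuous_re continuous_const).mem_nhds hs] with z hz
  rw [continuedEnergy, if_pos (show z.re < d from hz)]

variable {m : ℕ}

/-- The two branches agree on a strip to the left of the line `Re s = d`, so near any point of the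
line the piecewise definition is the right-hand branch, whose only possible singularity is at `s =
d`. -/
theorem continuedEnergy_eventuallyEq_of_ge (hd : 1 ≤ d) (h : IsClustering L f c ρ₁ ρ₂ a b C)
    (hm : HasMultipoleOrder L f m) {s : ℂ} (hs : (d : ℝ) ≤ s.re) :
    continuedEnergy L f ρ₁ ρ₂ c =ᶠ[𝓝 s]
      fun s => 1 / (2 * (cellVolume L : ℂ)) * continuedMean L f ρ₁ ρ₂ c s := by
  filter_upwards [(isOpen_lt continuous_const Complex.continuous_re).mem_nhds
    ((h.lower_lt hd hm).trans_le hs)] with z hz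
  rw [continuedEnergy]
  split_ifs with hlt
  · rw [h.longRangeMean_eq hd hm hz hlt]
  · rfl

theorem analyticAt_continuedEnergy_of_lt (hd : 1 ≤ d) (h : IsClustering L f c ρ₁ ρ₂ a b C)
    (hm : HasMultipoleOrder L f m) {s : ℂ} (h1 : max ((d : ℝ) - m) (d - b) < s.re)
    (h2 : s.re < d) : AnalyticAt ℂ (continuedEnergy L f ρ₁ ρ₂ c) s := by
  have hU : {s : ℂ | max ((d : ℝ) - m) (d - b) < s.re} ∩ {s : ℂ | s.re < d} ∈ 𝓝 s :=
    ((isOpen_lt continuous_const Complex.continuous_re).inter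
      (isOpen_lt Complex.continuous_re continuous_const)).mem_nhds ⟨h1, h2⟩
  have hA : AnalyticAt ℂ (longRangeMean L f ρ₁ ρ₂) s :=
    DifferentiableOn.analyticAt (fun z hz =>
      (h.differentiableAt_longRangeMean hd hm hz.1 hz.2).differentiableWithinAt) hU
  exact (analyticAt_const.mul hA).congr (continuedEnergy_eventuallyEq_of_lt h2).symm

theorem meromorphicAt_continuedEnergy (hd : 1 ≤ d) (h : IsClustering L f c ρ₁ ρ₂ a b C)
    (hm : HasMultipoleOrder L f m) {s : ℂ} (h1 : max ((d : ℝ) - m) (d - b) < s.re) :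
    MeromorphicAt (continuedEnergy L f ρ₁ ρ₂ c) s ∧
      (s ≠ (d : ℝ) → AnalyticAt ℂ (continuedEnergy L f ρ₁ ρ₂ c) s) := by
  rcases lt_or_ge s.re d with h2 | h2
  · have hA := h.analyticAt_continuedEnergy_of_lt hd hm h1 h2
    exact ⟨hA.meromorphicAt, fun _ => hA⟩
  · have e := (h.continuedEnergy_eventuallyEq_of_ge hd hm h2).symm
    obtain ⟨hM, hA⟩ := h.meromorphicAt_continuedMean hd hm ((h.lower_lt hd hm).trans_le h2)
    exact ⟨((MeromorphicAt.const _ s).mul hM).congr (e.filter_mono nhdsWithin_le_nhds),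
      fun hne => (analyticAt_const.mul (hA hne)).congr e⟩

theorem continuedEnergy_eq_shortRangeEnergy (hd : 1 ≤ d) (h : IsClustering L f c ρ₁ ρ₂ a b C)
    (hm : HasMultipoleOrder L f m) {s : ℂ} (hs : (d : ℝ) < s.re) :
    continuedEnergy L f ρ₁ ρ₂ c s = shortRangeEnergy L ρ₂ s := by
  rw [continuedEnergy, if_neg hs.not_gt, ← h.rieszMean_two_eq hd hm hs]
  rfl

theorem continuedEnergy_ofReal (h : IsClustering L f c ρ₁ ρ₂ a b C) {s : ℝ} (hs : -2 < s)
    (hsd : s < d) (h0 : s ≠ 0) {V : Space d → ℝ} (hV : IsPeriodicRiesz L s V) :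
    continuedEnergy L f ρ₁ ρ₂ c s
      = (Real.sign s : ℂ) * (longRangeEnergy L ρ₁ ρ₂ s V : ℂ) := by
  rw [continuedEnergy, if_pos (by simpa using hsd), longRangeMean_ofReal h0,
    h.longRangeEnergy_eq hs hsd hV]
  push_cast
  ring

theorem deriv_continuedEnergy_zero (hd : 1 ≤ d) (h : IsClustering L f c ρ₁ ρ₂ a b C)
    (hm : HasMultipoleOrder L f m) (h1 : max ((d : ℝ) - m) (d - b) < 0)
    {V : Space d → ℝ} (hV : IsPeriodicRiesz L 0 V) :
    deriv (continuedEnergy L f ρ₁ ρ₂ c) 0 = (longRangeEnergy L ρ₁ ρ₂ 0 V : ℂ) := by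
  have hd0 : (0 : ℝ) < d := by exact_mod_cast hd
  rw [(continuedEnergy_eventuallyEq_of_lt (s := 0) (by simpa using hd0)).deriv_eq,
    ((h.hasDerivAt_longRangeMean_zero hd hm h1).const_mul _).deriv,
    h.longRangeEnergy_eq (by norm_num) hd0 hV]
  push_cast
  ring

theorem exists_multipoleOrder (h : IsClustering L f c ρ₁ ρ₂ a b C) {m : ℝ}
    (hm : m = 2 ∨ (m = 4 ∧ (∫ y in wignerSeitz L, ρ₁ y • y) = 0)) :
    ∃ k : ℕ, (k : ℝ) = m ∧ HasMultipoleOrder L f k := by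
  rcases hm with rfl | ⟨rfl, h0⟩
  · exact ⟨2, by norm_num, Or.inl rfl⟩
  · exact ⟨4, by norm_num, h.hasMultipoleOrder_four h0⟩

end IsClustering

end Main

end RieszGas

end

open RieszGas in
theorem lemma18 (d : ℕ) (hd : 1 ≤ d)
    (L : Submodule ℤ (Space d)) [DiscreteTopology L] [IsZLattice ℝ L]
    (P : Measure (Config d)) [IsProbabilityMeasure P]
    (hper : IsPeriodic L P) (hmom : HasFiniteLocalMoments P)
    (ρ₁ : Space d → ℝ) (hρ₁ : IsOnePointCorrelation P ρ₁)
    (ρ₂ : Space d × Space d → ℝ) (hρ₂ : IsTwoPointCorrelation P ρ₂)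
    (a b C : ℝ) (ha : 0 < a) (hb : 0 < b) (hC : 0 < C)
    (hrep : ∀ᵐ p : Space d × Space d, |ρ₂ p| ≤ C * Real.exp (-(1 / (C * ‖p.1 - p.2‖ ^ a))))
    (hclust : ∀ᵐ p : Space d × Space d,
      |ρ₂ p - ρ₁ p.1 * ρ₁ p.2| ≤ C / (1 + ‖p.1 - p.2‖ ^ b)) :
    -- short range
    (∀ s : ℝ, (d : ℝ) < s →
      (∀ R : ℝ, Integrable (fun X => energy s X) (localize P (cellUnion L R))) ∧
      IntegrableOn (fun p : Space d × Space d => ρ₂ p / ‖p.1 - p.2‖ ^ s)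
        (wignerSeitz L ×ˢ Set.univ) ∧
      Tendsto
        (fun R : ℝ => (∫ X, energy s X ∂(localize P (cellUnion L R)))
          / volume.real (cellUnion L R))
        atTop
        (𝓝 (1 / (2 * cellVolume L) *
          (∫ p in wignerSeitz L ×ˢ Set.univ, ρ₂ p / ‖p.1 - p.2‖ ^ s)))) ∧
    -- the periodic potentials exist
    (∀ s : ℝ, -2 < s → s < d → ∃ V : Space d → ℝ, IsPeriodicRiesz L s V) ∧
    -- long range, with `m = 2` in general and `m = 4` without dipole
    (∀ VL : ℝ → Space d → ℝ, (∀ s : ℝ, -2 < s → s < d → IsPeriodicRiesz L s (VL s)) →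
      ∀ m : ℝ, (m = 2 ∨ (m = 4 ∧ (∫ y in wignerSeitz L, ρ₁ y • y) = 0)) →
        (∀ s : ℝ, -2 < s → max (d - m) (d - b) < s → s < d →
          (∀ R : ℝ,
            Integrable (fun X => jelliumEnergy s X (cellUnion L R) (meanDensity L ρ₁))
              (localize P (cellUnion L R))) ∧
          IntegrableOn
            (fun p : Space d × Space d => riesz s (p.1 - p.2) * (ρ₂ p - ρ₁ p.1 * ρ₁ p.2))
            (wignerSeitz L ×ˢ Set.univ) ∧
          IntegrableOn (fun p : Space d × Space d => VL s (p.1 - p.2) * ρ₁ p.1 * ρ₁ p.2)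
            (wignerSeitz L ×ˢ wignerSeitz L) ∧
          Tendsto
            (fun R : ℝ =>
              (∫ X, jelliumEnergy s X (cellUnion L R) (meanDensity L ρ₁)
                ∂(localize P (cellUnion L R))) / volume.real (cellUnion L R))
            atTop (𝓝 (longRangeEnergy L ρ₁ ρ₂ s (VL s)))) ∧
        -- analytic continuation in `s`
        (∃ F : ℂ → ℂ,
          MeromorphicOn F {s : ℂ | max (d - m) (d - b) < s.re} ∧
          AnalyticOnNhd ℂ F ({s : ℂ | max (d - m) (d - b) < s.re} \ {(d : ℂ)}) ∧
          (∀ s : ℂ, (d : ℝ) < s.re → F s = shortRangeEnergy L ρ₂ s) ∧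
          (∀ s : ℝ, -2 < s → max (d - m) (d - b) < s → s < d →
            (0 < s → (longRangeEnergy L ρ₁ ρ₂ s (VL s) : ℂ) = F s) ∧
            (s < 0 → (longRangeEnergy L ρ₁ ρ₂ s (VL s) : ℂ) = -F s) ∧
            (s = 0 → (longRangeEnergy L ρ₁ ρ₂ s (VL s) : ℂ) = deriv F 0)))) := by
  obtain ⟨f, h⟩ := hper.exists_isClustering hρ₁ hρ₂ ha hb hC hrep hclust
  refine ⟨fun s hs => h.short_range hd hρ₂ hs,
    fun s hs hsd => ⟨_, isPeriodicRiesz_periodicRiesz L hs hsd⟩, fun VL hVL m hm => ?_⟩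
  obtain ⟨k, rfl, hk⟩ := h.exists_multipoleOrder hm
  refine ⟨fun s hs hsb hsd => ?_, IsClustering.continuedEnergy L f ρ₁ ρ₂ (meanDensity L ρ₁),
    fun s hs => (h.meromorphicAt_continuedEnergy hd hk hs).1,
    fun s hs => (h.meromorphicAt_continuedEnergy hd hk hs.1).2 (by simpa using hs.2),
    fun s hs => h.continuedEnergy_eq_shortRangeEnergy hd hk hs,
    fun s hs hsb hsd => ⟨fun h0 => ?_, fun h0 => ?_, ?_⟩⟩
  · rw [max_lt_iff] at hsb
    refine ⟨fun R => (h.jellium hd hρ₁ hρ₂ hsb.2 hsd R).1,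
      h.integrableOn_long hd hsb.2 hsd (volume_wignerSeitz_ne_top L),
      (h.neutral.integral_isPeriodicRiesz hs hsd (hVL s hs hsd) h.one).1, ?_⟩
    rw [h.longRangeEnergy_eq hs hsd (hVL s hs hsd)]
    exact h.long_range hd hρ₁ hρ₂ hk hs hsb.1 hsb.2 hsd
  · rw [h.continuedEnergy_ofReal hs hsd h0.ne' (hVL s hs hsd), Real.sign_of_pos h0,
      Complex.ofReal_one, one_mul]
  · rw [h.continuedEnergy_ofReal hs hsd h0.ne (hVL s hs hsd), Real.sign_of_neg h0,
      Complex.ofReal_neg, Complex.ofReal_one, neg_one_mul, neg_neg]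
  · rintro rfl
    exact (h.deriv_continuedEnergy_zero hd hk hsb (hVL 0 hs hsd)).symm
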